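/- **Conventions.** Let $S$ be a Noetherian scheme. A *ribbon* $(C,\mathcal A)$ over $S$ consists of a flat morphism $\tau:C\to S$, locally of finite type, whose fibres $C_s$ are reduced algebraic curves over the residue fields $\kappa(s)$ (reduced, separated, of finite type, all irreducible components one-dimensional), a sheaf $\mathcal A$ of commutative $\tau^{-1}\mathcal O_S$-algebras on $C$, and a descending filtration $(\mathcal A_i)_{i\in\mathbb Z}$ of $\mathcal A$ by $\tau^{-1}\mathcal O_S$-submodules such that: $\mathcal A_i\mathcal A_j\subset\mathcal A_{i+j}$ and $1\in\mathcal A_0$; $\mathcal A_0/\mathcal A_1=\mathcal O_C$; each $\mathcal A_i/\mathcal A_{i+1}$ is a coherent sheaf on $C$, flat over $S$, whose restriction to each fibre $C_s$ has no nonzero coherent subsheaf with finite support and is isomorphic to $\mathcal O_{C_s}$ on a dense open subset of $C_s$; $\mathcal A=\varinjlim_i\mathcal A_i$ and $\mathcal A_i=\varprojlim_{j>0}\mathcal A_i/\mathcal A_{i+j}$ for all $i$. The base change of $(C,\mathcal A)$ along $\alpha:S'\to S$ has underlying scheme $C\times_SS'$ and filtered sheaf $\mathcal A'=\varinjlim_j\mathcal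 A'_j$ with $\mathcal A'_j=\varprojlim_i\,(\mathcal A_j/\mathcal A_{j+i})\boxtimes_{\mathcal O_S}\mathcal O_{S'}$, where, for a $\tau^{-1}\mathcal O_S$-module $\mathcal M$, $\mathcal M\boxtimes_{\mathcal O_S}\mathcal O_{S'}$ denotes the pullback of $\mathcal M$ to $C\times_SS'$ tensored with the pullback of $\mathcal O_{S'}$ over that of $\mathcal O_S$. The fibre $(C_s,\mathcal A_s)$ over $s\in S$ is the base change along $\operatorname{Spec}\kappa(s)\to S$; for a section $a$ of $\mathcal A$ over an open $U\subset C$ we write $a|_{U_s}$ for its image in $\mathcal A_s(U_s)$, $U_s=U\cap C_s$. A ribbon over a field satisfies $(**)$ if its curve has a cover by affine open sets $U$ for each of which there is a unit $a\in\mathcal A(U)^*$ with $a\in\mathcal A_1(U)$ and $a^{-1}\in\mathcal A_{-1}(U)$. Let $\mathcal N_S$ be the nilradical of $\mathcal O_S$, let $\mathcal N_S\mathcal A\subset\mathcal A$ and $\mathcal N_S\mathcal A_0\subset\mathcal A_0$ be the sheaves of ideals it generates, and for a $\tau^{-1}\mathcal O_S$-module $\mathcal M$ on $C$ put $\mathcal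 N_S\boxtimes\mathcal M=\tau^{-1}\mathcal N_S\otimes_{\tau^{-1}\mathcal O_S}\mathcal M$. Let $\mathbb Z_C$ be the sheaf of locally constant $\mathbb Z$-valued functions on $C$. For a section $a\in\mathcal A^*(U)$ and $x\in U$, $s=\tau(x)$, the *order* of $a$ at $x$ is $$\mathbf{ord}(a)(x)=\max\{j\in\mathbb Z \mid a|_{U_s}\in\mathcal A_{s,j}(U_s)\}.$$ **Theorem.** Let $(C,\mathcal A)$ be a ribbon over a Noetherian scheme $S$ such that for every $s\in S$ the topological space $C_s$ is irreducible and there is a point $P_s\in C_s$ with $(\mathcal A_{s,1})_{P_s}(\mathcal A_{s,-1})_{P_s}=(\mathcal A_{s,0})_{P_s}$. 1. (a) The maximum defining $\mathbf{ord}(a)(x)$ exists for all $U$, $a\in\mathcal A^*(U)$, $x\in U$, the functions $\mathbf{ord}(a)$ are locally constant, and $\mathbf{ord}:\mathcal A^*\to\mathbb Z_C$ is a morphism of sheaves of groups. (b) Every point $P_s$ as above has an affine open neighbourhood $U_{P_s}\subset C$ such that $\mathbf{ord}|_{U_{P_s}}$ is a surjective morphism of sheaves. (c) $\operatorname{Ker}(\mathbf{ord})=\mathcal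 A_0^*\cdot(1+\mathcal N_S\mathcal A)$ as subsheaves of $\mathcal A^*$, and the inclusions exhibit $\operatorname{Ker}(\mathbf{ord})$ as the amalgamated sum $$\operatorname{Ker}(\mathbf{ord})\simeq\mathcal A_0^*\coprod_{1+\mathcal N_S\mathcal A_0}(1+\mathcal N_S\mathcal A).$$ 2. If all fibres $(C_s,\mathcal A_s)$, $s\in S$, satisfy $(**)$, then $\mathbf{ord}:\mathcal A^*\to\mathbb Z_C$ is surjective on all of $C$. 3. Suppose that $S$ is a scheme over a field $k$ of characteristic zero and that all fibres $(C_s,\mathcal A_s)$ satisfy $(**)$, or that $(C,\mathcal A)$ is the base change along a morphism $S\to\operatorname{Spec}k$ of a ribbon over a field $k$ of characteristic zero satisfying $(**)$. Then there are morphisms of sheaves of groups $\exp:\mathcal N_S\boxtimes\mathcal A\to\operatorname{Ker}(\mathbf{ord})$ and $\exp:\mathcal N_S\boxtimes\mathcal A_0\to\mathcal A_0^*$ with $n\otimes a\mapsto\sum_{m\ge0}(na)^m/m!$ which, with the inclusions $\mathcal A_0^*\subset\operatorname{Ker}(\mathbf{ord})$ and $\mathcal A_0\subset\mathcal A$, make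 $\operatorname{Ker}(\mathbf{ord})$ the amalgamated sum $$\operatorname{Ker}(\mathbf{ord})=\mathcal A_0^*\coprod_{\mathcal N_S\boxtimes\mathcal A_0}\mathcal N_S\boxtimes\mathcal A,$$ and there are exact sequences of sheaves $$1\to\operatorname{Ker}(\mathbf{ord})\to\mathcal A^*\xrightarrow{\mathbf{ord}}\mathbb Z_C\to0,$$ $$0\to\mathcal N_S\boxtimes(\mathcal A/\mathcal A_0)\to\mathcal A^*/\mathcal A_0^*\to\mathbb Z_C\to0,$$ $$1\to\mathcal A_0^*\to\operatorname{Ker}(\mathbf{ord})\to\mathcal N_S\boxtimes(\mathcal A/\mathcal A_0)\to0,$$ in which the maps of the second sequence are induced by $\exp$ and $\mathbf{ord}$, and in the third one the first map is the inclusion and the second one sends $\exp(t)$ to the class of $t$ and $\mathcal A_0^*$ to $0$. -/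

import Mathlib

open CategoryTheory TopologicalSpace Opposite AlgebraicGeometry Limits TensorProduct

universe u

noncomputable section

/-! ### Sheaves of functions and subsheaves -/

namespace SheafAux

variable {T : TopCat.{u}}

/-- Restriction of dependent functions to a smaller open set. -/
def resFun {M : T → Type u} {U V : Opens T} (h : V ≤ U) (f : ∀ x : U, M x) : ∀ x : V, M x :=
  fun x => f ⟨x.1, h x.2⟩

theorem exists_glue {M : T → Type u} {ι : Type u} (U : ι → Opens T)
    (sf : ∀ i, ∀ x : U i, M x)
    (hc : ∀ i j (x : T) (hi : x ∈ U i) (hj : x ∈ U j), sf i ⟨x, hi⟩ = sf j ⟨x, hj⟩) :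
    ∃ f : ∀ x : (iSup U : Opens T), M x,
      ∀ i (x : T) (hi : x ∈ U i), f ⟨x, Opens.mem_iSup.2 ⟨i, hi⟩⟩ = sf i ⟨x, hi⟩ := by
  choose k hk using fun x : (iSup U : Opens T) => Opens.mem_iSup.1 x.2
  exact ⟨fun x => sf (k x) ⟨x.1, hk x⟩, fun i x hi => hc _ _ _ _ _⟩

/-- The presheaf of abelian groups whose sections over `U` are the members of the subgroup `H U`
of the group of all functions `x ↦ M x` on `U`. -/
def funPresheaf (M : T → Type u) [∀ x, AddCommGroup (M x)]
    (H : ∀ U : Opens T, AddSubgroup (∀ x : U, M x))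
    (hres : ∀ {U V : Opens T} (h : V ≤ U) (f), f ∈ H U → resFun h f ∈ H V) :
    TopCat.Presheaf AddCommGrpCat.{u} T where
  obj U := AddCommGrpCat.of (H U.unop)
  map {U V} i := AddCommGrpCat.ofHom
    { toFun := fun f => ⟨resFun i.unop.le f.1, hres i.unop.le f.1 f.2⟩
      map_zero' := rfl
      map_add' := fun _ _ => rfl }

/-- `funPresheaf` is a sheaf as soon as membership in `H` is a local condition. -/
def funSheaf (M : T → Type u) [∀ x, AddCommGroup (M x)]
    (H : ∀ U : Opens T, AddSubgroup (∀ x : U, M x))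
    (hres : ∀ {U V : Opens T} (h : V ≤ U) (f), f ∈ H U → resFun h f ∈ H V)
    (hloc : ∀ (U : Opens T) (f : ∀ x : U, M x),
      (∀ x : U, ∃ (V : Opens T) (h : V ≤ U), x.1 ∈ V ∧ resFun h f ∈ H V) → f ∈ H U) :
    TopCat.Sheaf AddCommGrpCat.{u} T :=
  ⟨funPresheaf M H hres, by
    apply (TopCat.Presheaf.isSheaf_iff_isSheafUniqueGluing _).2
    intro ι U sf hsf
    obtain ⟨f, hf⟩ := exists_glue (M := M) U (fun i => (sf i).1) (by
      intro i j x hi hj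
      exact congrFun (congrArg Subtype.val (hsf i j)) ⟨x, hi, hj⟩)
    refine ⟨⟨f, hloc _ _ ?_⟩, ?_, ?_⟩
    · intro x
      obtain ⟨i, hi⟩ := Opens.mem_iSup.1 x.2
      refine ⟨U i, le_iSup U i, hi, ?_⟩
      have : resFun (le_iSup U i) f = (sf i).1 := by
        funext y
        exact hf i y.1 y.2
      rw [this]
      exact (sf i).2
    · intro i
      apply Subtype.ext
      funext y
      exact hf i y.1 y.2
    · intro g hg
      apply Subtype.ext
      funext y
      obtain ⟨i, hi⟩ := Opens.mem_iSup.1 y.2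
      have h1 := congrFun (congrArg Subtype.val (hg i)) ⟨y.1, hi⟩
      exact h1.trans (hf i y.1 hi).symm⟩

/-- The presheaf of commutative rings whose sections over `U` are the members of the subring `H U`
of the ring of all functions `x ↦ M x` on `U`. -/
def ringFunPresheaf (M : T → Type u) [∀ x, CommRing (M x)]
    (H : ∀ U : Opens T, Subring (∀ x : U, M x))
    (hres : ∀ {U V : Opens T} (h : V ≤ U) (f), f ∈ H U → resFun h f ∈ H V) :
    TopCat.Presheaf CommRingCat.{u} T where
  obj U := CommRingCat.of (H U.unop)
  map {U V} i := CommRingCat.ofHom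
    { toFun := fun f => ⟨resFun i.unop.le f.1, hres i.unop.le f.1 f.2⟩
      map_one' := rfl
      map_mul' := fun _ _ => rfl
      map_zero' := rfl
      map_add' := fun _ _ => rfl }

/-- `ringFunPresheaf` is a sheaf as soon as membership in `H` is a local condition. -/
def ringFunSheaf (M : T → Type u) [∀ x, CommRing (M x)]
    (H : ∀ U : Opens T, Subring (∀ x : U, M x))
    (hres : ∀ {U V : Opens T} (h : V ≤ U) (f), f ∈ H U → resFun h f ∈ H V)
    (hloc : ∀ (U : Opens T) (f : ∀ x : U, M x),
      (∀ x : U, ∃ (V : Opens T) (h : V ≤ U), x.1 ∈ V ∧ resFun h f ∈ H V) → f ∈ H U) :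
    TopCat.Sheaf CommRingCat.{u} T :=
  ⟨ringFunPresheaf M H hres, by
    apply (TopCat.Presheaf.isSheaf_iff_isSheafUniqueGluing _).2
    intro ι U sf hsf
    obtain ⟨f, hf⟩ := exists_glue (M := M) U (fun i => (sf i).1) (by
      intro i j x hi hj
      exact congrFun (congrArg Subtype.val (hsf i j)) ⟨x, hi, hj⟩)
    refine ⟨⟨f, hloc _ _ ?_⟩, ?_, ?_⟩
    · intro x
      obtain ⟨i, hi⟩ := Opens.mem_iSup.1 x.2
      refine ⟨U i, le_iSup U i, hi, ?_⟩
      have : resFun (le_iSup U i) f = (sf i).1 := by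
        funext y
        exact hf i y.1 y.2
      rw [this]
      exact (sf i).2
    · intro i
      apply Subtype.ext
      funext y
      exact hf i y.1 y.2
    · intro g hg
      apply Subtype.ext
      funext y
      obtain ⟨i, hi⟩ := Opens.mem_iSup.1 y.2
      have h1 := congrFun (congrArg Subtype.val (hg i)) ⟨y.1, hi⟩
      exact h1.trans (hf i y.1 hi).symm⟩

/-- A subsheaf of a sheaf of abelian groups, given by subgroups of the groups of sections that
are stable under restriction and can be recognised locally. -/
def subPresheaf (F : TopCat.Sheaf AddCommGrpCat.{u} T)
    (H : ∀ U : Opens T, AddSubgroup (F.presheaf.obj (op U)))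
    (hres : ∀ {U V : Opens T} (h : V ≤ U) (f), f ∈ H U → F.presheaf.map (homOfLE h).op f ∈ H V) :
    TopCat.Presheaf AddCommGrpCat.{u} T where
  obj U := AddCommGrpCat.of (H U.unop)
  map {U V} i := AddCommGrpCat.ofHom
    { toFun := fun f => ⟨F.presheaf.map i f.1, hres i.unop.le f.1 f.2⟩
      map_zero' := by ext; simp
      map_add' := fun _ _ => by ext; simp }
  map_id U := by ext f; simp
  map_comp i j := by ext f; simp

def subSheaf (F : TopCat.Sheaf AddCommGrpCat.{u} T)
    (H : ∀ U : Opens T, AddSubgroup (F.presheaf.obj (op U)))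
    (hres : ∀ {U V : Opens T} (h : V ≤ U) (f), f ∈ H U → F.presheaf.map (homOfLE h).op f ∈ H V)
    (hloc : ∀ (U : Opens T) (f : F.presheaf.obj (op U)),
      (∀ x ∈ U, ∃ (V : Opens T) (h : V ≤ U), x ∈ V ∧ F.presheaf.map (homOfLE h).op f ∈ H V) →
        f ∈ H U) :
    TopCat.Sheaf AddCommGrpCat.{u} T :=
  ⟨subPresheaf F H hres, by
    apply (TopCat.Presheaf.isSheaf_iff_isSheafUniqueGluing _).2
    intro ι U sf hsf
    obtain ⟨f, hf, hu⟩ := F.existsUnique_gluing U (fun i => (sf i).1)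
      (fun i j => congrArg Subtype.val (hsf i j))
    refine ⟨⟨f, hloc _ _ ?_⟩, ?_, ?_⟩
    · intro x hx
      obtain ⟨i, hi⟩ := Opens.mem_iSup.1 hx
      refine ⟨U i, le_iSup U i, hi, ?_⟩
      have h1 : F.presheaf.map (homOfLE (le_iSup U i)).op f = (sf i).1 := hf i
      rw [h1]
      exact (sf i).2
    · intro i
      exact Subtype.ext (hf i)
    · intro g hg
      exact Subtype.ext (hu g.1 fun i => congrArg Subtype.val (hg i))⟩

/-- The inclusion of a subsheaf. -/
def subSheafι (F : TopCat.Sheaf AddCommGrpCat.{u} T)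
    (H : ∀ U : Opens T, AddSubgroup (F.presheaf.obj (op U)))
    (hres : ∀ {U V : Opens T} (h : V ≤ U) (f), f ∈ H U → F.presheaf.map (homOfLE h).op f ∈ H V)
    (hloc) : subSheaf F H hres hloc ⟶ F :=
  ⟨{ app := fun U => AddCommGrpCat.ofHom (H U.unop).subtype
     naturality := fun _ _ _ => rfl }⟩

/-- The inclusion of a subsheaf into a larger one. -/
def subSheafIncl (F : TopCat.Sheaf AddCommGrpCat.{u} T)
    (H H' : ∀ U : Opens T, AddSubgroup (F.presheaf.obj (op U)))
    (hle : ∀ U, H U ≤ H' U) (hres) (hloc) (hres') (hloc') :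
    subSheaf F H hres hloc ⟶ subSheaf F H' hres' hloc' :=
  ⟨{ app := fun U => AddCommGrpCat.ofHom (AddSubgroup.inclusion (hle U.unop))
     naturality := fun _ _ _ => rfl }⟩

/-- The sheaf of locally constant integer-valued functions. -/
def constZ (T : TopCat.{u}) : TopCat.Sheaf AddCommGrpCat.{u} T :=
  funSheaf (fun _ => ULift.{u} ℤ)
    (fun U =>
      { carrier := {f | IsLocallyConstant f}
        zero_mem' := IsLocallyConstant.const 0
        add_mem' := fun hf hg => hf.add hg
        neg_mem' := fun hf => hf.neg })
    (fun {U V} h f hf => IsLocallyConstant.comp_continuous hf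
      (f := fun x : V => (⟨x.1, h x.2⟩ : U)) (by fun_prop))
    (by
      intro U f hf
      refine (IsLocallyConstant.iff_exists_open f).2 fun x => ?_
      obtain ⟨V, h, hx, hV⟩ := hf x
      obtain ⟨W, hW, hxW, hc⟩ := (IsLocallyConstant.iff_exists_open _).1 hV ⟨x.1, hx⟩
      obtain ⟨W', hW', rfl⟩ := isOpen_induced_iff.1 hW
      refine ⟨{y : U | y.1 ∈ W' ∧ y.1 ∈ V}, ?_, ⟨hxW, hx⟩, fun y hy => hc ⟨y.1, hy.2⟩ hy.1⟩
      exact (hW'.inter V.isOpen).preimage continuous_subtype_val)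

end SheafAux

/-! ### Completion of a filtered ring -/

/-- A descending exhaustive multiplicative filtration of a commutative ring, indexed by `ℤ`. -/
structure RingFiltration (R : Type u) [CommRing R] where
  F : ℤ → AddSubgroup R
  anti : Antitone F
  one_mem : (1 : R) ∈ F 0
  mul_mem : ∀ {i j : ℤ} {a b : R}, a ∈ F i → b ∈ F j → a * b ∈ F (i + j)
  exhaust : ∀ a : R, ∃ i, a ∈ F i

namespace RingFiltration

variable {R : Type u} [CommRing R] (𝓕 : RingFiltration R)

theorem exists_bound {c : ℕ → R} (hc : ∀ i : ℤ, ∃ N, ∀ m ≥ N, c m - c N ∈ 𝓕.F i) :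
    ∃ (i : ℤ) (N : ℕ), ∀ m ≥ N, c m ∈ 𝓕.F i := by
  obtain ⟨N, hN⟩ := hc 0
  obtain ⟨i, hi⟩ := 𝓕.exhaust (c N)
  refine ⟨min i 0, N, fun m hm => ?_⟩
  have := (𝓕.F (min i 0)).add_mem (𝓕.anti (min_le_right i 0) (hN m hm))
    (𝓕.anti (min_le_left i 0) hi)
  simpa using this

/-- The ring of Cauchy sequences. -/
def cauchy : Subring (ℕ → R) where
  carrier := {c | ∀ i : ℤ, ∃ N, ∀ m ≥ N, c m - c N ∈ 𝓕.F i}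
  zero_mem' := fun i => ⟨0, fun m _ => by simp⟩
  one_mem' := fun i => ⟨0, fun m _ => by simp⟩
  neg_mem' := fun {c} hc i => by
    obtain ⟨N, hN⟩ := hc i
    refine ⟨N, fun m hm => ?_⟩
    have := (𝓕.F i).neg_mem (hN m hm)
    simpa [neg_add_eq_sub] using this
  add_mem' := fun {c d} hc hd i => by
    obtain ⟨N, hN⟩ := hc i
    obtain ⟨M, hM⟩ := hd i
    refine ⟨max N M, fun m hm => ?_⟩
    have h1 := (𝓕.F i).sub_mem (hN m (le_trans (le_max_left _ _) hm))
      (hN (max N M) (le_max_left _ _))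
    have h2 := (𝓕.F i).sub_mem (hM m (le_trans (le_max_right _ _) hm))
      (hM (max N M) (le_max_right _ _))
    have := (𝓕.F i).add_mem h1 h2
    convert this using 1
    simp only [Pi.add_apply]
    ring
  mul_mem' := fun {c d} hc hd i => by
    obtain ⟨p, P, hP⟩ := 𝓕.exists_bound hc
    obtain ⟨q, Q, hQ⟩ := 𝓕.exists_bound hd
    obtain ⟨N, hN⟩ := hc (i - q)
    obtain ⟨M, hM⟩ := hd (i - p)
    set K := max (max P Q) (max N M) with hK
    have hPK : P ≤ K := by omega
    have hQK : Q ≤ K := by omega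
    have hNK : N ≤ K := by omega
    have hMK : M ≤ K := by omega
    refine ⟨K, fun m hm => ?_⟩
    have h1 := (𝓕.F (i - q)).sub_mem (hN m (hNK.trans hm)) (hN K hNK)
    have h2 := (𝓕.F (i - p)).sub_mem (hM m (hMK.trans hm)) (hM K hMK)
    have h3 := 𝓕.mul_mem h1 (hQ m (hQK.trans hm))
    have h4 := 𝓕.mul_mem (hP K hPK) h2
    rw [show i - q + q = i by ring] at h3
    rw [show p + (i - p) = i by ring] at h4
    have := (𝓕.F i).add_mem h3 h4
    convert this using 1
    simp only [Pi.mul_apply]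
    ring

/-- The ideal of null sequences. -/
def null : Ideal 𝓕.cauchy where
  carrier := {c | ∀ i : ℤ, ∃ N, ∀ m ≥ N, c.1 m ∈ 𝓕.F i}
  zero_mem' := fun i => ⟨0, fun m _ => (𝓕.F i).zero_mem⟩
  add_mem' := fun {c d} hc hd i => by
    obtain ⟨N, hN⟩ := hc i
    obtain ⟨M, hM⟩ := hd i
    exact ⟨max N M, fun m hm => (𝓕.F i).add_mem (hN m (le_trans (le_max_left _ _) hm))
      (hM m (le_trans (le_max_right _ _) hm))⟩
  smul_mem' := fun c d hd i => by
    obtain ⟨p, P, hP⟩ := 𝓕.exists_bound c.2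
    obtain ⟨N, hN⟩ := hd (i - p)
    refine ⟨max P N, fun m hm => ?_⟩
    have := 𝓕.mul_mem (hP m (le_trans (le_max_left _ _) hm)) (hN m (le_trans (le_max_right _ _) hm))
    rw [show p + (i - p) = i by ring] at this
    exact this

/-- The completion `lim_j R / F j` of a filtered ring, realised as Cauchy sequences modulo null
sequences. -/
def Completion : Type u := 𝓕.cauchy ⧸ 𝓕.null

instance : CommRing 𝓕.Completion := inferInstanceAs (CommRing (𝓕.cauchy ⧸ 𝓕.null))

/-- The class of a Cauchy sequence in the completion. -/
def classOf : 𝓕.cauchy →+* 𝓕.Completion := Ideal.Quotient.mk 𝓕.null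

/-- The canonical map to the completion. -/
def incl : R →+* 𝓕.Completion :=
  𝓕.classOf.comp
    { toFun := fun a => ⟨fun _ => a, fun i => ⟨0, fun m _ => by simp⟩⟩
      map_one' := rfl
      map_mul' := fun _ _ => rfl
      map_zero' := rfl
      map_add' := fun _ _ => rfl }

/-- The filtration of the completion: classes of Cauchy sequences with almost all terms
in `F i`. -/
def complFil (i : ℤ) : AddSubgroup 𝓕.Completion :=
  AddSubgroup.map 𝓕.classOf.toAddMonoidHom
    { carrier := {c : 𝓕.cauchy | ∃ N, ∀ m ≥ N, c.1 m ∈ 𝓕.F i}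
      zero_mem' := ⟨0, fun _ _ => (𝓕.F i).zero_mem⟩
      neg_mem' := fun ⟨N, hN⟩ => ⟨N, fun m hm => (𝓕.F i).neg_mem (hN m hm)⟩
      add_mem' := fun ⟨N, hN⟩ ⟨M, hM⟩ => ⟨max N M, fun m hm =>
        (𝓕.F i).add_mem (hN m (le_trans (le_max_left _ _) hm))
          (hM m (le_trans (le_max_right _ _) hm))⟩ }

theorem complFil_anti : Antitone 𝓕.complFil := by
  rintro i j hij _ ⟨c, ⟨N, hN⟩, rfl⟩
  exact ⟨c, ⟨N, fun m hm => 𝓕.anti hij (hN m hm)⟩, rfl⟩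

theorem incl_mem {i : ℤ} {a : R} (ha : a ∈ 𝓕.F i) : 𝓕.incl a ∈ 𝓕.complFil i :=
  ⟨⟨fun _ => a, fun i => ⟨0, fun m _ => by simp⟩⟩, ⟨0, fun _ _ => ha⟩, rfl⟩

theorem one_mem_complFil : (1 : 𝓕.Completion) ∈ 𝓕.complFil 0 := by
  have := 𝓕.incl_mem 𝓕.one_mem
  rwa [map_one] at this

theorem complFil_mul {i j : ℤ} {a b : 𝓕.Completion} (ha : a ∈ 𝓕.complFil i)
    (hb : b ∈ 𝓕.complFil j) : a * b ∈ 𝓕.complFil (i + j) := by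
  obtain ⟨c, ⟨N, hN⟩, rfl⟩ := ha
  obtain ⟨d, ⟨M, hM⟩, rfl⟩ := hb
  exact ⟨c * d, ⟨max N M, fun m hm => 𝓕.mul_mem (hN m (le_trans (le_max_left _ _) hm))
          (hM m (le_trans (le_max_right _ _) hm))⟩, rfl⟩

theorem mem_of_approx {f : 𝓕.Completion} {a : R} {p : ℤ} (h : f - 𝓕.incl a ∈ 𝓕.complFil 0)
    (ha : a ∈ 𝓕.F p) : f ∈ 𝓕.complFil (min p 0) := by
  have := AddSubgroup.add_mem _ (𝓕.complFil_anti (min_le_right p 0) h)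
    (𝓕.complFil_anti (min_le_left p 0) (𝓕.incl_mem ha))
  rwa [sub_add_cancel] at this

theorem mul_approx {i P Q : ℤ} {f g : 𝓕.Completion} {a b : R} (hf : f ∈ 𝓕.complFil P)
    (hg : g ∈ 𝓕.complFil Q) (ha : f - 𝓕.incl a ∈ 𝓕.complFil (i - Q))
    (hb : g - 𝓕.incl b ∈ 𝓕.complFil (max Q (i - P))) :
    f * g - 𝓕.incl (a * b) ∈ 𝓕.complFil i := by
  have hb' : 𝓕.incl b ∈ 𝓕.complFil Q := by
    have := AddSubgroup.sub_mem _ hg (𝓕.complFil_anti (le_max_left _ _) hb)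
    rwa [sub_sub_cancel] at this
  have h1 := 𝓕.complFil_mul hf (𝓕.complFil_anti (le_max_right _ _) hb)
  have h2 := 𝓕.complFil_mul ha hb'
  rw [show P + (i - P) = i by ring] at h1
  rw [show i - Q + Q = i by ring] at h2
  have h3 : f * g - 𝓕.incl (a * b) = f * (g - 𝓕.incl b) + (f - 𝓕.incl a) * 𝓕.incl b := by
    rw [map_mul]; ring
  rw [h3]
  exact AddSubgroup.add_mem _ h1 h2

end RingFiltration

/-! ### Filtered sheaves of rings -/

/-- A sheaf of commutative rings `𝒜` on `T` with a descending filtration by subsheaves of abelian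
groups `𝒜_i`, `i ∈ ℤ`, such that `𝒜_i 𝒜_j ⊆ 𝒜_{i+j}`, `1 ∈ 𝒜_0` and `𝒜 = colim 𝒜_i`
(every section lies locally in some `𝒜_i`). -/
structure FilteredRingSheaf (T : TopCat.{u}) where
  sheaf : TopCat.Sheaf CommRingCat.{u} T
  fil : ℤ → ∀ U : Opens T, AddSubgroup (sheaf.presheaf.obj (op U))
  fil_anti : ∀ U, Antitone fun i => fil i U
  fil_res : ∀ (i : ℤ) {U V : Opens T} (h : V ≤ U) {a}, a ∈ fil i U →
    sheaf.presheaf.map (homOfLE h).op a ∈ fil i V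
  fil_local : ∀ (i : ℤ) (U : Opens T) (a : sheaf.presheaf.obj (op U)),
    (∀ x ∈ U, ∃ (V : Opens T) (h : V ≤ U), x ∈ V ∧ sheaf.presheaf.map (homOfLE h).op a ∈ fil i V) →
      a ∈ fil i U
  one_mem : ∀ U, (1 : sheaf.presheaf.obj (op U)) ∈ fil 0 U
  mul_mem : ∀ {i j : ℤ} {U : Opens T} {a b : sheaf.presheaf.obj (op U)},
    a ∈ fil i U → b ∈ fil j U → a * b ∈ fil (i + j) U
  exhaust : ∀ (U : Opens T) (a : sheaf.presheaf.obj (op U)), ∀ x ∈ U,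
    ∃ (V : Opens T) (h : V ≤ U) (i : ℤ), x ∈ V ∧ sheaf.presheaf.map (homOfLE h).op a ∈ fil i V

namespace FilteredRingSheaf

variable {T : TopCat.{u}} (A : FilteredRingSheaf T)

/-- The ring of sections `𝒜(U)`. -/
abbrev sec (U : Opens T) : Type u := A.sheaf.presheaf.obj (op U)

/-- Restriction of sections. -/
def res {U V : Opens T} (h : V ≤ U) : A.sec U →+* A.sec V :=
  (A.sheaf.presheaf.map (homOfLE h).op).hom

/-- The stalk `𝒜_x`. -/
abbrev stalk (x : T) : Type u := A.sheaf.presheaf.stalk x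

/-- The germ of a section. -/
def germ {U : Opens T} {x : T} (hx : x ∈ U) : A.sec U →+* A.stalk x :=
  (A.sheaf.presheaf.germ U x hx).hom

theorem germ_res {U V : Opens T} (h : V ≤ U) {x : T} (hx : x ∈ V) (a : A.sec U) :
    A.germ hx (A.res h a) = A.germ (h hx) a :=
  TopCat.Presheaf.germ_res_apply A.sheaf.presheaf (homOfLE h) x hx a

theorem exists_germ (x : T) (t : A.stalk x) :
    ∃ (U : Opens T) (hx : x ∈ U) (a : A.sec U), A.germ hx a = t :=
  TopCat.Presheaf.exists_germ_eq A.sheaf.presheaf t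

/-- The subring `𝒜_0(U)` of `𝒜(U)`. -/
def zeroRing (U : Opens T) : Subring (A.sec U) where
  carrier := A.fil 0 U
  zero_mem' := (A.fil 0 U).zero_mem
  one_mem' := A.one_mem U
  add_mem' := (A.fil 0 U).add_mem
  neg_mem' := (A.fil 0 U).neg_mem
  mul_mem' := fun ha hb => by simpa using A.mul_mem ha hb

/-- The stalk `𝒜_{i,x} ⊆ 𝒜_x`. -/
def stalkFil (i : ℤ) (x : T) : AddSubgroup (A.stalk x) where
  carrier := {t | ∃ (U : Opens T) (hx : x ∈ U) (a : A.sec U), a ∈ A.fil i U ∧ A.germ hx a = t}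
  zero_mem' := ⟨⊤, trivial, 0, (A.fil i _).zero_mem, map_zero _⟩
  neg_mem' := by
    rintro _ ⟨U, hx, a, ha, rfl⟩
    exact ⟨U, hx, -a, (A.fil i _).neg_mem ha, map_neg _ _⟩
  add_mem' := by
    rintro _ _ ⟨U, hx, a, ha, rfl⟩ ⟨V, hy, b, hb, rfl⟩
    have hxy : x ∈ U ⊓ V := ⟨hx, hy⟩
    refine ⟨U ⊓ V, hxy, A.res inf_le_left a + A.res inf_le_right b,
      (A.fil i _).add_mem (A.fil_res i _ ha) (A.fil_res i _ hb), ?_⟩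
    rw [map_add, A.germ_res _ hxy, A.germ_res _ hxy]

/-- The filtration of the stalk `𝒜_x` by the `𝒜_{i,x}`. -/
def stalkFiltration (x : T) : RingFiltration (A.stalk x) where
  F i := A.stalkFil i x
  anti := by
    rintro _ _ hij _ ⟨U, hx, a, ha, rfl⟩
    exact ⟨U, hx, a, A.fil_anti U hij ha, rfl⟩
  one_mem := ⟨⊤, trivial, 1, A.one_mem _, map_one _⟩
  mul_mem := by
    rintro i j _ _ ⟨U, hx, a, ha, rfl⟩ ⟨V, hy, b, hb, rfl⟩
    have hxy : x ∈ U ⊓ V := ⟨hx, hy⟩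
    refine ⟨U ⊓ V, hxy, A.res inf_le_left a * A.res inf_le_right b,
      A.mul_mem (A.fil_res i _ ha) (A.fil_res j _ hb), ?_⟩
    rw [map_mul, A.germ_res _ hxy, A.germ_res _ hxy]
  exhaust := by
    intro t
    obtain ⟨U, hx, a, rfl⟩ := A.exists_germ x t
    obtain ⟨V, h, i, hV, hi⟩ := A.exhaust U a x hx
    exact ⟨i, V, hV, A.res h a, hi, A.germ_res h hV a⟩

/-- The filtration is complete: `𝒜_i = lim_{j > 0} 𝒜_i / 𝒜_{i+j}` as sheaves, for all `i`.
A section of the sheaf `𝒜_i / 𝒜_{i+j}` over `U` is a family of germs `g j x ∈ 𝒜_{i,x}`, taken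
modulo `𝒜_{i+j,x}`, which is locally represented by sections of `𝒜_i`. -/
def IsComplete : Prop :=
  ∀ (i : ℤ) (U : Opens T) (g : ℕ → ∀ x : U, A.stalk x.1),
    (∀ j : ℕ, 0 < j → ∀ x : U, ∃ (V : Opens T) (hV : V ≤ U) (b : A.sec V), x.1 ∈ V ∧ b ∈ A.fil i V ∧
      ∀ y (hy : y ∈ V), A.germ hy b - g j ⟨y, hV hy⟩ ∈ A.stalkFil (i + j) y) →
    (∀ j : ℕ, 0 < j → ∀ x : U, g (j + 1) x - g j x ∈ A.stalkFil (i + j) x.1) →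
    ∃! a : A.sec U, a ∈ A.fil i U ∧
      ∀ j : ℕ, 0 < j → ∀ x : U, A.germ x.2 a - g j x ∈ A.stalkFil (i + j) x.1

/-- The stalks at `x` satisfy `𝒜_{1,x} 𝒜_{-1,x} = 𝒜_{0,x}`, where the left-hand side is the
additive group generated by the products. -/
def IsInvertibleAt (x : T) : Prop :=
  AddSubgroup.closure {t | ∃ a ∈ A.stalkFil 1 x, ∃ b ∈ A.stalkFil (-1) x, a * b = t} =
    A.stalkFil 0 x

end FilteredRingSheaf

/-- A filtered sheaf of rings whose sections are functions `x ↦ M x` satisfying a local condition,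
filtered by the pointwise conditions `f x ∈ G i x`. -/
def FilteredRingSheaf.ofFun {T : TopCat.{u}} (M : T → Type u) [∀ x, CommRing (M x)]
    (H : ∀ U : Opens T, Subring (∀ x : U, M x))
    (hres : ∀ {U V : Opens T} (h : V ≤ U) (f), f ∈ H U → SheafAux.resFun h f ∈ H V)
    (hloc : ∀ (U : Opens T) (f : ∀ x : U, M x),
      (∀ x : U, ∃ (V : Opens T) (h : V ≤ U), x.1 ∈ V ∧ SheafAux.resFun h f ∈ H V) → f ∈ H U)
    (G : ℤ → ∀ x, AddSubgroup (M x)) (hanti : ∀ x, Antitone fun i => G i x)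
    (hone : ∀ x, 1 ∈ G 0 x)
    (hmul : ∀ {i j : ℤ} {x : T} {a b : M x}, a ∈ G i x → b ∈ G j x → a * b ∈ G (i + j) x)
    (hex : ∀ (U : Opens T) (f : ∀ x : U, M x), f ∈ H U → ∀ x ∈ U, ∃ (V : Opens T) (h : V ≤ U)
      (i : ℤ), x ∈ V ∧ ∀ y : V, SheafAux.resFun h f y ∈ G i y.1) :
    FilteredRingSheaf T where
  sheaf := SheafAux.ringFunSheaf M H hres hloc
  fil i U :=
    { carrier := {f : H U | ∀ y : U, f.1 y ∈ G i y.1}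
      zero_mem' := fun _ => AddSubgroup.zero_mem _
      add_mem' := fun hf hg y => AddSubgroup.add_mem _ (hf y) (hg y)
      neg_mem' := fun hf y => AddSubgroup.neg_mem _ (hf y) }
  fil_anti _ _ _ hij _ hf y := hanti _ hij (hf y)
  fil_res _ _ _ h _ ha y := ha ⟨y.1, h y.2⟩
  fil_local _ _ _ h y := by
    obtain ⟨V, hV, hy, hm⟩ := h y.1 y.2
    exact hm ⟨y.1, hy⟩
  one_mem _ _ := hone _
  mul_mem ha hb y := hmul (ha y) (hb y)
  exhaust U f x hx := hex U f.1 f.2 x hx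

/-- Condition `(**)` for a filtered sheaf of rings on a scheme: there is an affine open cover such
that over each member `U` some `a ∈ 𝒜_1(U)` is invertible in `𝒜(U)` with `a⁻¹ ∈ 𝒜_{-1}(U)`. -/
def FilteredRingSheaf.StarStar {C : Scheme.{u}} (A : FilteredRingSheaf C.carrier) : Prop :=
  ∃ 𝒰 : Set C.Opens, (∀ x : C, ∃ U ∈ 𝒰, x ∈ U) ∧ ∀ U ∈ 𝒰, IsAffineOpen U ∧
    ∃ a : (A.sec U)ˣ, (a : A.sec U) ∈ A.fil 1 U ∧ ((a⁻¹ : (A.sec U)ˣ) : A.sec U) ∈ A.fil (-1) U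

/-! ### Ribbons -/

/-- A (nonempty or empty) reduced algebraic curve over a field, given by its structure morphism:
a reduced separated scheme of finite type all of whose irreducible components are
one-dimensional. -/
structure IsReducedCurve {Y : Scheme.{u}} {K : CommRingCat.{u}} (f : Y ⟶ Spec K) : Prop where
  isReduced : IsReduced Y
  separated : IsSeparated f
  locallyOfFiniteType : LocallyOfFiniteType f
  quasiCompact : QuasiCompact f
  dim_one : ∀ Z ∈ irreducibleComponents Y, topologicalKrullDim Z = 1

/-- The data underlying a ribbon over `S`: a morphism `τ : C ⟶ S`, a filtered sheaf of rings `𝒜`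
on `C`, a `τ⁻¹𝒪_S`-algebra structure on `𝒜` (in its adjoint form `𝒪_S → τ_* 𝒜`) for which the
`𝒜_i` are `τ⁻¹𝒪_S`-submodules (as `1 ∈ 𝒜_0`, this says that `τ⁻¹𝒪_S` maps to `𝒜_0`), and a
homomorphism of sheaves of `τ⁻¹𝒪_S`-algebras `𝒜_0 → 𝒪_C`. -/
structure PreRibbon (S : Scheme.{u}) where
  C : Scheme.{u}
  τ : C ⟶ S
  A : FilteredRingSheaf C.carrier
  alg : S.presheaf ⟶ (TopCat.Presheaf.pushforward CommRingCat.{u} τ.base).obj A.sheaf.presheaf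
  alg_mem : ∀ (V : S.Opens) (r : Γ(S, V)), alg.app (op V) r ∈ A.fil 0 (τ ⁻¹ᵁ V)
  residue : ∀ U : C.Opens, A.zeroRing U →+* Γ(C, U)
  residue_res : ∀ {U V : C.Opens} (h : V ≤ U) (a : A.zeroRing U),
    residue V ⟨A.res h a, A.fil_res 0 h a.2⟩ = C.presheaf.map (homOfLE h).op (residue U a)
  residue_alg : ∀ (V : S.Opens) (r : Γ(S, V)),
    residue (τ ⁻¹ᵁ V) ⟨alg.app (op V) r, alg_mem V r⟩ = τ.app V r

namespace PreRibbon

variable {S : Scheme.{u}} (X : PreRibbon S)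

/-- The structure map `𝒪_S(V) → 𝒜(U)` for `U ⊆ τ⁻¹V`. -/
def algMap {V : S.Opens} {U : X.C.Opens} (h : U ≤ X.τ ⁻¹ᵁ V) : Γ(S, V) →+* X.A.sec U :=
  (X.A.res h).comp (X.alg.app (op V)).hom

theorem algMap_mem {V : S.Opens} {U : X.C.Opens} (h : U ≤ X.τ ⁻¹ᵁ V) (r : Γ(S, V)) :
    X.algMap h r ∈ X.A.fil 0 U :=
  X.A.fil_res 0 h (X.alg_mem V r)

/-- The local ring `𝒪_{S, τ(x)}`. -/
abbrev baseStalk (x : X.C) : Type u := S.presheaf.stalk (X.τ x)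

/-- The structure map `𝒪_{S, τ(x)} → 𝒜_x`. -/
def stalkAlg (x : X.C) : X.baseStalk x →+* X.A.stalk x :=
  ((TopCat.Presheaf.stalkFunctor CommRingCat.{u} (X.τ x)).map X.alg ≫
    TopCat.Presheaf.stalkPushforward CommRingCat.{u} X.τ.base X.A.sheaf.presheaf x).hom

theorem stalkAlg_germ {V : S.Opens} (x : X.C) (hx : X.τ x ∈ V) (r : Γ(S, V)) :
    X.stalkAlg x (S.presheaf.germ V (X.τ x) hx r) =
      X.A.germ (U := X.τ ⁻¹ᵁ V) hx (X.alg.app (op V) r) := by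
  have h1 := TopCat.Presheaf.stalkFunctor_map_germ_apply V (X.τ x) hx X.alg r
  have h2 := TopCat.Presheaf.stalkPushforward_germ_apply CommRingCat.{u} X.τ.base
    X.A.sheaf.presheaf V x hx (X.alg.app (op V) r)
  exact (congrArg _ h1).trans h2

instance stalkAlgebra (x : X.C) : Algebra (X.baseStalk x) (X.A.stalk x) :=
  (X.stalkAlg x).toAlgebra

/-- `𝒜_{i,x}` as an `𝒪_{S, τ(x)}`-submodule of `𝒜_x`. -/
def stalkSub (i : ℤ) (x : X.C) : Submodule (X.baseStalk x) (X.A.stalk x) where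
  __ := X.A.stalkFil i x
  smul_mem' := by
    rintro r t ht
    obtain ⟨V, hV, r, rfl⟩ := S.presheaf.exists_germ_eq r
    have h1 : X.stalkAlg x (S.presheaf.germ V (X.τ x) hV r) ∈ X.A.stalkFil 0 x :=
      ⟨X.τ ⁻¹ᵁ V, hV, _, X.alg_mem V r, (X.stalkAlg_germ x hV r).symm⟩
    have := (X.A.stalkFiltration x).mul_mem h1 ht
    rw [zero_add] at this
    exact this

/-- The stalk at `x` of `𝒜_i / 𝒜_{i+1}`. -/
abbrev grStalk (i : ℤ) (x : X.C) : Type u :=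
  X.stalkSub i x ⧸ (X.stalkSub (i + 1) x).submoduleOf (X.stalkSub i x)

/-- `𝒜_i / 𝒜_{i+1}` is a coherent `𝒜_0 / 𝒜_1`-module, in the form appropriate for a locally
Noetherian scheme `C` with `𝒜_0 / 𝒜_1 = 𝒪_C`: it is locally finitely presented. Around each
point there are sections `g_1, …, g_n` of `𝒜_i` and functions `r_{lk}` (`l = 1, …, m`), lifted to
`𝒜_0`, such that the `g_k` generate all stalks of `𝒜_i / 𝒜_{i+1}`, are subject to the relations
`∑ r_{lk} g_k = 0`, and these generate all the relations on all stalks. -/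
def GrCoherent (i : ℤ) : Prop :=
  ∀ x : X.C, ∃ (W : X.C.Opens) (n m : ℕ) (g : Fin n → X.A.sec W) (r : Fin m → Fin n → X.A.sec W),
    x ∈ W ∧ (∀ k, g k ∈ X.A.fil i W) ∧ (∀ l k, r l k ∈ X.A.fil 0 W) ∧
    ∀ y (hy : y ∈ W),
      (∀ a ∈ X.A.stalkFil i y, ∃ c : Fin n → X.A.stalk y, (∀ k, c k ∈ X.A.stalkFil 0 y) ∧
        a - ∑ k, c k * X.A.germ hy (g k) ∈ X.A.stalkFil (i + 1) y) ∧
      (∀ l, ∑ k, X.A.germ hy (r l k) * X.A.germ hy (g k) ∈ X.A.stalkFil (i + 1) y) ∧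
      (∀ c : Fin n → X.A.stalk y, (∀ k, c k ∈ X.A.stalkFil 0 y) →
        ∑ k, c k * X.A.germ hy (g k) ∈ X.A.stalkFil (i + 1) y →
        ∃ d : Fin m → X.A.stalk y, (∀ l, d l ∈ X.A.stalkFil 0 y) ∧
          ∀ k, c k - ∑ l, d l * X.A.germ hy (r l k) ∈ X.A.stalkFil 1 y)

/-- The submodule `𝒜_{i+1,x} + 𝔪 𝒜_{i,x}` of `𝒜_{i,x}`, where `𝔪` is the maximal ideal of
`𝒪_{S, τ(x)}`: for `s = τ(x)` the stalk at `x` of the restriction of `𝒜_i / 𝒜_{i+1}` to the fibre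
`C_s` is `𝒜_{i,x}` modulo this submodule. -/
def fiberGrSub (i : ℤ) (x : X.C) : Submodule (X.baseStalk x) (X.A.stalk x) :=
  X.stalkSub (i + 1) x ⊔ IsLocalRing.maximalIdeal (X.baseStalk x) • X.stalkSub i x

/-- The restriction of `𝒜_i / 𝒜_{i+1}` to the fibre `C_s` has no nonzero coherent subsheaf with
finite support; equivalently, no nonzero local section with finite support. As sections of the
restriction lift locally to sections of `𝒜_i`, it is enough to consider those. -/
def FiberTorsionFree (i : ℤ) (s : S) : Prop :=
  ∀ (U : X.C.Opens) (b : X.A.sec U), b ∈ X.A.fil i U →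
    {y : X.τ.fiber s | ∃ hy : X.τ.fiberι s y ∈ U, X.A.germ hy b ∉ X.fiberGrSub i _}.Finite →
    ∀ (y : X.τ.fiber s) (hy : X.τ.fiberι s y ∈ U), X.A.germ hy b ∈ X.fiberGrSub i _

/-- The restriction of `𝒜_i / 𝒜_{i+1}` to the fibre `C_s` is isomorphic to `𝒪_{C_s}` on a dense
open subset `W`: it has a section `e` over `W` (a family of germs, taken modulo `fiberGrSub`,
locally represented by sections of `𝒜_i`) that freely generates each stalk over
`𝒪_{C_s,y} = 𝒜_{0,y} / (𝒜_{1,y} + 𝔪 𝒜_{0,y})`. -/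
def FiberGenericallyTrivial (i : ℤ) (s : S) : Prop :=
  ∃ (W : (X.τ.fiber s).Opens) (e : ∀ y : X.τ.fiber s, X.A.stalk (X.τ.fiberι s y)),
    Dense (W : Set (X.τ.fiber s)) ∧
    (∀ y ∈ W, ∃ (U : X.C.Opens) (b : X.A.sec U), X.τ.fiberι s y ∈ U ∧ b ∈ X.A.fil i U ∧
      ∀ z ∈ W, ∀ hz : X.τ.fiberι s z ∈ U, X.A.germ hz b - e z ∈ X.fiberGrSub i _) ∧
    ∀ y ∈ W,
      (∀ a ∈ X.A.stalkFil i _, ∃ c ∈ X.A.stalkFil 0 _, a - c * e y ∈ X.fiberGrSub i _) ∧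
      (∀ c ∈ X.A.stalkFil 0 _, c * e y ∈ X.fiberGrSub i _ → c ∈ X.fiberGrSub 0 _)

/-- The axioms of a ribbon over `S`: `τ` is a flat family of reduced algebraic curves, locally of
finite type; `𝒜_0 → 𝒪_C` induces an isomorphism `𝒜_0 / 𝒜_1 = 𝒪_C`; each `𝒜_i / 𝒜_{i+1}` is a
coherent sheaf on `C`, flat over `S`, whose restriction to any fibre has no nonzero coherent
subsheaf with finite support and is isomorphic to the structure sheaf on a dense open set; and
`𝒜_i = lim_{j > 0} 𝒜_i / 𝒜_{i+j}`. -/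
structure IsRibbon : Prop where
  flat : Flat X.τ
  locallyOfFiniteType : LocallyOfFiniteType X.τ
  curve : ∀ s, IsReducedCurve (X.τ.fiberToSpecResidueField s)
  residue_ker : ∀ (U : X.C.Opens) (a : X.A.zeroRing U),
    X.residue U a = 0 ↔ (a : X.A.sec U) ∈ X.A.fil 1 U
  residue_surj : ∀ (U : X.C.Opens) (f : Γ(X.C, U)), ∀ x ∈ U,
    ∃ (V : X.C.Opens) (h : V ≤ U) (a : X.A.zeroRing V), x ∈ V ∧
      X.residue V a = X.C.presheaf.map (homOfLE h).op f
  coherent : ∀ i, X.GrCoherent i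
  gr_flat : ∀ i (x : X.C), Module.Flat (X.baseStalk x) (X.grStalk i x)
  torsionFree : ∀ i s, X.FiberTorsionFree i s
  genericallyTrivial : ∀ i s, X.FiberGenericallyTrivial i s
  complete : X.A.IsComplete

/-! ### The fibres of a ribbon -/

/-- The filtration of `𝒜_x` by the `𝒜_{i,x} + 𝔪 𝒜_x`, where `𝔪` is the maximal ideal of
`𝒪_{S, τ(x)}`. It is the filtration of `𝒜_x ⊗ κ(τ(x))` by the images of the
`𝒜_{i,x} ⊗ κ(τ(x))`. -/
def fiberFiltration (x : X.C) : RingFiltration (X.A.stalk x) where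
  F i := (X.stalkSub i x ⊔
    IsLocalRing.maximalIdeal (X.baseStalk x) • (⊤ : Submodule (X.baseStalk x) (X.A.stalk x))).toAddSubgroup
  anti := fun _ _ h => sup_le_sup_right (a := X.stalkSub _ x) (b := X.stalkSub _ x)
    ((X.A.stalkFiltration x).anti h) _
  one_mem := Submodule.mem_sup_left (X.A.stalkFiltration x).one_mem
  mul_mem := by
    intro i j a b ha hb
    have key : ∀ p q : X.A.stalk x,
        p ∈ IsLocalRing.maximalIdeal (X.baseStalk x) •
          (⊤ : Submodule (X.baseStalk x) (X.A.stalk x)) →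
        p * q ∈ IsLocalRing.maximalIdeal (X.baseStalk x) •
          (⊤ : Submodule (X.baseStalk x) (X.A.stalk x)) := by
      intro p q hp
      refine Submodule.smul_induction_on hp (fun r hr n _ => ?_) (fun _ _ h1 h2 => ?_)
      · rw [smul_mul_assoc]
        exact Submodule.smul_mem_smul hr trivial
      · rw [add_mul]
        exact Submodule.add_mem _ h1 h2
    obtain ⟨a, ha', p, hp, rfl⟩ := Submodule.mem_sup.1 ha
    obtain ⟨b, hb', q, hq, rfl⟩ := Submodule.mem_sup.1 hb
    rw [show (a + p) * (b + q) = a * b + (p * (b + q) + q * a) by ring]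
    exact Submodule.add_mem_sup ((X.A.stalkFiltration x).mul_mem ha' hb')
      (Submodule.add_mem _ (key _ _ hp) (key _ _ hq))
  exhaust := fun a => by
    obtain ⟨i, hi⟩ := (X.A.stalkFiltration x).exhaust a
    exact ⟨i, Submodule.mem_sup_left hi⟩

theorem exists_germ_mem_fil (x : X.C) {U : X.C.Opens} (hx : x ∈ U) (a : X.A.sec U) :
    ∃ (V : X.C.Opens) (h : V ≤ U) (i : ℤ), x ∈ V ∧ X.A.res h a ∈ X.A.fil i V :=
  X.A.exhaust U a x hx

/-- The sections over `W ⊆ C_s` of the structure sheaf `𝒜_s` of the fibre over `s`: families of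
elements of the completions of the `𝒜_x ⊗ κ(s)` which, modulo each step of the filtration, are
locally the image of a section of `𝒜`. -/
def fiberSec (s : S) (W : (X.τ.fiber s).Opens) :
    Subring (∀ y : W, (X.fiberFiltration (X.τ.fiberι s y)).Completion) where
  carrier := {f | ∀ (i : ℤ) (y : W), ∃ (U : X.C.Opens) (a : X.A.sec U), X.τ.fiberι s y ∈ U ∧
    ∀ (z : W) (hz : X.τ.fiberι s z ∈ U),
      f z - (X.fiberFiltration _).incl (X.A.germ hz a) ∈ (X.fiberFiltration _).complFil i}
  zero_mem' := fun i y => ⟨⊤, 0, trivial, fun z hz => by simp⟩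
  one_mem' := fun i y => ⟨⊤, 1, trivial, fun z hz => by simp⟩
  neg_mem' := by
    intro f hf i y
    obtain ⟨U, a, hy, h⟩ := hf i y
    refine ⟨U, -a, hy, fun z hz => ?_⟩
    have := AddSubgroup.neg_mem _ (h z hz)
    simpa [neg_add_eq_sub] using this
  add_mem' := by
    intro f g hf hg i y
    obtain ⟨U, a, hy, h⟩ := hf i y
    obtain ⟨V, b, hy', h'⟩ := hg i y
    have hyy : X.τ.fiberι s y ∈ U ⊓ V := ⟨hy, hy'⟩
    refine ⟨U ⊓ V, X.A.res inf_le_left a + X.A.res inf_le_right b, hyy, fun z hz => ?_⟩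
    have := AddSubgroup.add_mem _ (h z hz.1) (h' z hz.2)
    convert this using 1
    rw [map_add, X.A.germ_res _ hz, X.A.germ_res _ hz, map_add, Pi.add_apply]
    ring
  mul_mem' := by
    intro f g hf hg i y
    obtain ⟨U, a, hy, h⟩ := hf 0 y
    obtain ⟨V, b, hy', h'⟩ := hg 0 y
    obtain ⟨U₁, hU₁, p, hyU, hp⟩ := X.exists_germ_mem_fil _ hy a
    obtain ⟨V₁, hV₁, q, hyV, hq⟩ := X.exists_germ_mem_fil _ hy' b
    obtain ⟨U₂, a', hyU₂, ha'⟩ := hf (i - min q 0) y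
    obtain ⟨V₂, b', hyV₂, hb'⟩ := hg (max (min q 0) (i - min p 0)) y
    let N : X.C.Opens := (U₁ ⊓ V₁) ⊓ (U₂ ⊓ V₂)
    have hN₁ : N ≤ U₂ := inf_le_right.trans inf_le_left
    have hN₂ : N ≤ V₂ := inf_le_right.trans inf_le_right
    have hyN : X.τ.fiberι s y ∈ N := ⟨⟨hyU, hyV⟩, hyU₂, hyV₂⟩
    refine ⟨N, X.A.res hN₁ a' * X.A.res hN₂ b', hyN, fun z hz => ?_⟩
    have hfP : f z ∈ (X.fiberFiltration (X.τ.fiberι s z)).complFil (min p 0) := by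
      refine (X.fiberFiltration _).mem_of_approx (h z (hU₁ hz.1.1)) ?_
      rw [← X.A.germ_res hU₁ hz.1.1]
      exact Submodule.mem_sup_left ⟨U₁, hz.1.1, _, hp, rfl⟩
    have hgQ : g z ∈ (X.fiberFiltration (X.τ.fiberι s z)).complFil (min q 0) := by
      refine (X.fiberFiltration _).mem_of_approx (h' z (hV₁ hz.1.2)) ?_
      rw [← X.A.germ_res hV₁ hz.1.2]
      exact Submodule.mem_sup_left ⟨V₁, hz.1.2, _, hq, rfl⟩
    have := (X.fiberFiltration (X.τ.fiberι s z)).mul_approx hfP hgQ (ha' z (hN₁ hz))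
      (hb' z (hN₂ hz))
    rw [map_mul, X.A.germ_res hN₁ hz, X.A.germ_res hN₂ hz]
    exact this

theorem fiberSec_res (s : S) {U V : (X.τ.fiber s).Opens} (h : V ≤ U)
    (f : ∀ y : U, (X.fiberFiltration (X.τ.fiberι s y)).Completion) (hf : f ∈ X.fiberSec s U) :
    SheafAux.resFun (M := fun y => (X.fiberFiltration (X.τ.fiberι s y)).Completion) h f ∈
      X.fiberSec s V := by
  intro k y
  obtain ⟨N, a, hy, h'⟩ := hf k ⟨y.1, h y.2⟩
  exact ⟨N, a, hy, fun z hz => h' ⟨z.1, h z.2⟩ hz⟩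

theorem fiberSec_local (s : S) (U : (X.τ.fiber s).Opens)
    (f : ∀ y : U, (X.fiberFiltration (X.τ.fiberι s y)).Completion)
    (hf : ∀ y : U, ∃ (V : (X.τ.fiber s).Opens) (h : V ≤ U), y.1 ∈ V ∧
      SheafAux.resFun (M := fun y => (X.fiberFiltration (X.τ.fiberι s y)).Completion) h f ∈
        X.fiberSec s V) : f ∈ X.fiberSec s U := by
  intro k y
  obtain ⟨W, hW, hyW, h⟩ := hf y
  obtain ⟨V, a, hy, h⟩ := h k ⟨y.1, hyW⟩
  obtain ⟨N, hN, hNW⟩ := (X.τ.fiberι s).isEmbedding.isOpen_iff.1 W.isOpen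
  have hmem : ∀ z, X.τ.fiberι s z ∈ N ↔ z ∈ W := fun z =>
    Set.ext_iff.1 hNW z
  let N' : X.C.Opens := ⟨N, hN⟩
  have hyN : X.τ.fiberι s y ∈ V ⊓ N' := ⟨hy, (hmem _).2 hyW⟩
  refine ⟨V ⊓ N', X.A.res inf_le_left a, hyN, fun z hz => ?_⟩
  rw [X.A.germ_res _ hz]
  exact h ⟨z.1, (hmem _).1 hz.2⟩ hz.1

/-- The fibre over `s` of the filtered sheaf of rings `𝒜`, that is, its base change along
`Spec κ(s) → S`: a filtered sheaf of rings `𝒜_s` on `C_s` with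
`𝒜_{s,j} = lim_i (𝒜_j / 𝒜_{j+i}) ⊠ κ(s)`. -/
def fiberA (s : S) : FilteredRingSheaf (X.τ.fiber s).carrier :=
  FilteredRingSheaf.ofFun (fun y => (X.fiberFiltration (X.τ.fiberι s y)).Completion)
    (X.fiberSec s) (X.fiberSec_res s) (X.fiberSec_local s)
    (fun i y => (X.fiberFiltration (X.τ.fiberι s y)).complFil i)
    (fun _ => (X.fiberFiltration _).complFil_anti)
    (fun _ => (X.fiberFiltration _).one_mem_complFil)
    (fun ha hb => (X.fiberFiltration _).complFil_mul ha hb)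
    (by
      intro W f hf y hy
      obtain ⟨U, a, hyU, h⟩ := hf 0 ⟨y, hy⟩
      obtain ⟨V, hV, i, hyV, hi⟩ := X.exists_germ_mem_fil _ hyU a
      refine ⟨W ⊓ X.τ.fiberι s ⁻¹ᵁ V, inf_le_left, min i 0, ⟨hy, hyV⟩, fun z => ?_⟩
      have hz : X.τ.fiberι s z ∈ V := z.2.2
      refine (X.fiberFiltration _).mem_of_approx (h ⟨z.1, z.2.1⟩ (hV hz)) ?_
      rw [← X.A.germ_res hV hz]
      exact Submodule.mem_sup_left ⟨V, hz, _, hi, rfl⟩)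

/-- The restriction `a ↦ a|_{U_s}` of sections of `𝒜` over `U` to `U_s = U ∩ C_s`. -/
def toFiber (s : S) (U : X.C.Opens) : X.A.sec U →+* (X.fiberA s).sec (X.τ.fiberι s ⁻¹ᵁ U) :=
  RingHom.codRestrict
    (RingHom.pi (fun y : (X.τ.fiberι s ⁻¹ᵁ U : (X.τ.fiber s).Opens) =>
      (X.fiberFiltration (X.τ.fiberι s y)).incl.comp (X.A.germ (U := U) y.2)))
    (X.fiberSec s (X.τ.fiberι s ⁻¹ᵁ U))
    (fun a _ y => ⟨U, a, y.2, fun _ _ => by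
      rw [RingHom.pi_apply, RingHom.comp_apply, sub_self]; exact AddSubgroup.zero_mem _⟩)

/-- The standing assumptions on the fibres: the underlying space of each fibre `C_s` is
irreducible, and `C_s` has a point `P_s` with
`(𝒜_{s,1})_{P_s} (𝒜_{s,-1})_{P_s} = (𝒜_{s,0})_{P_s}`. -/
structure StandingAssumptions : Prop where
  irreducible : ∀ s, IrreducibleSpace (X.τ.fiber s)
  exists_point : ∀ s, ∃ P : X.τ.fiber s, (X.fiberA s).IsInvertibleAt P

/-- The set of integers `j` with `a|_{U_s} ∈ 𝒜_{s,j}(U_s)`; the order of `a` along the fibre over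
`s` is its maximum. -/
def ordSet {U : X.C.Opens} (a : X.A.sec U) (s : S) : Set ℤ :=
  {j | X.toFiber s U a ∈ (X.fiberA s).fil j (X.τ.fiberι s ⁻¹ᵁ U)}

end PreRibbon

/-! ### The sheaves in the statement -/

namespace FilteredRingSheaf

variable {T : TopCat.{u}} (A : FilteredRingSheaf T)

/-- The presheaf of units of `𝒜`, written additively. -/
def unitsPresheaf : TopCat.Presheaf AddCommGrpCat.{u} T where
  obj U := AddCommGrpCat.of (Additive (A.sec U.unop)ˣ)
  map i := AddCommGrpCat.ofHom
    (MonoidHom.toAdditive (Units.map (A.sheaf.presheaf.map i).hom.toMonoidHom))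
  map_id U := by
    ext a
    apply Additive.toMul.injective
    apply Units.ext
    exact congrArg (fun f => f.hom (Additive.toMul a : (A.sec U.unop)ˣ).1)
      (A.sheaf.presheaf.map_id U)
  map_comp i j := by
    ext a
    apply Additive.toMul.injective
    apply Units.ext
    exact congrArg (fun f => f.hom (Additive.toMul a : (A.sec _)ˣ).1)
      (A.sheaf.presheaf.map_comp i j)

/-- The sheaf `𝒜^*` of units of `𝒜`, written additively. -/
def unitsSheaf : TopCat.Sheaf AddCommGrpCat.{u} T :=
  ⟨A.unitsPresheaf, by
    apply (TopCat.Presheaf.isSheaf_iff_isSheafUniqueGluing _).2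
    intro ι U sf hsf
    have hv : ∀ i j, A.sheaf.presheaf.map (Opens.infLELeft (U i) (U j)).op
          (Additive.toMul (sf i) : (A.sec (U i))ˣ).1 =
        A.sheaf.presheaf.map (Opens.infLERight (U i) (U j)).op
          (Additive.toMul (sf j) : (A.sec (U j))ˣ).1 := fun i j =>
      congrArg (fun a : Additive (A.sec (U i ⊓ U j))ˣ => (Additive.toMul a).1) (hsf i j)
    have hi : ∀ i j, A.sheaf.presheaf.map (Opens.infLELeft (U i) (U j)).op
          (Additive.toMul (sf i) : (A.sec (U i))ˣ).2 =
        A.sheaf.presheaf.map (Opens.infLERight (U i) (U j)).op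
          (Additive.toMul (sf j) : (A.sec (U j))ˣ).2 := fun i j =>
      congrArg (fun a : Additive (A.sec (U i ⊓ U j))ˣ => (Additive.toMul a).2) (hsf i j)
    obtain ⟨a, ha, hau⟩ := A.sheaf.existsUnique_gluing U _ hv
    obtain ⟨b, hb, -⟩ := A.sheaf.existsUnique_gluing U _ hi
    have hab : a * b = 1 := by
      refine A.sheaf.eq_of_locally_eq U _ _ fun i => ?_
      rw [map_mul, map_one]
      refine (congrArg₂ (· * ·) (ha i) (hb i)).trans ?_
      exact (Additive.toMul (sf i) : (A.sec (U i))ˣ).3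
    refine ⟨Additive.ofMul (⟨a, b, hab, (mul_comm _ _).trans hab⟩ : (A.sec (iSup U))ˣ), ?_, ?_⟩
    · intro i
      apply Additive.toMul.injective
      apply Units.ext
      exact ha i
    · intro c hc
      apply Additive.toMul.injective
      apply Units.ext
      exact hau _ fun i => congrArg (fun a : Additive (A.sec (U i))ˣ => (Additive.toMul a).1) (hc i)⟩

/-- The value of a section of `unitsSheaf`, that is, the corresponding section of `𝒜`. -/
def unitVal {U : Opens T} (a : A.unitsSheaf.presheaf.obj (op U)) : A.sec U :=
  ((Additive.toMul (a : Additive (A.sec U)ˣ) : (A.sec U)ˣ) : A.sec U)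

/-- The subgroup `𝒜_0(U)^*` of `𝒜(U)^*`. -/
def zeroUnits (U : Opens T) : Subgroup (A.sec U)ˣ where
  carrier := {a | (a : A.sec U) ∈ A.fil 0 U ∧ ((a⁻¹ : (A.sec U)ˣ) : A.sec U) ∈ A.fil 0 U}
  one_mem' := ⟨A.one_mem U, by simpa using A.one_mem U⟩
  mul_mem' {a b} ha hb := ⟨(A.zeroRing U).mul_mem ha.1 hb.1, by
    rw [mul_inv]; exact (A.zeroRing U).mul_mem ha.2 hb.2⟩
  inv_mem' {a} ha := ⟨ha.2, by rw [inv_inv]; exact ha.1⟩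

theorem zeroUnits_res {U V : Opens T} (h : V ≤ U) (f : A.unitsSheaf.presheaf.obj (op U))
    (hf : f ∈ (A.zeroUnits U).toAddSubgroup) :
    A.unitsSheaf.presheaf.map (homOfLE h).op f ∈ (A.zeroUnits V).toAddSubgroup :=
  ⟨A.fil_res 0 h hf.1, A.fil_res 0 h hf.2⟩

theorem zeroUnits_local (U : Opens T) (f : A.unitsSheaf.presheaf.obj (op U))
    (hf : ∀ x ∈ U, ∃ (V : Opens T) (h : V ≤ U), x ∈ V ∧
      A.unitsSheaf.presheaf.map (homOfLE h).op f ∈ (A.zeroUnits V).toAddSubgroup) :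
    f ∈ (A.zeroUnits U).toAddSubgroup :=
  ⟨A.fil_local 0 U _ fun x hx => by
      obtain ⟨V, h, hxV, hm⟩ := hf x hx
      exact ⟨V, h, hxV, hm.1⟩,
   A.fil_local 0 U _ fun x hx => by
      obtain ⟨V, h, hxV, hm⟩ := hf x hx
      exact ⟨V, h, hxV, hm.2⟩⟩

end FilteredRingSheaf

namespace PreRibbon

variable {S : Scheme.{u}} (X : PreRibbon S)

/-- The sheaf `𝒜_0^*`, as a subsheaf of `𝒜^*`. -/
def unitsZero : TopCat.Sheaf AddCommGrpCat.{u} X.C.carrier :=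
  SheafAux.subSheaf X.A.unitsSheaf (fun U => (X.A.zeroUnits U).toAddSubgroup)
    X.A.zeroUnits_res X.A.zeroUnits_local

/-- The inclusion `𝒜_0^* → 𝒜^*`. -/
def unitsZeroι : X.unitsZero ⟶ X.A.unitsSheaf :=
  SheafAux.subSheafι _ _ X.A.zeroUnits_res X.A.zeroUnits_local

/-- The stalk `𝒩_{S,s}` at `s = τ(x)` of the nilradical `𝒩_S` of `𝒪_S`: the nilradical of the local
ring `𝒪_{S,s}`. -/
abbrev nilStalk (x : X.C) : Ideal (X.baseStalk x) := nilradical (X.baseStalk x)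

/-- The stalk `𝒩_{S,s} 𝒜_x` at `x` of the sheaf of ideals `𝒩_S 𝒜` of `𝒜`. -/
def nilA (x : X.C) : Submodule (X.baseStalk x) (X.A.stalk x) := X.nilStalk x • ⊤

/-- The stalk `𝒩_{S,s} 𝒜_{0,x}` at `x` of the sheaf of ideals `𝒩_S 𝒜_0` of `𝒜_0`. -/
def nilA₀ (x : X.C) : Submodule (X.baseStalk x) (X.A.stalk x) := X.nilStalk x • X.stalkSub 0 x

theorem nilA_mul {x : X.C} {p : X.A.stalk x} (hp : p ∈ X.nilA x) (q : X.A.stalk x) :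
    p * q ∈ X.nilA x := by
  refine Submodule.smul_induction_on hp (fun r hr n _ => ?_) (fun _ _ h1 h2 => ?_)
  · rw [smul_mul_assoc]
    exact Submodule.smul_mem_smul hr trivial
  · rw [add_mul]
    exact Submodule.add_mem _ h1 h2

theorem nilA₀_mul {x : X.C} {p q : X.A.stalk x} (hp : p ∈ X.nilA₀ x) (hq : q ∈ X.A.stalkFil 0 x) :
    p * q ∈ X.nilA₀ x := by
  refine Submodule.smul_induction_on hp (fun r hr n hn => ?_) (fun _ _ h1 h2 => ?_)
  · rw [smul_mul_assoc]
    refine Submodule.smul_mem_smul hr ?_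
    have := (X.A.stalkFiltration x).mul_mem hn hq
    rw [add_zero] at this
    exact this
  · rw [add_mul]
    exact Submodule.add_mem _ h1 h2

theorem nilA₀_le (x : X.C) : X.nilA₀ x ≤ X.stalkSub 0 x := Submodule.smul_le_right

theorem nilA₀_nilpotent {x : X.C} {p : X.A.stalk x} (hp : p ∈ X.nilA₀ x) : IsNilpotent p := by
  rw [← mem_nilradical]
  refine Submodule.smul_induction_on hp (fun r hr n _ => ?_) (fun _ _ h1 h2 => ?_)
  · rw [Algebra.smul_def]
    exact Ideal.mul_mem_right _ _ (mem_nilradical.2 ((mem_nilradical.1 hr).map _))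
  · exact Ideal.add_mem _ h1 h2

theorem nilA₀_inv {x : X.C} (a : (X.A.stalk x)ˣ) (ha : (a : X.A.stalk x) - 1 ∈ X.nilA₀ x) :
    ((a⁻¹ : (X.A.stalk x)ˣ) : X.A.stalk x) - 1 ∈ X.nilA₀ x := by
  set z := (a : X.A.stalk x) - 1 with hz
  obtain ⟨m, hm⟩ := (X.nilA₀_nilpotent ha).neg
  have hsum : (∑ i ∈ Finset.range m, (-z) ^ i) * (-z - 1) = -1 := by
    rw [geom_sum_mul, hm, zero_sub]
  have hinv : ((a⁻¹ : (X.A.stalk x)ˣ) : X.A.stalk x) = ∑ i ∈ Finset.range m, (-z) ^ i := by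
    rw [Units.inv_eq_of_mul_eq_one_left]
    linear_combination -hsum + (∑ i ∈ Finset.range m, (-z) ^ i) * hz
  have hpow : ∀ i, (-z) ^ i ∈ X.A.stalkFil 0 x := by
    intro i
    induction i with
    | zero => rw [pow_zero]; exact (X.A.stalkFiltration x).one_mem
    | succ i ih =>
      rw [pow_succ]
      have := (X.A.stalkFiltration x).mul_mem ih (AddSubgroup.neg_mem _ (X.nilA₀_le x ha))
      rw [add_zero] at this
      exact this
  have hA₀ : ((a⁻¹ : (X.A.stalk x)ˣ) : X.A.stalk x) ∈ X.A.stalkFil 0 x := by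
    rw [hinv]
    exact AddSubgroup.sum_mem _ fun i _ => hpow i
  have hfin : ((a⁻¹ : (X.A.stalk x)ˣ) : X.A.stalk x) - 1 =
      -(z * ((a⁻¹ : (X.A.stalk x)ˣ) : X.A.stalk x)) := by
    have := a.mul_inv
    rw [hz]
    linear_combination this
  rw [hfin]
  exact Submodule.neg_mem _ (X.nilA₀_mul ha hA₀)

/-- The group of sections over `U` of `1 + 𝒩_S 𝒜`: the units of `𝒜(U)` all of whose germs lie in
`1 + 𝒩_{S,s} 𝒜_x`. -/
def oneAddNilSec (U : X.C.Opens) : Subgroup (X.A.sec U)ˣ where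
  carrier := {a | ∀ (x : X.C) (hx : x ∈ U), X.A.germ hx (a : X.A.sec U) - 1 ∈ X.nilA x}
  one_mem' x hx := by rw [Units.val_one, map_one, sub_self]; exact Submodule.zero_mem _
  mul_mem' {a b} ha hb x hx := by
    rw [Units.val_mul, map_mul, show X.A.germ hx (a : X.A.sec U) * X.A.germ hx (b : X.A.sec U) - 1 =
      (X.A.germ hx (a : X.A.sec U) - 1) * X.A.germ hx (b : X.A.sec U) +
        (X.A.germ hx (b : X.A.sec U) - 1) by ring]
    exact Submodule.add_mem _ (X.nilA_mul (ha x hx) _) (hb x hx)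
  inv_mem' {a} ha x hx := by
    have h1 : X.A.germ hx (a : X.A.sec U) * X.A.germ hx ((a⁻¹ : (X.A.sec U)ˣ) : X.A.sec U) = 1 := by
      rw [← map_mul, Units.mul_inv, map_one]
    have h2 : X.A.germ hx ((a⁻¹ : (X.A.sec U)ˣ) : X.A.sec U) - 1 =
        -((X.A.germ hx (a : X.A.sec U) - 1) *
          X.A.germ hx ((a⁻¹ : (X.A.sec U)ˣ) : X.A.sec U)) := by
      linear_combination h1
    rw [h2]
    exact Submodule.neg_mem _ (X.nilA_mul (ha x hx) _)

/-- The group of sections over `U` of `1 + 𝒩_S 𝒜_0`: the units of `𝒜(U)` all of whose germs lie in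
`1 + 𝒩_{S,s} 𝒜_{0,x}`. -/
def oneAddNilZeroSec (U : X.C.Opens) : Subgroup (X.A.sec U)ˣ where
  carrier := {a | ∀ (x : X.C) (hx : x ∈ U), X.A.germ hx (a : X.A.sec U) - 1 ∈ X.nilA₀ x}
  one_mem' x hx := by rw [Units.val_one, map_one, sub_self]; exact Submodule.zero_mem _
  mul_mem' {a b} ha hb x hx := by
    have hb' : X.A.germ hx (b : X.A.sec U) ∈ X.A.stalkFil 0 x := by
      have := AddSubgroup.add_mem _ (X.nilA₀_le x (hb x hx)) (X.A.stalkFiltration x).one_mem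
      rwa [sub_add_cancel] at this
    rw [Units.val_mul, map_mul, show X.A.germ hx (a : X.A.sec U) * X.A.germ hx (b : X.A.sec U) - 1 =
      (X.A.germ hx (a : X.A.sec U) - 1) * X.A.germ hx (b : X.A.sec U) +
        (X.A.germ hx (b : X.A.sec U) - 1) by ring]
    exact Submodule.add_mem _ (X.nilA₀_mul (ha x hx) hb') (hb x hx)
  inv_mem' {a} ha x hx := X.nilA₀_inv (Units.map (X.A.germ hx).toMonoidHom a) (ha x hx)

theorem oneAddNilSec_res {U V : X.C.Opens} (h : V ≤ U) (f : X.A.unitsSheaf.presheaf.obj (op U))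
    (hf : f ∈ (X.oneAddNilSec U).toAddSubgroup) :
    X.A.unitsSheaf.presheaf.map (homOfLE h).op f ∈ (X.oneAddNilSec V).toAddSubgroup := by
  intro x hx
  have := hf x (h hx)
  rw [← X.A.germ_res h hx] at this
  exact this

theorem oneAddNilSec_local (U : X.C.Opens) (f : X.A.unitsSheaf.presheaf.obj (op U))
    (hf : ∀ x ∈ U, ∃ (V : X.C.Opens) (h : V ≤ U), x ∈ V ∧
      X.A.unitsSheaf.presheaf.map (homOfLE h).op f ∈ (X.oneAddNilSec V).toAddSubgroup) :
    f ∈ (X.oneAddNilSec U).toAddSubgroup := by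
  intro x hx
  obtain ⟨V, h, hxV, hm⟩ := hf x hx
  rw [← X.A.germ_res h hxV]
  exact hm x hxV

theorem oneAddNilZeroSec_res {U V : X.C.Opens} (h : V ≤ U)
    (f : X.A.unitsSheaf.presheaf.obj (op U)) (hf : f ∈ (X.oneAddNilZeroSec U).toAddSubgroup) :
    X.A.unitsSheaf.presheaf.map (homOfLE h).op f ∈ (X.oneAddNilZeroSec V).toAddSubgroup := by
  intro x hx
  have := hf x (h hx)
  rw [← X.A.germ_res h hx] at this
  exact this

theorem oneAddNilZeroSec_local (U : X.C.Opens) (f : X.A.unitsSheaf.presheaf.obj (op U))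
    (hf : ∀ x ∈ U, ∃ (V : X.C.Opens) (h : V ≤ U), x ∈ V ∧
      X.A.unitsSheaf.presheaf.map (homOfLE h).op f ∈ (X.oneAddNilZeroSec V).toAddSubgroup) :
    f ∈ (X.oneAddNilZeroSec U).toAddSubgroup := by
  intro x hx
  obtain ⟨V, h, hxV, hm⟩ := hf x hx
  rw [← X.A.germ_res h hxV]
  exact hm x hxV

theorem mem_fil_of_germ {i : ℤ} {U : X.C.Opens} (a : X.A.sec U)
    (h : ∀ x (hx : x ∈ U), X.A.germ hx a ∈ X.A.stalkFil i x) : a ∈ X.A.fil i U := by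
  refine X.A.fil_local i U a fun x hx => ?_
  obtain ⟨V, hV, b, hb, hab⟩ := h x hx
  obtain ⟨W, hxW, iU, iV, hW⟩ := X.A.sheaf.presheaf.germ_eq x hV hx b a hab
  refine ⟨W, iV.le, hxW, ?_⟩
  have := X.A.fil_res i iU.le hb
  exact hW ▸ this

theorem oneAddNilZeroSec_le (U : X.C.Opens) :
    (X.oneAddNilZeroSec U).toAddSubgroup ≤ (X.A.zeroUnits U).toAddSubgroup := by
  have key : ∀ a ∈ X.oneAddNilZeroSec U, (a : X.A.sec U) ∈ X.A.fil 0 U := by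
    intro a ha
    refine X.mem_fil_of_germ _ fun x hx => ?_
    have := AddSubgroup.add_mem _ (X.nilA₀_le x (ha x hx)) (X.A.stalkFiltration x).one_mem
    rwa [sub_add_cancel] at this
  intro a ha
  exact ⟨key _ ha, key _ ((X.oneAddNilZeroSec U).inv_mem ha)⟩

theorem oneAddNilZeroSec_le' (U : X.C.Opens) :
    (X.oneAddNilZeroSec U).toAddSubgroup ≤ (X.oneAddNilSec U).toAddSubgroup :=
  fun _ ha x hx => Submodule.smul_mono le_rfl le_top (ha x hx)

/-- The sheaf of groups `1 + 𝒩_S 𝒜`, as a subsheaf of `𝒜^*`. -/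
def oneAddNil : TopCat.Sheaf AddCommGrpCat.{u} X.C.carrier :=
  SheafAux.subSheaf X.A.unitsSheaf (fun U => (X.oneAddNilSec U).toAddSubgroup)
    X.oneAddNilSec_res X.oneAddNilSec_local

/-- The inclusion `1 + 𝒩_S 𝒜 → 𝒜^*`. -/
def oneAddNilι : X.oneAddNil ⟶ X.A.unitsSheaf :=
  SheafAux.subSheafι _ _ X.oneAddNilSec_res X.oneAddNilSec_local

/-- The sheaf of groups `1 + 𝒩_S 𝒜_0`, as a subsheaf of `𝒜^*`. -/
def oneAddNilZero : TopCat.Sheaf AddCommGrpCat.{u} X.C.carrier :=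
  SheafAux.subSheaf X.A.unitsSheaf (fun U => (X.oneAddNilZeroSec U).toAddSubgroup)
    X.oneAddNilZeroSec_res X.oneAddNilZeroSec_local

/-- The inclusion `1 + 𝒩_S 𝒜_0 → 𝒜_0^*`. -/
def oneAddNilZeroToUnitsZero : X.oneAddNilZero ⟶ X.unitsZero :=
  SheafAux.subSheafIncl _ _ _ X.oneAddNilZeroSec_le X.oneAddNilZeroSec_res
    X.oneAddNilZeroSec_local X.A.zeroUnits_res X.A.zeroUnits_local

/-- The inclusion `1 + 𝒩_S 𝒜_0 → 1 + 𝒩_S 𝒜`. -/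
def oneAddNilZeroToOneAddNil : X.oneAddNilZero ⟶ X.oneAddNil :=
  SheafAux.subSheafIncl _ _ _ X.oneAddNilZeroSec_le' X.oneAddNilZeroSec_res
    X.oneAddNilZeroSec_local X.oneAddNilSec_res X.oneAddNilSec_local

/-- A sheaf of `τ⁻¹𝒪_S`-modules on `C`, presented by its stalks and by a family of sections
(regarded as families of germs) representing all sections locally. -/
structure ModuleFamily where
  M : X.C → Type u
  [addCommGroup : ∀ x, AddCommGroup (M x)]
  [module : ∀ x, Module (X.baseStalk x) (M x)]
  secs : ∀ U : X.C.Opens, Set (∀ x : U, M x)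
  res : ∀ {U V : X.C.Opens} (h : V ≤ U) (f), f ∈ secs U → SheafAux.resFun (M := M) h f ∈ secs V

attribute [instance] ModuleFamily.addCommGroup ModuleFamily.module

/-- The sheaf `𝒜`. -/
def famA : X.ModuleFamily where
  M := X.A.stalk
  secs U := {f | ∃ a : X.A.sec U, ∀ x : U, f x = X.A.germ x.2 a}
  res := by
    rintro U V h f ⟨a, ha⟩
    exact ⟨X.A.res h a, fun x => (ha ⟨x.1, h x.2⟩).trans (X.A.germ_res h x.2 a).symm⟩

/-- The sheaf `𝒜_0`. -/
def famA₀ : X.ModuleFamily where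
  M x := X.stalkSub 0 x
  secs U := {f | ∃ a ∈ X.A.fil 0 U, ∀ x : U, (f x : X.A.stalk x.1) = X.A.germ x.2 a}
  res := by
    rintro U V h f ⟨a, ha, hf⟩
    exact ⟨X.A.res h a, X.A.fil_res 0 h ha,
      fun x => (hf ⟨x.1, h x.2⟩).trans (X.A.germ_res h x.2 a).symm⟩

/-- The sheaf `𝒜 / 𝒜_0`. -/
def famQuot : X.ModuleFamily where
  M x := X.A.stalk x ⧸ X.stalkSub 0 x
  secs U := {f | ∃ a : X.A.sec U, ∀ x : U, f x = (X.stalkSub 0 x.1).mkQ (X.A.germ x.2 a)}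
  res := by
    rintro U V h f ⟨a, ha⟩
    exact ⟨X.A.res h a, fun x => (ha ⟨x.1, h x.2⟩).trans
      (congrArg (X.stalkSub 0 x.1).mkQ (X.A.germ_res h x.2 a).symm)⟩

variable {X}

namespace ModuleFamily

variable (𝓜 𝓜' : X.ModuleFamily)

/-- The stalk `𝒩_{S,s} ⊗_{𝒪_{S,s}} M_x` of `𝒩_S ⊠ M` at `x`, where `s = τ(x)`. -/
abbrev boxStalk (x : X.C) : Type u := X.nilStalk x ⊗[X.baseStalk x] 𝓜.M x

/-- The family of germs of `n ⊗ m`, for a nilpotent function `n` on `V ⊆ S` and a section `m` over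
`U ⊆ τ⁻¹V`. -/
def pureFun {V : S.Opens} {U : X.C.Opens} (h : U ≤ X.τ ⁻¹ᵁ V) (n : Γ(S, V)) (hn : IsNilpotent n)
    (m : ∀ x : U, 𝓜.M x) (x : U) : 𝓜.boxStalk x :=
  (⟨S.presheaf.germ V (X.τ x.1) (h x.2) n, mem_nilradical.2 (hn.map (S.presheaf.germ V _ _).hom)⟩ :
    X.nilStalk x.1) ⊗ₜ[X.baseStalk x.1] m x

/-- Finite sums of families `n ⊗ m` over `U`. -/
def boxPre (U : X.C.Opens) : AddSubgroup (∀ x : U, 𝓜.boxStalk x) :=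
  AddSubgroup.closure {t | ∃ (V : S.Opens) (h : U ≤ X.τ ⁻¹ᵁ V) (n : Γ(S, V)) (hn : IsNilpotent n),
    ∃ m ∈ 𝓜.secs U, 𝓜.pureFun h n hn m = t}

theorem boxPre_res {U V : X.C.Opens} (h : V ≤ U) (t : ∀ x : U, 𝓜.boxStalk x)
    (ht : t ∈ 𝓜.boxPre U) : SheafAux.resFun (M := 𝓜.boxStalk) h t ∈ 𝓜.boxPre V := by
  induction ht using AddSubgroup.closure_induction with
  | mem t ht =>
    obtain ⟨W, hW, n, hn, m, hm, rfl⟩ := ht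
    exact AddSubgroup.subset_closure ⟨W, h.trans hW, n, hn, _, 𝓜.res h m hm, rfl⟩
  | zero => exact AddSubgroup.zero_mem _
  | add s t _ _ hs ht => exact AddSubgroup.add_mem _ hs ht
  | neg s _ hs => exact AddSubgroup.neg_mem _ hs

/-- The sections over `U` of `𝒩_S ⊠ M`: families of germs that are locally finite sums of families
`n ⊗ m`. -/
def boxSec (U : X.C.Opens) : AddSubgroup (∀ x : U, 𝓜.boxStalk x) where
  carrier := {t | ∀ x : U, ∃ (V : X.C.Opens) (h : V ≤ U), x.1 ∈ V ∧
    SheafAux.resFun (M := 𝓜.boxStalk) h t ∈ 𝓜.boxPre V}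
  zero_mem' x := ⟨U, le_rfl, x.2, AddSubgroup.zero_mem _⟩
  add_mem' {s t} hs ht x := by
    obtain ⟨V, h, hx, hs⟩ := hs x
    obtain ⟨W, h', hx', ht⟩ := ht x
    exact ⟨V ⊓ W, inf_le_left.trans h, ⟨hx, hx'⟩, AddSubgroup.add_mem _
      (𝓜.boxPre_res inf_le_left _ hs) (𝓜.boxPre_res inf_le_right _ ht)⟩
  neg_mem' {s} hs x := by
    obtain ⟨V, h, hx, hs⟩ := hs x
    exact ⟨V, h, hx, AddSubgroup.neg_mem _ hs⟩

theorem boxSec_res {U V : X.C.Opens} (h : V ≤ U) (t : ∀ x : U, 𝓜.boxStalk x)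
    (ht : t ∈ 𝓜.boxSec U) : SheafAux.resFun (M := 𝓜.boxStalk) h t ∈ 𝓜.boxSec V := by
  intro x
  obtain ⟨W, h', hx, ht⟩ := ht ⟨x.1, h x.2⟩
  exact ⟨V ⊓ W, inf_le_left, ⟨x.2, hx⟩, 𝓜.boxPre_res inf_le_right _ ht⟩

theorem boxSec_local (U : X.C.Opens) (t : ∀ x : U, 𝓜.boxStalk x)
    (ht : ∀ x : U, ∃ (V : X.C.Opens) (h : V ≤ U), x.1 ∈ V ∧
      SheafAux.resFun (M := 𝓜.boxStalk) h t ∈ 𝓜.boxSec V) : t ∈ 𝓜.boxSec U := by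
  intro x
  obtain ⟨V, h, hx, hV⟩ := ht x
  obtain ⟨W, h', hx', hW⟩ := hV ⟨x.1, hx⟩
  exact ⟨W, h'.trans h, hx', hW⟩

/-- The sheaf `𝒩_S ⊠ M = τ⁻¹𝒩_S ⊗_{τ⁻¹𝒪_S} M` of abelian groups on `C`. -/
def box : TopCat.Sheaf AddCommGrpCat.{u} X.C.carrier :=
  SheafAux.funSheaf 𝓜.boxStalk 𝓜.boxSec 𝓜.boxSec_res 𝓜.boxSec_local

/-- The section `n ⊗ m` of `𝒩_S ⊠ M` over `U`. -/
def boxMk {V : S.Opens} {U : X.C.Opens} (h : U ≤ X.τ ⁻¹ᵁ V) (n : Γ(S, V)) (hn : IsNilpotent n)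
    (m : ∀ x : U, 𝓜.M x) (hm : m ∈ 𝓜.secs U) : 𝓜.box.presheaf.obj (op U) :=
  (⟨𝓜.pureFun h n hn m, fun x => ⟨U, le_rfl, x.2,
    AddSubgroup.subset_closure ⟨V, h, n, hn, m, hm, rfl⟩⟩⟩ : 𝓜.boxSec U)

variable {𝓜 𝓜'}

/-- The morphism `𝒩_S ⊠ M → 𝒩_S ⊠ M'` induced by a morphism `M → M'`. -/
def boxMap (g : ∀ x, 𝓜.M x →ₗ[X.baseStalk x] 𝓜'.M x)
    (hg : ∀ (U : X.C.Opens), ∀ m ∈ 𝓜.secs U, (fun x : U => g x.1 (m x)) ∈ 𝓜'.secs U) :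
    𝓜.box ⟶ 𝓜'.box := by
  have key : ∀ (U : X.C.Opens) (t : ∀ x : U, 𝓜.boxStalk x), t ∈ 𝓜.boxPre U →
      (fun x : U => (g x.1).lTensor (X.nilStalk x.1) (t x)) ∈ 𝓜'.boxPre U := by
    intro U t ht
    induction ht using AddSubgroup.closure_induction with
    | mem t ht =>
      obtain ⟨W, hW, n, hn, m, hm, rfl⟩ := ht
      exact AddSubgroup.subset_closure ⟨W, hW, n, hn, _, hg U m hm, by
        funext x; exact (LinearMap.lTensor_tmul _ _ _ _).symm⟩
    | zero =>
      have h0 : (fun x : U => (g x.1).lTensor (X.nilStalk x.1)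
          ((0 : ∀ x : U, 𝓜.boxStalk x) x)) = 0 := by
        funext x; exact map_zero _
      rw [h0]
      exact AddSubgroup.zero_mem _
    | add s t _ _ hs ht =>
      have h0 : (fun x : U => (g x.1).lTensor (X.nilStalk x.1) ((s + t) x)) =
          (fun x : U => (g x.1).lTensor (X.nilStalk x.1) (s x)) +
          (fun x : U => (g x.1).lTensor (X.nilStalk x.1) (t x)) := by
        funext x; exact map_add _ _ _
      rw [h0]
      exact AddSubgroup.add_mem _ hs ht
    | neg s _ hs =>
      have h0 : (fun x : U => (g x.1).lTensor (X.nilStalk x.1) ((-s) x)) =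
          -(fun x : U => (g x.1).lTensor (X.nilStalk x.1) (s x)) := by
        funext x; exact map_neg _ _
      rw [h0]
      exact AddSubgroup.neg_mem _ hs
  exact ⟨{
    app := fun U => AddCommGrpCat.ofHom
      { toFun := fun t => ⟨fun x => (g x.1).lTensor (X.nilStalk x.1) (t.1 x), fun x => by
          obtain ⟨V, h, hx, hV⟩ := t.2 x
          exact ⟨V, h, hx, key V _ hV⟩⟩
        map_zero' := by apply Subtype.ext; funext x; exact map_zero _
        map_add' := fun s t => by apply Subtype.ext; funext x; exact map_add _ _ _ }
    naturality := fun _ _ _ => rfl }⟩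

end ModuleFamily

variable (X)

/-- The morphism `𝒩_S ⊠ 𝒜_0 → 𝒩_S ⊠ 𝒜` induced by the inclusion. -/
def boxIncl : X.famA₀.box ⟶ X.famA.box :=
  ModuleFamily.boxMap (𝓜 := X.famA₀) (𝓜' := X.famA) (fun x => (X.stalkSub 0 x).subtype)
    (by rintro U m ⟨a, -, ha⟩; exact ⟨a, ha⟩)

/-- The morphism `𝒩_S ⊠ 𝒜 → 𝒩_S ⊠ (𝒜 / 𝒜_0)` induced by the projection. -/
def boxProj : X.famA.box ⟶ X.famQuot.box :=
  ModuleFamily.boxMap (𝓜 := X.famA) (𝓜' := X.famQuot) (fun x => (X.stalkSub 0 x).mkQ)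
    (by rintro U m ⟨a, ha⟩; exact ⟨a, fun x => congrArg (X.stalkSub 0 x.1).mkQ (ha x)⟩)

/-- The section `n ⊗ a` of `𝒩_S ⊠ 𝒜`. -/
def tmulA {V : S.Opens} {U : X.C.Opens} (h : U ≤ X.τ ⁻¹ᵁ V) (n : Γ(S, V)) (hn : IsNilpotent n)
    (a : X.A.sec U) : X.famA.box.presheaf.obj (op U) :=
  X.famA.boxMk h n hn (fun x => X.A.germ x.2 a) ⟨a, fun _ => rfl⟩

/-- The section `n ⊗ a` of `𝒩_S ⊠ 𝒜_0`. -/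
def tmulA₀ {V : S.Opens} {U : X.C.Opens} (h : U ≤ X.τ ⁻¹ᵁ V) (n : Γ(S, V)) (hn : IsNilpotent n)
    (a : X.A.sec U) (ha : a ∈ X.A.fil 0 U) : X.famA₀.box.presheaf.obj (op U) :=
  X.famA₀.boxMk h n hn (fun x => ⟨X.A.germ x.2 a, U, x.2, a, ha, rfl⟩) ⟨a, ha, fun _ => rfl⟩

end PreRibbon

/-- The exponential `∑_k z^k / k!` of a nilpotent element of a ring in which all `k!` are
invertible. -/
def nilExp {R : Type u} [CommRing R] (z : R) : R :=
  ∑ k ∈ Finset.range (nilpotencyClass z), Ring.inverse (k.factorial : R) * z ^ k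

namespace PreRibbon

variable {S : Scheme.{u}} (X : PreRibbon S)

/-- A morphism `φ : 𝒜^* → ℤ_C` restricts to a surjective morphism of sheaves on the open set `U`:
every locally constant function on an open subset of `U` lies locally in the image. -/
def SurjectiveOn (φ : X.A.unitsSheaf ⟶ SheafAux.constZ X.C.carrier) (U : X.C.Opens) : Prop :=
  ∀ (W : X.C.Opens), W ≤ U → ∀ f : (SheafAux.constZ X.C.carrier).presheaf.obj (op W), ∀ x ∈ W,
    ∃ (W' : X.C.Opens) (h : W' ≤ W) (a : X.A.unitsSheaf.presheaf.obj (op W')), x ∈ W' ∧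
      φ.hom.app (op W') a = (SheafAux.constZ X.C.carrier).presheaf.map (homOfLE h).op f

/-- `φ` is the order map: `φ(a)(x)` is the maximum of all `j` with `a|_{U_s} ∈ 𝒜_{s,j}(U_s)`, where
`s = τ(x)`. -/
def IsOrderMap (φ : X.A.unitsSheaf ⟶ SheafAux.constZ X.C.carrier) : Prop :=
  ∀ (U : X.C.Opens) (a : X.A.unitsSheaf.presheaf.obj (op U)) (x : X.C) (hx : x ∈ U),
    IsGreatest (X.ordSet (X.A.unitVal a) (X.τ x)) ((φ.hom.app (op U) a).1 ⟨x, hx⟩).down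

/-- The kernel of `φ : 𝒜^* → ℤ_C`, described through exponentials, and the resulting exact
sequences of sheaves:
* `Ker φ` is the amalgamated sum of `𝒜_0^*` and `𝒩_S ⊠ 𝒜` over `𝒩_S ⊠ 𝒜_0`, where
  `𝒩_S ⊠ 𝒜 → Ker φ` and `𝒩_S ⊠ 𝒜_0 → 𝒜_0^*` are the exponential maps `n ⊗ a ↦ exp (n a)`;
* `1 → Ker φ → 𝒜^* → ℤ_C → 0` is exact;
* `0 → 𝒩_S ⊠ (𝒜 / 𝒜_0) → 𝒜^* / 𝒜_0^* → ℤ_C → 0` is exact, where the first map is induced by the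
  exponential and the second one by `φ`;
* `1 → 𝒜_0^* → Ker φ → 𝒩_S ⊠ (𝒜 / 𝒜_0) → 0` is exact, where the second map sends `exp t` to the
  class of `t`. -/
def ExpSequences (φ : X.A.unitsSheaf ⟶ SheafAux.constZ X.C.carrier) : Prop :=
  ∃ (i : X.unitsZero ⟶ kernel φ) (e : X.famA.box ⟶ kernel φ) (e₀ : X.famA₀.box ⟶ X.unitsZero)
    (φ' : cokernel X.unitsZeroι ⟶ SheafAux.constZ X.C.carrier)
    (δ : X.famQuot.box ⟶ cokernel X.unitsZeroι) (ℓ : kernel φ ⟶ X.famQuot.box),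
    i ≫ kernel.ι φ = X.unitsZeroι ∧
    (∀ (V : S.Opens) (U : X.C.Opens) (h : U ≤ X.τ ⁻¹ᵁ V) (n : Γ(S, V)) (hn : IsNilpotent n)
      (a : X.A.sec U), X.A.unitVal ((e ≫ kernel.ι φ).hom.app (op U) (X.tmulA h n hn a)) =
        nilExp (X.algMap h n * a)) ∧
    (∀ (V : S.Opens) (U : X.C.Opens) (h : U ≤ X.τ ⁻¹ᵁ V) (n : Γ(S, V)) (hn : IsNilpotent n)
      (a : X.A.sec U) (ha : a ∈ X.A.fil 0 U),
      X.A.unitVal ((e₀ ≫ X.unitsZeroι).hom.app (op U) (X.tmulA₀ h n hn a ha)) =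
        nilExp (X.algMap h n * a)) ∧
    IsPushout X.boxIncl e₀ e i ∧
    (ShortComplex.mk (kernel.ι φ) φ (kernel.condition φ)).ShortExact ∧
    cokernel.π X.unitsZeroι ≫ φ' = φ ∧
    X.boxProj ≫ δ = e ≫ kernel.ι φ ≫ cokernel.π X.unitsZeroι ∧
    (∃ w : δ ≫ φ' = 0, (ShortComplex.mk δ φ' w).ShortExact) ∧
    e ≫ ℓ = X.boxProj ∧
    (∃ w : i ≫ ℓ = 0, (ShortComplex.mk i ℓ w).ShortExact)

/-! ### Base change -/

/-- The ring `𝒜(U)` as an algebra over `𝒪_S(V)`, for `U ⊆ τ⁻¹V`. -/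
def SecOver {V : S.Opens} {U : X.C.Opens} (_h : U ≤ X.τ ⁻¹ᵁ V) : Type u := X.A.sec U

instance {V : S.Opens} {U : X.C.Opens} (h : U ≤ X.τ ⁻¹ᵁ V) : CommRing (X.SecOver h) :=
  inferInstanceAs (CommRing (X.A.sec U))

instance {V : S.Opens} {U : X.C.Opens} (h : U ≤ X.τ ⁻¹ᵁ V) : Algebra Γ(S, V) (X.SecOver h) :=
  (X.algMap h).toAlgebra

theorem algMap_mul_mem {V : S.Opens} {U : X.C.Opens} (h : U ≤ X.τ ⁻¹ᵁ V) (r : Γ(S, V)) {i : ℤ}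
    {a : X.A.sec U} (ha : a ∈ X.A.fil i U) : X.algMap h r * a ∈ X.A.fil i U := by
  have := X.A.mul_mem (X.algMap_mem h r) ha
  rwa [zero_add] at this

/-- `𝒜_i(U)` as an `𝒪_S(V)`-module. -/
def secSub {V : S.Opens} {U : X.C.Opens} (h : U ≤ X.τ ⁻¹ᵁ V) (i : ℤ) :
    Submodule Γ(S, V) (X.SecOver h) where
  __ := X.A.fil i U
  smul_mem' r _ ha := X.algMap_mul_mem h r ha

/-- `𝒜_i(U) / 𝒜_j(U)` as an `𝒪_S(V)`-module. For affine `U` and `i ≤ j` this is the module of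
sections of the sheaf `𝒜_i / 𝒜_j` over `U`. -/
def secQuot {V : S.Opens} {U : X.C.Opens} (h : U ≤ X.τ ⁻¹ᵁ V) (i j : ℤ) : Type u :=
  X.secSub h i ⧸ (X.secSub h j).submoduleOf (X.secSub h i)

instance {V : S.Opens} {U : X.C.Opens} (h : U ≤ X.τ ⁻¹ᵁ V) (i j : ℤ) :
    AddCommGroup (X.secQuot h i j) :=
  inferInstanceAs (AddCommGroup (X.secSub h i ⧸ (X.secSub h j).submoduleOf (X.secSub h i)))

instance {V : S.Opens} {U : X.C.Opens} (h : U ≤ X.τ ⁻¹ᵁ V) (i j : ℤ) :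
    Module Γ(S, V) (X.secQuot h i j) :=
  inferInstanceAs (Module Γ(S, V) (X.secSub h i ⧸ (X.secSub h j).submoduleOf (X.secSub h i)))

/-- The class of a section of `𝒜_i` in `𝒜_i(U) / 𝒜_j(U)`. -/
def secQuotMk {V : S.Opens} {U : X.C.Opens} (h : U ≤ X.τ ⁻¹ᵁ V) (i j : ℤ) (a : X.A.sec U)
    (ha : a ∈ X.A.fil i U) : X.secQuot h i j :=
  (Submodule.Quotient.mk (⟨a, ha⟩ : X.secSub h i) :
    X.secSub h i ⧸ (X.secSub h j).submoduleOf (X.secSub h i))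

/-- `X'` is the base change of `X` along `α : S' ⟶ S`: `C' = C ×_S S'`, and there is a homomorphism
of filtered sheaves of algebras `𝒜 → p_* 𝒜'` that identifies `𝒜'_i / 𝒜'_j` with
`(𝒜_i / 𝒜_j) ⊠_{𝒪_S} 𝒪_{S'}` for `i ≤ j`, that is, with `(𝒜_i / 𝒜_j)(U) ⊗_{𝒪(V)} 𝒪(V')` on the
affine open sets `U ×_V V'` of `C'`. If `X'` is a ribbon, then
`𝒜'_i = lim_j (𝒜_i / 𝒜_{i+j}) ⊠ 𝒪_{S'}` and `𝒜' = colim 𝒜'_i`. -/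
structure BaseChangeData {S' : Scheme.{u}} (α : S' ⟶ S) (X' : PreRibbon S') where
  p : X'.C ⟶ X.C
  isPullback : IsPullback p X'.τ X.τ α
  φ : X.A.sheaf.presheaf ⟶
    (TopCat.Presheaf.pushforward CommRingCat.{u} p.base).obj X'.A.sheaf.presheaf
  φ_fil : ∀ (i : ℤ) (U : X.C.Opens) (a : X.A.sec U), a ∈ X.A.fil i U →
    φ.app (op U) a ∈ X'.A.fil i (p ⁻¹ᵁ U)
  φ_alg : ∀ (V : S.Opens) (V' : S'.Opens) (hV : V' ≤ α ⁻¹ᵁ V) (U : X.C.Opens)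
    (h : U ≤ X.τ ⁻¹ᵁ V) (r : Γ(S, V)),
    X'.A.res (inf_le_left : p ⁻¹ᵁ U ⊓ X'.τ ⁻¹ᵁ V' ≤ p ⁻¹ᵁ U) (φ.app (op U) (X.algMap h r)) =
      X'.algMap inf_le_right (α.appLE V V' hV r)
  φ_residue : ∀ (U : X.C.Opens) (a : X.A.zeroRing U),
    X'.residue (p ⁻¹ᵁ U) ⟨φ.app (op U) a.1, φ_fil 0 U a.1 a.2⟩ = p.app U (X.residue U a)
  φ_box : ∀ (i j : ℤ), i ≤ j → ∀ (V : S.Opens) (V' : S'.Opens) (hV : V' ≤ α ⁻¹ᵁ V)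
    (U : X.C.Opens) (h : U ≤ X.τ ⁻¹ᵁ V), IsAffineOpen V → IsAffineOpen V' → IsAffineOpen U →
    letI : Algebra Γ(S, V) Γ(S', V') := (α.appLE V V' hV).hom.toAlgebra
    ∃ ψ : X.secQuot h i j ⊗[Γ(S, V)] Γ(S', V') ≃+
        X'.secQuot (inf_le_right : p ⁻¹ᵁ U ⊓ X'.τ ⁻¹ᵁ V' ≤ X'.τ ⁻¹ᵁ V') i j,
      ∀ (a : X.A.sec U) (ha : a ∈ X.A.fil i U) (r : Γ(S', V')),
        ψ (X.secQuotMk h i j a ha ⊗ₜ[Γ(S, V)] r) =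
          X'.secQuotMk inf_le_right i j
            (X'.algMap inf_le_right r * X'.A.res inf_le_left (φ.app (op U) a))
            (X'.algMap_mul_mem _ r (X'.A.fil_res i inf_le_left (φ_fil i U a ha)))

end PreRibbon

end

/-! Orders are read off at the generic points of the fibres, and everything else is transported from
there. Let `x` lie over `s`, and let 𝔪 and 𝒩 be the maximal ideal and the nilradical of 𝒪_{S,s}.
Flatness of the graded pieces gives I𝒜_x ∩ 𝒜_{j,x} = I𝒜_{j,x} for every ideal I
(`smul_top_inf_le_smul`). Hence the graded pieces of 𝒜_x/𝔪𝒜_x are the fibres of the graded pieces of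
𝒜. The piece of degree 0 is 𝒪_{C,x}/𝔪𝒪_{C,x}, a domain because the fibre is reduced and irreducible.
Near P_s, and so near the generic point of C_s, there is a section of 𝒜_1 with inverse in 𝒜_{-1}
(`hasUniformizer_of_isInvertibleAt`). Therefore orders of units exist at that generic point and are
additive.

The central result is `germ_mem_sup_of_fiberGen`: if a section has order at least j at the generic
points of the fibres over a set of generalisations of s, then its germ at `x` lies in 𝒜_j + I𝒜,
where I is the ideal attached to these generalisations. The proof climbs the filtration one step at
a time. In a graded piece, a section vanishing at the generic point of a fibre vanishes on the fibre
except at finitely many points, hence everywhere by torsion-freeness. Coherence and flatness then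
carry this vanishing to `x`, modulo the prime of the fibre.

For a single generalisation s', this says that the order does not decrease under specialisation.
Applied to the inverse of a unit as well, it shows that the order is invariant, hence locally
constant on a Noetherian base. For all generalisations, I is the nilradical, so a unit of order zero
and its inverse both lie in 𝒜_0 + 𝒩𝒜. Since 𝒩𝒜 ∩ 𝒜_0 = 𝒩𝒜_0, the unit factors locally through 𝒜_0^*
and 1 + 𝒩𝒜, and these two groups meet in 1 + 𝒩𝒜_0. This is the amalgamated sum.

In characteristic zero, exp maps 𝒩 ⊗ 𝒜 onto 1 + 𝒩𝒜 on stalks, and exp(t) lies in 𝒜_0 only if t comes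
from 𝒩 ⊗ 𝒜_0 (`exists_lTensor_eq_of_boxExp_mem`). This yields the second amalgamated sum. The
logarithm is defined by its universal property, and the remaining exact sequences follow by diagram
chases. -/

/-! ### Flat quotients and ideals -/

section FlatQuotient

variable {R M : Type*} [CommRing R] [AddCommGroup M] [Module R M]

/-- The multiplication map `I ⊗ M → M`. -/
noncomputable def idealMul (I : Ideal R) (M : Type*) [AddCommGroup M] [Module R M] :
    I ⊗[R] M →ₗ[R] M :=
  (TensorProduct.lid R M).toLinearMap ∘ₗ I.subtype.rTensor M

@[simp]
theorem idealMul_tmul (I : Ideal R) (r : I) (m : M) : idealMul I M (r ⊗ₜ m) = (r : R) • m := by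
  simp [idealMul]

theorem idealMul_lTensor {N : Type*} [AddCommGroup N] [Module R N] (I : Ideal R) (f : N →ₗ[R] M)
    (t : I ⊗[R] N) : idealMul I M (f.lTensor I t) = f (idealMul I N t) := by
  induction t with
  | zero => simp
  | tmul x y => simp
  | add x y hx hy => simp [hx, hy]

theorem idealMul_mem (I : Ideal R) (t : I ⊗[R] M) : idealMul I M t ∈ I • (⊤ : Submodule R M) := by
  induction t with
  | zero => simp
  | tmul x y => rw [idealMul_tmul]; exact Submodule.smul_mem_smul x.2 trivial
  | add x y hx hy => rw [map_add]; exact add_mem hx hy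

theorem exists_idealMul_eq (I : Ideal R) (P : Submodule R M) {a : M} (ha : a ∈ I • P) :
    ∃ t : I ⊗[R] P, (idealMul I P t : M) = a := by
  refine Submodule.smul_induction_on ha (fun r hr n hn => ?_) (fun x y hx hy => ?_)
  · exact ⟨⟨r, hr⟩ ⊗ₜ ⟨n, hn⟩, by simp⟩
  · obtain ⟨s, rfl⟩ := hx
    obtain ⟨t, rfl⟩ := hy
    exact ⟨s + t, by simp⟩

theorem idealMul_mem_smul (I : Ideal R) (P : Submodule R M) (t : I ⊗[R] P) :
    (idealMul I P t : M) ∈ I • P := by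
  induction t with
  | zero => simp
  | tmul x y => rw [idealMul_tmul]; exact Submodule.smul_mem_smul x.2 y.2
  | add x y hx hy => rw [map_add]; exact add_mem hx hy

theorem idealMul_injective (I : Ideal R) [Module.Flat R M] :
    Function.Injective (idealMul I M) :=
  (TensorProduct.lid R M).injective.comp
    (Module.Flat.rTensor_preserves_injective_linearMap I.subtype I.subtype_injective)

/-- The image of `t` in I ⊗ (P/N) multiplies to zero in P/N. Flatness of P/N makes that
multiplication injective, and right exactness of I ⊗ - then lifts `t`. -/
theorem exists_lTensor_inclusion {N P : Submodule R M} (hNP : N ≤ P)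
    [Module.Flat R (P ⧸ N.submoduleOf P)] (I : Ideal R) (t : I ⊗[R] P)
    (ht : (idealMul I P t : M) ∈ N) :
    ∃ t' : I ⊗[R] N, (Submodule.inclusion hNP).lTensor I t' = t := by
  have hex : Function.Exact (Submodule.inclusion hNP) (N.submoduleOf P).mkQ := by
    intro x
    rw [Submodule.mkQ_apply, Submodule.Quotient.mk_eq_zero]
    exact ⟨fun h => ⟨⟨x.1, h⟩, rfl⟩, by rintro ⟨y, rfl⟩; exact y.2⟩
  refine (lTensor_exact I hex (N.submoduleOf P).mkQ_surjective t).1 ?_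
  apply idealMul_injective I
  rw [idealMul_lTensor, map_zero, Submodule.mkQ_apply, Submodule.Quotient.mk_eq_zero]
  exact ht

theorem mk_mem_smul_top_iff {N P : Submodule R M} (I : Ideal R) (a : P) :
    (N.submoduleOf P).mkQ a ∈ I • (⊤ : Submodule R (P ⧸ N.submoduleOf P)) ↔
      (a : M) ∈ N ⊔ I • P := by
  have h1 : I • (⊤ : Submodule R (P ⧸ N.submoduleOf P)) =
      (I • (⊤ : Submodule R P)).map (N.submoduleOf P).mkQ := by
    rw [Submodule.map_smul'', Submodule.map_top, Submodule.range_mkQ]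
  have h2 : (I • (⊤ : Submodule R P)).map P.subtype = I • P := by
    rw [Submodule.map_smul'', Submodule.map_top, Submodule.range_subtype]
  rw [h1, Submodule.mem_map, Submodule.mem_sup]
  constructor
  · rintro ⟨y, hy, h⟩
    have h3 := (Submodule.Quotient.eq _).1 h.symm
    refine ⟨a - y, h3, y, h2 ▸ ⟨y, hy, rfl⟩, by simp⟩
  · rintro ⟨y, hy, z, hz, h⟩
    rw [← h2] at hz
    obtain ⟨z, hz, rfl⟩ := hz
    refine ⟨z, hz, ((Submodule.Quotient.eq _).2 ?_).symm⟩
    change (a : M) - z ∈ N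
    rw [← h]
    simpa using hy

/-- Multiplication by `r` is injective on the domain R/p, and stays so after tensoring with the flat
module M. -/
theorem mem_smul_top_of_smul_mem [Module.Flat R M] (p : Ideal R) [p.IsPrime] {r : R} (hr : r ∉ p)
    {m : M} (h : r • m ∈ p • (⊤ : Submodule R M)) : m ∈ p • (⊤ : Submodule R M) := by
  have hinj : Function.Injective (LinearMap.lsmul R (R ⧸ p) r) := by
    rw [injective_iff_map_eq_zero]
    intro x hx
    obtain ⟨x, rfl⟩ := Ideal.Quotient.mk_surjective x
    rw [LinearMap.lsmul_apply, Algebra.smul_def, Ideal.Quotient.algebraMap_eq, ← map_mul,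
      Ideal.Quotient.eq_zero_iff_mem] at hx
    exact Ideal.Quotient.eq_zero_iff_mem.2 ((Ideal.IsPrime.mem_or_mem ‹_› hx).resolve_left hr)
  have hinj' := Module.Flat.rTensor_preserves_injective_linearMap (M := M) _ hinj
  let e := TensorProduct.quotTensorEquivQuotSMul M p
  have key : ∀ m : M, e (1 ⊗ₜ m) = Submodule.Quotient.mk m := fun m => by
    exact quotTensorEquivQuotSMul_mk_tmul p (1 : R) m |>.trans (by simp)
  rw [← Submodule.Quotient.mk_eq_zero, ← key] at h ⊢
  rw [map_eq_zero_iff _ e.injective] at h ⊢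
  apply hinj'
  rw [LinearMap.rTensor_tmul, map_zero, LinearMap.lsmul_apply, TensorProduct.smul_tmul, h]

/-- The embedding of R/(I ∩ J) into R/I × R/J remains injective after tensoring with M. -/
theorem smul_top_inf_le [Module.Flat R M] (I J : Ideal R) :
    I • (⊤ : Submodule R M) ⊓ J • ⊤ ≤ (I ⊓ J) • ⊤ := by
  rintro m ⟨hI, hJ⟩
  let f : (R ⧸ I ⊓ J) →ₗ[R] (R ⧸ I) × (R ⧸ J) :=
    (Submodule.factor inf_le_left).prod (Submodule.factor inf_le_right)
  have hinj : Function.Injective f := by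
    rw [injective_iff_map_eq_zero]
    intro x hx
    obtain ⟨x, rfl⟩ := Submodule.mkQ_surjective _ x
    have h1 := congrArg Prod.fst hx
    have h2 := congrArg Prod.snd hx
    exact (Submodule.Quotient.mk_eq_zero _).2
      ⟨(Submodule.Quotient.mk_eq_zero _).1 h1, (Submodule.Quotient.mk_eq_zero _).1 h2⟩
  have hinj' := Module.Flat.rTensor_preserves_injective_linearMap (M := M) _ hinj
  have key : ∀ (p : Ideal R) (m : M), m ∈ p • (⊤ : Submodule R M) ↔
      (Submodule.Quotient.mk 1 : R ⧸ p) ⊗ₜ[R] m = 0 := fun p m => by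
    let e := TensorProduct.quotTensorEquivQuotSMul M p
    have : e ((Submodule.Quotient.mk 1 : R ⧸ p) ⊗ₜ m) = Submodule.Quotient.mk m :=
      quotTensorEquivQuotSMul_mk_tmul p (1 : R) m |>.trans (by simp)
    rw [← Submodule.Quotient.mk_eq_zero, ← this, map_eq_zero_iff _ e.injective]
  rw [SetLike.mem_coe, key] at hI hJ
  rw [key]
  apply hinj'
  rw [LinearMap.rTensor_tmul, map_zero]
  apply (TensorProduct.prodLeft R R (R ⧸ I) (R ⧸ J) M).injective
  rw [map_zero]
  exact Prod.ext hI hJ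

theorem mem_finset_inf_smul_top [Module.Flat R M] (s : Finset (Ideal R)) {m : M}
    (h : ∀ I ∈ s, m ∈ I • (⊤ : Submodule R M)) : m ∈ s.inf id • (⊤ : Submodule R M) := by
  classical
  induction s using Finset.induction_on with
  | empty => simp
  | insert I s _ ih =>
    rw [Finset.inf_insert]
    exact smul_top_inf_le _ _ ⟨h _ (Finset.mem_insert_self _ _),
      ih fun J hJ => h J (Finset.mem_insert_of_mem hJ)⟩

theorem mem_sup_smul_of_smul_mem {N P : Submodule R M}
    [Module.Flat R (P ⧸ N.submoduleOf P)] (p : Ideal R) [p.IsPrime] {r : R} (hr : r ∉ p) {a : M}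
    (ha : a ∈ P) (h : r • a ∈ N ⊔ p • P) : a ∈ N ⊔ p • P := by
  rw [← mk_mem_smul_top_iff p ⟨a, ha⟩]
  refine mem_smul_top_of_smul_mem p hr ?_
  rw [← map_smul]
  exact (mk_mem_smul_top_iff p (r • ⟨a, ha⟩)).2 h

/-- A Noetherian ring has finitely many minimal primes, so the nilradical is a finite intersection
and the result for two ideals can be iterated on the flat quotient P/N. -/
theorem mem_sup_nilradical_smul [IsNoetherianRing R] {N P : Submodule R M}
    [Module.Flat R (P ⧸ N.submoduleOf P)] {a : M} (ha : a ∈ P)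
    (h : ∀ p ∈ minimalPrimes R, a ∈ N ⊔ p • P) : a ∈ N ⊔ nilradical R • P := by
  have hfin := minimalPrimes.finite_of_isNoetherianRing R
  have hnil : hfin.toFinset.inf id = nilradical R := by
    rw [nilradical, ← Ideal.sInf_minimalPrimes, Finset.inf_id_eq_sInf]
    simp [minimalPrimes]
  rw [← mk_mem_smul_top_iff _ ⟨a, ha⟩, ← hnil]
  refine mem_finset_inf_smul_top _ fun p hp => ?_
  rw [mk_mem_smul_top_iff p ⟨a, ha⟩]
  exact h p (hfin.mem_toFinset.1 hp)

variable (F : ℤ → Submodule R M) (anti : Antitone F) (exhaust : ∀ a, ∃ i, a ∈ F i)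
  (hflat : ∀ i, Module.Flat R (F i ⧸ (F (i + 1)).submoduleOf (F i)))

-- A tensor involves finitely many elements of M, so it already lives on some step of the
-- filtration. The bound `i ≤ j` provides a starting point for an upward induction ending at `j`.
include anti exhaust in
theorem exists_lTensor_subtype_of_exhaust (I : Ideal R) (t : I ⊗[R] M) (j : ℤ) :
    ∃ i ≤ j, ∃ t' : I ⊗[R] F i, (F i).subtype.lTensor I t' = t := by
  induction t with
  | zero => exact ⟨j, le_rfl, 0, by simp⟩
  | tmul r m =>
    obtain ⟨i, hi⟩ := exhaust m
    exact ⟨min i j, min_le_right _ _, r ⊗ₜ ⟨m, anti (min_le_left _ _) hi⟩, by simp⟩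
  | add x y hx hy =>
    obtain ⟨i, hi, x, rfl⟩ := hx
    obtain ⟨k, hk, y, rfl⟩ := hy
    refine ⟨min i k, (min_le_left _ _).trans hi,
      (Submodule.inclusion (anti (min_le_left i k))).lTensor I x +
      (Submodule.inclusion (anti (min_le_right i k))).lTensor I y, ?_⟩
    rw [map_add, ← LinearMap.comp_apply, ← LinearMap.comp_apply, ← LinearMap.lTensor_comp,
      ← LinearMap.lTensor_comp]
    rfl

include anti exhaust hflat in
/-- If the graded pieces of an exhaustive filtration are flat, an element of `I ⊗ M` whose product
lies in `F j` comes from `I ⊗ F j`. -/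
theorem exists_lTensor_subtype (I : Ideal R) (t : I ⊗[R] M) (j : ℤ) (ht : idealMul I M t ∈ F j) :
    ∃ t' : I ⊗[R] F j, (F j).subtype.lTensor I t' = t := by
  obtain ⟨i, hij, h⟩ := exists_lTensor_subtype_of_exhaust F anti exhaust I t j
  -- Climb from `F i` to `F j` one step at a time; each step needs only flatness of a single graded
  -- piece.
  induction j, hij using Int.leInduction with
  | base => exact h
  | succ j hij ih =>
    have hj : F (j + 1) ≤ F j := anti (by omega)
    obtain ⟨s, rfl⟩ := ih (hj ht)
    have := hflat j
    rw [idealMul_lTensor] at ht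
    obtain ⟨s', rfl⟩ := exists_lTensor_inclusion hj I s ht
    refine ⟨s', ?_⟩
    rw [← LinearMap.comp_apply, ← LinearMap.lTensor_comp]
    rfl

-- Flatness of the graded pieces forces I M ∩ F j = I (F j). M itself need not be flat.
include anti exhaust hflat in
theorem smul_top_inf_le_smul (I : Ideal R) (j : ℤ) {a : M} (ha : a ∈ I • (⊤ : Submodule R M))
    (haj : a ∈ F j) : a ∈ I • F j := by
  obtain ⟨t, ht⟩ := exists_idealMul_eq I ⊤ ha
  have h1 : idealMul I M ((⊤ : Submodule R M).subtype.lTensor I t) = a := by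
    rw [idealMul_lTensor]; exact ht
  obtain ⟨s, hs⟩ := exists_lTensor_subtype F anti exhaust hflat I _ j (by rw [h1]; exact haj)
  rw [← hs, idealMul_lTensor] at h1
  rw [← h1]
  exact idealMul_mem_smul I _ s

end FlatQuotient

/-! ### Exponentials of nilpotent elements -/

section NilpotentExp

variable {R : Type*} [CommRing R] [Algebra ℚ R]

open Polynomial IsNilpotent

theorem IsNilpotent.exp_eq_aeval {z : R} {n : ℕ} (h : z ^ n = 0) :
    exp z = aeval z (∑ k ∈ Finset.range n, C (k.factorial : ℚ)⁻¹ * X ^ k) := by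
  rw [exp_eq_sum h, map_sum]
  refine Finset.sum_congr rfl fun k _ => ?_
  rw [map_mul, aeval_C, map_pow, aeval_X, Algebra.smul_def]

variable (B : AddSubgroup R) (hmul : ∀ a ∈ B, ∀ b ∈ B, a * b ∈ B) (hrat : ∀ (q : ℚ), ∀ a ∈ B, q • a ∈ B)

omit [Algebra ℚ R] in
include hmul in
theorem AddSubgroup.pow_succ_mem {a : R} (ha : a ∈ B) (n : ℕ) : a ^ (n + 1) ∈ B := by
  induction n with
  | zero => simpa using ha
  | succ n ih => rw [_root_.pow_succ]; exact hmul _ ih _ ha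

include hmul hrat in
theorem IsNilpotent.exp_sub_one_mem {z : R} (hz : IsNilpotent z) (hB : z ∈ B) : exp z - 1 ∈ B := by
  obtain ⟨n, hn⟩ := hz
  rw [exp_eq_sum (pow_eq_zero_of_le n.le_succ hn), Finset.sum_range_succ']
  simp only [pow_zero, Nat.factorial_zero, Nat.cast_one, inv_one, one_smul, add_sub_cancel_right]
  exact AddSubgroup.sum_mem _ fun k _ => hrat _ _ (B.pow_succ_mem hmul hB k)

-- This replaces the logarithm series: `B` is a ℚ-algebra without unit, and z is recovered from
-- powers of exp(z) - 1 by successive elimination of the lowest term.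
include hmul hrat in
theorem IsNilpotent.mem_of_exp_sub_one_mem {z : R} (hz : IsNilpotent z) (hB : exp z - 1 ∈ B) :
    z ∈ B := by
  obtain ⟨n, hn⟩ := hz
  have hn2 : z ^ (n + 2) = 0 := pow_eq_zero_of_le (by omega) hn
  let W : ℚ[X] := ∑ k ∈ Finset.range n, C ((k + 2).factorial : ℚ)⁻¹ * X ^ k
  have hV : exp z - 1 = aeval z (X * (1 + X * W)) := by
    rw [exp_eq_aeval hn2, Finset.sum_range_succ', Finset.sum_range_succ']
    simp only [W, mul_add, Finset.mul_sum, map_add, map_sum, map_mul, aeval_X, aeval_C, map_one,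
      map_pow, pow_zero, Nat.factorial, Nat.cast_one, inv_one]
    have : ∀ k ∈ Finset.range n, z * (z * ((algebraMap ℚ R) ((k + 1 + 1).factorial : ℚ)⁻¹ * z ^ k)) =
      (algebraMap ℚ R) ((k + 1 + 1).factorial : ℚ)⁻¹ * z ^ (k + 1 + 1) := fun k _ => by ring
    have h2 := Finset.sum_congr rfl this
    simp only [Nat.factorial] at h2
    rw [h2]
    simp
    ring
  -- Descending induction on the exponent `j + 1`, with `d` bounding its distance to the nilpotency
  -- exponent `n`. For `d = 0` the power of z vanishes.
  have key : ∀ d j : ℕ, n ≤ j + 1 + d → ∀ P : ℚ[X], aeval z (X ^ (j + 1) * P) ∈ B := by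
    intro d
    induction d with
    | zero =>
      intro j hj P
      rw [map_mul, map_pow, aeval_X, pow_eq_zero_of_le hj hn, zero_mul]
      exact B.zero_mem
    | succ d ih =>
      intro j hj P
      obtain ⟨W', hW'⟩ : X ∣ (1 + X * W) ^ (j + 1) - 1 := by
        have := sub_dvd_pow_sub_pow (1 + X * W) 1 (j + 1)
        rw [one_pow, add_sub_cancel_left] at this
        exact (dvd_mul_right X W).trans this
      -- Remove the term of degree `j + 1` with a multiple of (exp(z) - 1)^(j+1), which lies in `B`;
      -- the remainder is divisible by one more power of X.
      have h1 : X ^ (j + 1) * P = P.coeff 0 • (X * (1 + X * W)) ^ (j + 1) +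
          X ^ (j + 1 + 1) * (P.divX - C (P.coeff 0) * W') := by
        rw [smul_eq_C_mul, mul_pow]
        conv_lhs => rw [← P.divX_mul_X_add]
        linear_combination (-C (P.coeff 0) * X ^ (j + 1)) * hW'
      rw [h1, map_add, map_smul, map_pow, ← hV]
      exact B.add_mem (hrat _ _ (B.pow_succ_mem hmul hB j)) (ih (j + 1) (by omega) _)
  simpa using key n 0 (by omega) 1

-- Successive approximation: multiplying 1 + v by exp(-v) replaces the error v by an error divisible
-- by v², so the nilpotency exponent falls until v is zero.
include hmul hrat in
theorem IsNilpotent.exists_exp_eq_one_add {v : R} (hv : IsNilpotent v) (hB : v ∈ B) :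
    ∃ z ∈ B, IsNilpotent z ∧ exp z = 1 + v := by
  obtain ⟨n, hn⟩ := hv
  induction n using Nat.strong_induction_on generalizing v with
  | _ n ih =>
    rcases Nat.lt_or_ge n 2 with h2 | h2
    · have h0 : v = 0 := by simpa using pow_eq_zero_of_le (show n ≤ 1 by omega) hn
      exact ⟨0, B.zero_mem, IsNilpotent.zero, by rw [h0, exp_zero, add_zero]⟩
    · have hnil : IsNilpotent v := ⟨n, hn⟩
      have hneg : IsNilpotent (-v) := hnil.neg
      obtain ⟨m, rfl⟩ := Nat.exists_eq_add_of_le' h2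
      obtain ⟨w, hw⟩ : ∃ w, exp (-v) = 1 - v + v ^ 2 * w := by
        have hn' : (-v) ^ (m + 2) = 0 := by rw [neg_pow, hn, mul_zero]
        rw [exp_eq_sum hn', Finset.sum_range_succ', Finset.sum_range_succ']
        refine ⟨∑ k ∈ Finset.range m, ((k + 2).factorial : ℚ)⁻¹ • (-v) ^ k, ?_⟩
        rw [Finset.mul_sum]
        have : ∀ k ∈ Finset.range m, v ^ 2 * ((k + 2).factorial : ℚ)⁻¹ • (-v) ^ k =
            ((k + 1 + 1).factorial : ℚ)⁻¹ • (-v) ^ (k + 1 + 1) := fun k _ => by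
          rw [mul_smul_comm]; congr 1; ring
        rw [Finset.sum_congr rfl this]
        simp
        ring
      set v' := exp (-v) * (1 + v) - 1 with hv'
      have hmem : v' ∈ B := by
        have h1 := exp_sub_one_mem B hmul hrat hneg (B.neg_mem hB)
        have : v' = (exp (-v) - 1) + (exp (-v) - 1) * v + v := by rw [hv']; ring
        rw [this]
        exact B.add_mem (B.add_mem h1 (hmul _ h1 _ hB)) hB
      -- As v' is a multiple of v², its power of exponent m + 1 contains v^(2m+2), which vanishes
      -- because v^(m+2) = 0.
      have hpow : v' ^ (m + 1) = 0 := by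
        have : v' = v ^ 2 * (-1 + w * (1 + v)) := by rw [hv', hw]; ring
        rw [this, mul_pow, ← pow_mul, pow_eq_zero_of_le (by omega) hn, zero_mul]
      obtain ⟨z, hzB, hz, hexp⟩ := ih (m + 1) (by omega) hmem hpow
      refine ⟨v + z, B.add_mem hB hzB, (Commute.all v z).isNilpotent_add hnil hz, ?_⟩
      rw [exp_add_of_commute (Commute.all v z) hnil hz, hexp, hv', add_sub_cancel, ← mul_assoc,
        exp_mul_exp_neg_self hnil, one_mul]

end NilpotentExp

/-! ### Sheaves of abelian groups -/

namespace SheafAux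

section Locally

variable {T : TopCat.{u}} {F F₁ F₂ G H : TopCat.Sheaf AddCommGrpCat.{u} T}

theorem sheaf_hom_ext {f g : F ⟶ G}
    (h : ∀ (U : Opens T) (s : F.presheaf.obj (op U)), f.hom.app (op U) s = g.hom.app (op U) s) :
    f = g := by
  apply ObjectProperty.hom_ext
  ext U s
  exact h _ _

theorem hom_app_map (f : F ⟶ G) {U V : Opens T} (h : V ≤ U) (s : F.presheaf.obj (op U)) :
    f.hom.app (op V) (F.presheaf.map (homOfLE h).op s) =
      G.presheaf.map (homOfLE h).op (f.hom.app (op U) s) :=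
  ConcreteCategory.congr_hom (f.hom.naturality (homOfLE h).op) s

theorem app_injective_of_mono (f : F ⟶ G) [hf : Mono f] (U : Opens T) :
    Function.Injective (f.hom.app (op U)) := by
  have : (TopCat.Sheaf.forget AddCommGrpCat.{u} T).PreservesMonomorphisms :=
    inferInstanceAs (sheafToPresheaf (Opens.grothendieckTopology T) AddCommGrpCat.{u}).PreservesMonomorphisms
  have h2 : Mono f.hom := inferInstanceAs (Mono ((TopCat.Sheaf.forget _ _).map f))
  have h3 : Mono (f.hom.app (op U)) := inferInstance
  exact (AddCommGrpCat.mono_iff_injective _).1 h3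

theorem mono_of_app_injective (f : F ⟶ G)
    (h : ∀ U : Opens T, Function.Injective (f.hom.app (op U))) : Mono f where
  right_cancellation a b hab := sheaf_hom_ext fun U s => h U (by
    have := congrArg (fun k => k.hom.app (op U) s) hab
    exact this)

theorem epi_of_locally_surjective (f : F ⟶ G)
    (h : ∀ (U : Opens T) (s : G.presheaf.obj (op U)), ∀ x ∈ U, ∃ (V : Opens T) (hV : V ≤ U)
      (a : F.presheaf.obj (op V)), x ∈ V ∧ f.hom.app (op V) a = G.presheaf.map (homOfLE hV).op s) :
    Epi f where
  left_cancellation {H} a b hab := sheaf_hom_ext fun U s => by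
    refine TopCat.Presheaf.IsSheaf.section_ext H.2 fun x hx => ?_
    obtain ⟨V, hV, t, hxV, ht⟩ := h U s x hx
    refine ⟨V, hV, hxV, ?_⟩
    refine (hom_app_map a hV s).symm.trans (Eq.trans ?_ (hom_app_map b hV s))
    rw [← ht]
    exact congrArg (fun k => k.hom.app (op V) t) hab

theorem kernel_ι_app (f : F ⟶ G) (U : Opens T) (s : (kernel f).presheaf.obj (op U)) :
    f.hom.app (op U) ((kernel.ι f).hom.app (op U) s) = 0 := by
  have := congrArg (fun k => k.hom.app (op U) s) (kernel.condition f)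
  exact this

theorem exact_of_locally (f : F ⟶ G) (g : G ⟶ H) (w : f ≫ g = 0)
    (h : ∀ (U : Opens T) (s : G.presheaf.obj (op U)), g.hom.app (op U) s = 0 → ∀ x ∈ U,
      ∃ (V : Opens T) (hV : V ≤ U) (a : F.presheaf.obj (op V)), x ∈ V ∧
        f.hom.app (op V) a = G.presheaf.map (homOfLE hV).op s) :
    (ShortComplex.mk f g w).Exact := by
  rw [ShortComplex.exact_iff_epi_kernel_lift]
  refine epi_of_locally_surjective _ fun U s x hx => ?_
  obtain ⟨V, hV, a, hxV, ha⟩ := h U ((kernel.ι g).hom.app (op U) s) (kernel_ι_app g U s) x hx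
  refine ⟨V, hV, a, hxV, app_injective_of_mono (kernel.ι g) V ?_⟩
  rw [hom_app_map, ← ha]
  exact congrArg (fun k => k.hom.app (op V) a) (kernel.lift_ι g f w)

/-- A square of sheaves of abelian groups is a pushout as soon as F → F₁ ⊞ F₂ → G → 0 is exact,
which can be tested on local sections. -/
theorem isPushout_of_locally {f : F ⟶ F₁} {g : F ⟶ F₂} {inl : F₁ ⟶ G} {inr : F₂ ⟶ G}
    (w : f ≫ inl = g ≫ inr)
    (hsurj : ∀ (U : Opens T) (s : G.presheaf.obj (op U)), ∀ x ∈ U, ∃ (V : Opens T) (hV : V ≤ U)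
      (a : F₁.presheaf.obj (op V)) (b : F₂.presheaf.obj (op V)), x ∈ V ∧
        inl.hom.app (op V) a + inr.hom.app (op V) b = G.presheaf.map (homOfLE hV).op s)
    (hker : ∀ (U : Opens T) (a : F₁.presheaf.obj (op U)) (b : F₂.presheaf.obj (op U)),
      inl.hom.app (op U) a = inr.hom.app (op U) b → ∀ x ∈ U, ∃ (V : Opens T) (hV : V ≤ U)
        (c : F.presheaf.obj (op V)), x ∈ V ∧ f.hom.app (op V) c = F₁.presheaf.map (homOfLE hV).op a ∧
          g.hom.app (op V) c = F₂.presheaf.map (homOfLE hV).op b) :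
    IsPushout f g inl inr := by
  let sq : CommSq f g inl inr := ⟨w⟩
  have hfst : ∀ (U : Opens T) (z : (F₁ ⊞ F₂).presheaf.obj (op U)),
      z = (biprod.inl : F₁ ⟶ F₁ ⊞ F₂).hom.app (op U) ((biprod.fst : F₁ ⊞ F₂ ⟶ F₁).hom.app (op U) z) +
        (biprod.inr : F₂ ⟶ F₁ ⊞ F₂).hom.app (op U)
          ((biprod.snd : F₁ ⊞ F₂ ⟶ F₂).hom.app (op U) z) := fun U z => by
    have := congrArg (fun k => k.hom.app (op U) z) (biprod.total (X := F₁) (Y := F₂))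
    exact this.symm
  have hepi : Epi sq.shortComplex.g := by
    refine epi_of_locally_surjective _ fun U s x hx => ?_
    obtain ⟨V, hV, a, b, hxV, hab⟩ := hsurj U s x hx
    refine ⟨V, hV, (biprod.inl : F₁ ⟶ F₁ ⊞ F₂).hom.app (op V) a +
      (biprod.inr : F₂ ⟶ F₁ ⊞ F₂).hom.app (op V) b, hxV, ?_⟩
    refine Eq.trans (map_add _ _ _) (Eq.trans ?_ hab)
    exact congrArg₂ (· + ·) (congrArg (fun k => k.hom.app (op V) a) (biprod.inl_desc inl inr))
      (congrArg (fun k => k.hom.app (op V) b) (biprod.inr_desc inl inr))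
  have hex : sq.shortComplex.Exact := by
    refine exact_of_locally _ _ _ fun U z hz x hx => ?_
    have h1 : inl.hom.app (op U) ((biprod.fst : F₁ ⊞ F₂ ⟶ F₁).hom.app (op U) z) +
        inr.hom.app (op U) ((biprod.snd : F₁ ⊞ F₂ ⟶ F₂).hom.app (op U) z) = 0 := by
      rw [← hz]
      have := congrArg (fun k => k.hom.app (op U) z) (biprod.desc_eq (f := inl) (g := inr))
      exact this.symm
    -- The first map of the associated complex is (f, -g), so the second component has to be negated
    -- before `hker` applies.
    obtain ⟨V, hV, c, hxV, hc1, hc2⟩ := hker U _ (-_) ((eq_neg_of_add_eq_zero_left h1).trans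
      (map_neg _ _).symm) x hx
    refine ⟨V, hV, c, hxV, ?_⟩
    refine (hfst V _).trans (Eq.trans ?_
      (congrArg ((F₁ ⊞ F₂).presheaf.map (homOfLE hV).op) (hfst U z)).symm)
    refine Eq.trans ?_ (map_add _ _ _).symm
    refine congrArg₂ (· + ·) (Eq.trans (congrArg _ ?_) (hom_app_map _ hV _))
      (Eq.trans (congrArg _ ?_) (hom_app_map _ hV _))
    · refine Eq.trans ?_ hc1
      exact congrArg (fun k => k.hom.app (op V) c) (biprod.lift_fst f (-g))
    · refine Eq.trans ?_ (neg_eq_iff_eq_neg.2 (hc2.trans (map_neg _ _)))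
      exact congrArg (fun k => k.hom.app (op V) c) (biprod.lift_snd f (-g))
  exact ⟨sq, ⟨sq.isColimitEquivIsColimitCokernelCofork.symm hex.gIsCokernel⟩⟩

end Locally

end SheafAux

/-! ### A diagram chase in an abelian category -/

section AbelianCategory

variable {C : Type*} [Category C] [Abelian C] {A₀ A Z Q : C}

/-- If `A₀ → K = Ker φ → Q → 0` is exact with `A₀ → A` mono and `φ : A → Z` epi, then
`0 → Q → A / A₀ → Z → 0` is exact. -/
theorem exists_shortExact_cokernel (φ : A ⟶ Z) [Epi φ] (v : A₀ ⟶ A) (i : A₀ ⟶ kernel φ)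
    (hi : i ≫ kernel.ι φ = v) (ℓ : kernel φ ⟶ Q) [Epi ℓ] (w : i ≫ ℓ = 0)
    (hex : (ShortComplex.mk i ℓ w).Exact) (φ' : cokernel v ⟶ Z) (hφ' : cokernel.π v ≫ φ' = φ) :
    ∃ δ : Q ⟶ cokernel v, ℓ ≫ δ = kernel.ι φ ≫ cokernel.π v ∧
      ∃ w' : δ ≫ φ' = 0, (ShortComplex.mk δ φ' w').ShortExact := by
  have : Epi (ShortComplex.mk i ℓ w).g := ‹Epi ℓ›
  have hz : i ≫ kernel.ι φ ≫ cokernel.π v = 0 := by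
    rw [← Category.assoc, hi, cokernel.condition]
  let δ : Q ⟶ cokernel v := hex.desc (kernel.ι φ ≫ cokernel.π v) hz
  have hδ : ℓ ≫ δ = kernel.ι φ ≫ cokernel.π v := hex.g_desc _ hz
  have w' : δ ≫ φ' = 0 := by
    rw [← cancel_epi ℓ, ← Category.assoc, hδ, Category.assoc, hφ', kernel.condition, comp_zero]
  have hv : (ShortComplex.mk v (cokernel.π v) (cokernel.condition v)).Exact :=
    ShortComplex.exact_of_g_is_cokernel _ (cokernelIsCokernel v)
  have hepi : Epi φ' := epi_of_epi_fac hφ'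
  -- An element of Q killed by δ lifts to Ker φ. The lift dies in A / A₀, so it comes from A₀
  -- through `i`, and `ℓ` kills it.
  have hmono : Mono δ := by
    refine Preadditive.mono_of_cancel_zero _ fun {T} t ht => ?_
    obtain ⟨T₁, π₁, _, k, hk⟩ := surjective_up_to_refinements_of_epi ℓ t
    obtain ⟨T₂, π₂, _, a, ha⟩ := hv.exact_up_to_refinements (k ≫ kernel.ι φ) (by
      change (k ≫ kernel.ι φ) ≫ cokernel.π v = 0
      rw [Category.assoc, ← hδ, ← Category.assoc, ← hk, Category.assoc, ht, comp_zero])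
    have h1 : π₂ ≫ k = a ≫ i := by
      rw [← cancel_mono (kernel.ι φ), Category.assoc, Category.assoc, hi]
      exact ha
    rw [← cancel_epi π₁, ← cancel_epi π₂, hk, ← Category.assoc, h1, Category.assoc, w]
    simp
  refine ⟨δ, hδ, w', ShortComplex.ShortExact.mk ?_⟩
  rw [ShortComplex.exact_iff_exact_up_to_refinements]
  intro T t ht
  obtain ⟨T₁, π₁, _, a, ha⟩ := surjective_up_to_refinements_of_epi (cokernel.π v) t
  have h1 : a ≫ φ = 0 := by
    rw [← hφ', ← Category.assoc, ← ha, Category.assoc]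
    exact (congrArg (π₁ ≫ ·) ht).trans comp_zero
  refine ⟨T₁, π₁, inferInstance, kernel.lift φ a h1 ≫ ℓ, ?_⟩
  change π₁ ≫ t = (kernel.lift φ a h1 ≫ ℓ) ≫ δ
  rw [ha, Category.assoc, hδ, kernel.lift_ι_assoc]

end AbelianCategory

noncomputable section

/-! ### Germs of sections -/

namespace FilteredRingSheaf

variable {T : TopCat.{u}} (A : FilteredRingSheaf T)

theorem res_res {U V W : Opens T} (h : V ≤ U) (h' : W ≤ V) (a : A.sec U) :
    A.res h' (A.res h a) = A.res (h'.trans h) a :=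
  (ConcreteCategory.congr_hom (A.sheaf.presheaf.map_comp (homOfLE h).op (homOfLE h').op) a).symm

theorem exists_res_eq {U V : Opens T} {x : T} (hU : x ∈ U) (hV : x ∈ V) (a : A.sec U) (b : A.sec V)
    (h : A.germ hU a = A.germ hV b) :
    ∃ (W : Opens T) (hWU : W ≤ U) (hWV : W ≤ V), x ∈ W ∧ A.res hWU a = A.res hWV b := by
  obtain ⟨W, hxW, iU, iV, hW⟩ := A.sheaf.presheaf.germ_eq x hU hV a b h
  exact ⟨W, iU.le, iV.le, hxW, hW⟩

theorem sec_ext {U : Opens T} {a b : A.sec U} (h : ∀ x (hx : x ∈ U), A.germ hx a = A.germ hx b) :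
    a = b :=
  TopCat.Presheaf.section_ext A.sheaf U a b h

theorem exists_section {U : Opens T} (g : ∀ x : U, A.stalk x.1)
    (h : ∀ x : U, ∃ (V : Opens T) (hV : V ≤ U) (a : A.sec V), x.1 ∈ V ∧
      ∀ y (hy : y ∈ V), A.germ hy a = g ⟨y, hV hy⟩) :
    ∃ a : A.sec U, ∀ x : U, A.germ x.2 a = g x := by
  choose V hV a hx ha using h
  have hcomp : ∀ i j : U, A.res inf_le_left (a i) = A.res (inf_le_right : V i ⊓ V j ≤ V j) (a j) :=
    fun i j => A.sec_ext fun y hy => by rw [A.germ_res _ hy, A.germ_res _ hy, ha, ha]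
  have hcover : U ≤ iSup V := fun x hxU => Opens.mem_iSup.2 ⟨⟨x, hxU⟩, hx ⟨x, hxU⟩⟩
  obtain ⟨b, hb, -⟩ := A.sheaf.existsUnique_gluing V a hcomp
  refine ⟨A.res hcover b, fun x => ?_⟩
  have h1 : A.res (le_iSup V x) b = a x := hb x
  rw [A.germ_res, ← A.germ_res (le_iSup V x) (hx x), h1, ha]

theorem germ_mem_stalkFil {i : ℤ} {U : Opens T} {x : T} (hx : x ∈ U) {a : A.sec U}
    (ha : a ∈ A.fil i U) : A.germ hx a ∈ A.stalkFil i x :=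
  ⟨U, hx, a, ha, rfl⟩

theorem exists_res_mem_fil {i : ℤ} {U : Opens T} {x : T} (hx : x ∈ U) (a : A.sec U)
    (h : A.germ hx a ∈ A.stalkFil i x) :
    ∃ (V : Opens T) (hV : V ≤ U), x ∈ V ∧ A.res hV a ∈ A.fil i V := by
  obtain ⟨V, hV, b, hb, hab⟩ := h
  obtain ⟨W, hWU, hWV, hxW, h⟩ := A.exists_res_eq hx hV a b hab.symm
  exact ⟨W, hWU, hxW, h ▸ A.fil_res i hWV hb⟩

/-- The stalk `𝒜_{0,x}` as a subring of `𝒜_x`. -/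
def zeroStalk (x : T) : Subring (A.stalk x) where
  __ := A.stalkFil 0 x
  one_mem' := (A.stalkFiltration x).one_mem
  mul_mem' {a b} ha hb := by
    have := (A.stalkFiltration x).mul_mem ha hb
    rwa [add_zero] at this

theorem stalkFil_mul_mem {x : T} {i j : ℤ} {a b : A.stalk x} (ha : a ∈ A.stalkFil i x)
    (hb : b ∈ A.stalkFil j x) : a * b ∈ A.stalkFil (i + j) x :=
  (A.stalkFiltration x).mul_mem ha hb

end FilteredRingSheaf

theorem AlgebraicGeometry.Scheme.germ_mem_maximalIdeal_iff {Y : Scheme.{u}} {V : Y.Opens} {s : Y}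
    (hs : s ∈ V) (p : Γ(Y, V)) :
    Y.presheaf.germ V s hs p ∈ IsLocalRing.maximalIdeal (Y.presheaf.stalk s) ↔
      s ∉ Y.basicOpen p := by
  rw [IsLocalRing.mem_maximalIdeal, mem_nonunits_iff, Scheme.mem_basicOpen Y p s hs]

theorem AlgebraicGeometry.Scheme.germ_map_homOfLE {Y : Scheme.{u}} {U V : Y.Opens} (h : V ≤ U)
    {s : Y} (hs : s ∈ V) (p : Γ(Y, U)) :
    Y.presheaf.germ V s hs (Y.presheaf.map (homOfLE h).op p) = Y.presheaf.germ U s (h hs) p :=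
  TopCat.Presheaf.germ_res_apply Y.presheaf (homOfLE h) s hs p

namespace PreRibbon

variable {S : Scheme.{u}} (X : PreRibbon S)

/-! ### The residue map on stalks -/

theorem residue_germ_eq {U V : X.C.Opens} {x : X.C} (hU : x ∈ U) (hV : x ∈ V) (a : X.A.zeroRing U)
    (b : X.A.zeroRing V) (h : X.A.germ hU (a : X.A.sec U) = X.A.germ hV (b : X.A.sec V)) :
    X.C.presheaf.germ U x hU (X.residue U a) = X.C.presheaf.germ V x hV (X.residue V b) := by
  obtain ⟨W, hWU, hWV, hxW, h⟩ := X.A.exists_res_eq hU hV _ _ h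
  rw [← TopCat.Presheaf.germ_res_apply X.C.presheaf (homOfLE hWU) x hxW,
    ← TopCat.Presheaf.germ_res_apply X.C.presheaf (homOfLE hWV) x hxW, ← X.residue_res hWU,
    ← X.residue_res hWV]
  congr 3

theorem exists_zeroRing_germ (x : X.C) (t : X.A.zeroStalk x) :
    ∃ (U : X.C.Opens) (hx : x ∈ U) (a : X.A.zeroRing U), X.A.germ hx (a : X.A.sec U) = t := by
  obtain ⟨U, hx, a, ha, h⟩ := t.2
  exact ⟨U, hx, ⟨a, ha⟩, h⟩

/-- The map `𝒜_{0,x} → 𝒪_{C,x}` induced by the residue map. -/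
def resFn (x : X.C) (t : X.A.zeroStalk x) : X.C.presheaf.stalk x :=
  X.C.presheaf.germ _ x (X.exists_zeroRing_germ x t).choose_spec.choose
    (X.residue _ (X.exists_zeroRing_germ x t).choose_spec.choose_spec.choose)

theorem resFn_eq {x : X.C} (t : X.A.zeroStalk x) {U : X.C.Opens} (hx : x ∈ U) (a : X.A.zeroRing U)
    (h : X.A.germ hx (a : X.A.sec U) = t) :
    X.resFn x t = X.C.presheaf.germ U x hx (X.residue U a) :=
  X.residue_germ_eq _ hx _ a
    ((X.exists_zeroRing_germ x t).choose_spec.choose_spec.choose_spec.trans h.symm)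

theorem resFn_op {x : X.C} (s t : X.A.zeroStalk x) :
    X.resFn x (s + t) = X.resFn x s + X.resFn x t ∧
      X.resFn x (s * t) = X.resFn x s * X.resFn x t := by
  obtain ⟨U, hU, a, ha⟩ := X.exists_zeroRing_germ x s
  obtain ⟨V, hV, b, hb⟩ := X.exists_zeroRing_germ x t
  have hx : x ∈ U ⊓ V := ⟨hU, hV⟩
  let a' : X.A.zeroRing (U ⊓ V) := ⟨X.A.res inf_le_left a, X.A.fil_res 0 inf_le_left a.2⟩
  let b' : X.A.zeroRing (U ⊓ V) := ⟨X.A.res inf_le_right b, X.A.fil_res 0 inf_le_right b.2⟩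
  have ha' : X.A.germ hx (a' : X.A.sec (U ⊓ V)) = s := (X.A.germ_res _ hx _).trans ha
  have hb' : X.A.germ hx (b' : X.A.sec (U ⊓ V)) = t := (X.A.germ_res _ hx _).trans hb
  rw [X.resFn_eq s hx a' ha', X.resFn_eq t hx b' hb', X.resFn_eq (s + t) hx (a' + b')
    (by rw [Subring.coe_add, map_add, ha', hb']; rfl), X.resFn_eq (s * t) hx (a' * b')
    (by rw [Subring.coe_mul, map_mul, ha', hb']; rfl), map_add, map_add, map_mul, map_mul]
  exact ⟨rfl, rfl⟩

/-- The ring homomorphism `𝒜_{0,x} → 𝒪_{C,x}` induced by the residue map. -/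
def resStalk (x : X.C) : X.A.zeroStalk x →+* X.C.presheaf.stalk x where
  toFun := X.resFn x
  map_one' := by
    rw [X.resFn_eq 1 (U := ⊤) trivial 1 (map_one _), map_one, map_one]
  map_zero' := by
    rw [X.resFn_eq 0 (U := ⊤) trivial 0 (map_zero _), map_zero, map_zero]
  map_add' s t := (X.resFn_op s t).1
  map_mul' s t := (X.resFn_op s t).2

theorem resStalk_eq {x : X.C} (t : X.A.zeroStalk x) {U : X.C.Opens} (hx : x ∈ U)
    (a : X.A.zeroRing U) (h : X.A.germ hx (a : X.A.sec U) = t) :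
    X.resStalk x t = X.C.presheaf.germ U x hx (X.residue U a) :=
  X.resFn_eq t hx a h

theorem resStalk_eq_zero_iff (hX : X.IsRibbon) {x : X.C} (t : X.A.zeroStalk x) :
    X.resStalk x t = 0 ↔ (t : X.A.stalk x) ∈ X.A.stalkFil 1 x := by
  obtain ⟨U, hx, a, ha⟩ := X.exists_zeroRing_germ x t
  rw [X.resStalk_eq t hx a ha]
  constructor
  · intro h
    rw [← map_zero (X.C.presheaf.germ U x hx).hom] at h
    obtain ⟨W, hxW, iU, iV, hW⟩ := X.C.presheaf.germ_eq x hx hx _ _ h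
    rw [map_zero] at hW
    have h2 := (X.residue_res iU.le a).trans hW
    rw [hX.residue_ker] at h2
    exact ⟨W, hxW, _, h2, (X.A.germ_res _ hxW _).trans ha⟩
  · intro h
    rw [← ha] at h
    obtain ⟨W, hWU, hxW, h⟩ := X.A.exists_res_mem_fil hx _ h
    have h2 := (hX.residue_ker W ⟨_, X.A.fil_res 0 hWU a.2⟩).2 h
    rw [← Scheme.germ_map_homOfLE hWU hxW, ← X.residue_res hWU]
    exact (congrArg _ h2).trans (map_zero _)

theorem resStalk_surjective (hX : X.IsRibbon) (x : X.C) : Function.Surjective (X.resStalk x) := by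
  intro f
  obtain ⟨U, hx, f, rfl⟩ := X.C.presheaf.exists_germ_eq f
  obtain ⟨V, hVU, a, hxV, h⟩ := hX.residue_surj U f x hx
  refine ⟨⟨X.A.germ hxV a.1, X.A.germ_mem_stalkFil hxV a.2⟩, ?_⟩
  rw [X.resStalk_eq _ hxV a rfl, h]
  exact TopCat.Presheaf.germ_res_apply X.C.presheaf (homOfLE hVU) x hxV f

theorem stalkAlg_mem (x : X.C) (r : X.baseStalk x) : X.stalkAlg x r ∈ X.A.stalkFil 0 x := by
  obtain ⟨V, hV, r, rfl⟩ := S.presheaf.exists_germ_eq r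
  rw [X.stalkAlg_germ]
  exact X.A.germ_mem_stalkFil _ (X.alg_mem V r)

theorem resStalk_stalkAlg (x : X.C) (r : X.baseStalk x) :
    X.resStalk x ⟨X.stalkAlg x r, X.stalkAlg_mem x r⟩ = X.τ.stalkMap x r := by
  obtain ⟨V, hV, r, rfl⟩ := S.presheaf.exists_germ_eq r
  rw [X.resStalk_eq _ (U := X.τ ⁻¹ᵁ V) hV ⟨_, X.alg_mem V r⟩ (X.stalkAlg_germ x hV r).symm,
    X.residue_alg]
  exact (Scheme.Hom.germ_stalkMap_apply X.τ V x hV r).symm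

theorem germ_algMap {V : S.Opens} {U : X.C.Opens} (h : U ≤ X.τ ⁻¹ᵁ V) {x : X.C} (hx : x ∈ U)
    (r : Γ(S, V)) : X.A.germ hx (X.algMap h r) =
      algebraMap (X.baseStalk x) (X.A.stalk x) (S.presheaf.germ V (X.τ x) (h hx) r) :=
  (X.A.germ_res h hx _).trans (X.stalkAlg_germ x (h hx) r).symm

/-! ### The filtration of a stalk -/

theorem stalkSub_anti (x : X.C) : Antitone fun i => X.stalkSub i x :=
  fun _ _ h => (X.A.stalkFiltration x).anti h

/-- Here flatness of 𝒜_i/𝒜_{i+1} over S enters: I𝒜_x ∩ 𝒜_{j,x} = I𝒜_{j,x}. It is used for I = 𝔪 on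
fibres and for I = 𝒩 in the kernel of the order. -/
theorem mem_smul_stalkSub (hX : X.IsRibbon) {x : X.C} (I : Ideal (X.baseStalk x)) (j : ℤ)
    {a : X.A.stalk x} (ha : a ∈ I • (⊤ : Submodule (X.baseStalk x) (X.A.stalk x)))
    (haj : a ∈ X.stalkSub j x) : a ∈ I • X.stalkSub j x :=
  smul_top_inf_le_smul (fun i => X.stalkSub i x) (X.stalkSub_anti x) (X.A.stalkFiltration x).exhaust
    (fun i => hX.gr_flat i x) I j ha haj

theorem exists_mem_smul_stalkSub {x : X.C} (I : Ideal (X.baseStalk x)) {a : X.A.stalk x}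
    (ha : a ∈ I • (⊤ : Submodule (X.baseStalk x) (X.A.stalk x))) : ∃ i, a ∈ I • X.stalkSub i x := by
  refine Submodule.smul_induction_on ha (fun r hr n _ => ?_) (fun a b h1 h2 => ?_)
  · obtain ⟨i, hi⟩ := (X.A.stalkFiltration x).exhaust n
    exact ⟨i, Submodule.smul_mem_smul hr hi⟩
  · obtain ⟨i, hi⟩ := h1
    obtain ⟨j, hj⟩ := h2
    exact ⟨min i j, add_mem (Submodule.smul_mono le_rfl (X.stalkSub_anti x (min_le_left i j)) hi)
      (Submodule.smul_mono le_rfl (X.stalkSub_anti x (min_le_right i j)) hj)⟩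

theorem mem_sup_smul_stalkSub (hX : X.IsRibbon) {x : X.C} (I : Ideal (X.baseStalk x)) {i j : ℤ}
    (hij : j ≤ i) {a : X.A.stalk x} (ha : a ∈ X.stalkSub j x)
    (h : a ∈ X.stalkSub i x ⊔ I • (⊤ : Submodule (X.baseStalk x) (X.A.stalk x))) :
    a ∈ X.stalkSub i x ⊔ I • X.stalkSub j x := by
  obtain ⟨b, hb, c, hc, rfl⟩ := Submodule.mem_sup.1 h
  refine Submodule.add_mem_sup hb (X.mem_smul_stalkSub hX I j hc ?_)
  have := sub_mem ha (X.stalkSub_anti x hij hb)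
  rwa [add_sub_cancel_left] at this

theorem fiberGrSub_le (x : X.C) (i : ℤ) {a : X.A.stalk x} (h : a ∈ X.fiberGrSub i x) :
    a ∈ (X.fiberFiltration x).F (i + 1) :=
  sup_le_sup_left (Submodule.smul_mono le_rfl le_top) (X.stalkSub (i + 1) x) h

/-- Taking graded pieces commutes with restriction to the fibre. This links the filtration of
𝒜_x/𝔪𝒜_x to the axioms on the restrictions of 𝒜_i/𝒜_{i+1}. -/
theorem mem_fiberGrSub (hX : X.IsRibbon) {x : X.C} {i : ℤ} {a : X.A.stalk x}
    (ha : a ∈ X.stalkSub i x) (h : a ∈ (X.fiberFiltration x).F (i + 1)) : a ∈ X.fiberGrSub i x :=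
  X.mem_sup_smul_stalkSub hX _ (by omega) ha h

/-- A germ in `I 𝒜_{i,x}` extends to a section `∑ p_k a_k` with `p_k ∈ I` and `a_k ∈ 𝒜_i`. -/
theorem exists_section_smul {x : X.C} {I : Ideal (X.baseStalk x)} {i : ℤ} {t : X.A.stalk x}
    (ht : t ∈ I • X.stalkSub i x) :
    ∃ (U : X.C.Opens) (c : X.A.sec U) (hx : x ∈ U) (V : S.Opens) (h : U ≤ X.τ ⁻¹ᵁ V)
      (s : Finset Γ(S, V)), X.A.germ hx c = t ∧
      (∀ p ∈ s, S.presheaf.germ V (X.τ x) (h hx) p ∈ I) ∧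
      ∀ y (hy : y ∈ U) (J : Ideal (X.baseStalk y)),
        (∀ p ∈ s, S.presheaf.germ V (X.τ y) (h hy) p ∈ J) → X.A.germ hy c ∈ J • X.stalkSub i y := by
  classical
  refine Submodule.smul_induction_on ht (fun r hr n hn => ?_) (fun a b h1 h2 => ?_)
  · obtain ⟨V, hV, r, rfl⟩ := S.presheaf.exists_germ_eq r
    obtain ⟨U, hU, n, hn, rfl⟩ := hn
    have hx : x ∈ U ⊓ X.τ ⁻¹ᵁ V := ⟨hU, hV⟩
    have hgerm : ∀ y (hy : y ∈ U ⊓ X.τ ⁻¹ᵁ V),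
        X.A.germ hy (X.algMap inf_le_right r * X.A.res inf_le_left n) =
          S.presheaf.germ V (X.τ y) hy.2 r • X.A.germ hy.1 n := fun y hy => by
      rw [map_mul, X.germ_algMap, X.A.germ_res _ hy, Algebra.smul_def]
    refine ⟨_, _, hx, V, inf_le_right, {r}, hgerm x hx, ?_, fun y hy J hJ => ?_⟩
    · intro p hp
      rw [Finset.mem_singleton.1 hp]
      exact hr
    · rw [hgerm y hy]
      exact Submodule.smul_mem_smul (hJ r (Finset.mem_singleton_self r))
        (X.A.germ_mem_stalkFil hy.1 hn)
  · obtain ⟨U, c, hU, V, hUV, s, rfl, hsI, hs⟩ := h1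
    obtain ⟨U', c', hU', V', hUV', s', rfl, hsI', hs'⟩ := h2
    have hx : x ∈ U ⊓ U' := ⟨hU, hU'⟩
    refine ⟨U ⊓ U', X.A.res inf_le_left c + X.A.res inf_le_right c', hx, V ⊓ V',
      fun y hy => ⟨hUV hy.1, hUV' hy.2⟩,
      s.image (S.presheaf.map (homOfLE inf_le_left).op) ∪
        s'.image (S.presheaf.map (homOfLE inf_le_right).op), ?_, ?_, fun y hy J hJ => ?_⟩
    · rw [map_add, X.A.germ_res _ hx, X.A.germ_res _ hx]
    · intro p hp
      rcases Finset.mem_union.1 hp with hp | hp <;> obtain ⟨q, hq, rfl⟩ := Finset.mem_image.1 hp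
      · exact (Scheme.germ_map_homOfLE _ _ q).symm ▸ hsI q hq
      · exact (Scheme.germ_map_homOfLE _ _ q).symm ▸ hsI' q hq
    · rw [map_add, X.A.germ_res _ hy, X.A.germ_res _ hy]
      refine add_mem (hs y hy.1 J fun p hp => ?_) (hs' y hy.2 J fun p hp => ?_)
      · exact Scheme.germ_map_homOfLE (inf_le_left : V ⊓ V' ≤ V) _ p ▸
          hJ _ (Finset.mem_union_left _ (Finset.mem_image_of_mem _ hp))
      · exact Scheme.germ_map_homOfLE (inf_le_right : V ⊓ V' ≤ V') _ p ▸
          hJ _ (Finset.mem_union_right _ (Finset.mem_image_of_mem _ hp))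

end PreRibbon

end

noncomputable section

/-! ### Fibres of a family of curves -/

/-- The complement is a finite union of irreducible closed sets. None of them is the whole space, so
in dimension at most one each is minimal, and minimal ones are points in a T0 space. -/
theorem finite_compl_of_topologicalKrullDim_le_one {T : Type*} [TopologicalSpace T]
    [NoetherianSpace T] [IrreducibleSpace T] [T0Space T] (h : topologicalKrullDim T ≤ 1)
    {U : Set T} (hU : IsOpen U) (hne : U.Nonempty) : Uᶜ.Finite := by
  obtain ⟨s, hs, hclosed, hirr, hUs⟩ :=
    NoetherianSpace.exists_finite_set_isClosed_irreducible hU.isClosed_compl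
  rw [hUs]
  refine hs.sUnion fun t ht => Set.Subsingleton.finite fun x hx y hy => ?_
  have key : ∀ z ∈ t, t ⊆ closure {z} := by
    intro z hz
    let t' : IrreducibleCloseds T := ⟨t, hirr t ht, hclosed t ht⟩
    let z' : IrreducibleCloseds T := ⟨closure {z}, isIrreducible_singleton.closure, isClosed_closure⟩
    let e : IrreducibleCloseds T := ⟨Set.univ, IrreducibleSpace.isIrreducible_univ T, isClosed_univ⟩
    have hz' : z' ≤ t' := (hclosed t ht).closure_subset_iff.2 (Set.singleton_subset_iff.2 hz)
    -- In a poset of dimension at most one every element is minimal or maximal; a maximal `t'` would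
    -- be all of T and would meet U.
    rcases Order.krullDim_le_one_iff.1 h t' with hmin | hmax
    · exact hmin hz'
    · obtain ⟨w, hw⟩ := hne
      have h1 : w ∈ t := hmax (show t' ≤ e from Set.subset_univ _) (Set.mem_univ w)
      have h2 : w ∈ Uᶜ := hUs ▸ Set.mem_sUnion_of_mem h1 ht
      exact absurd hw h2
  exact ((specializes_iff_mem_closure.2 (key x hx hy)).antisymm
    (specializes_iff_mem_closure.2 (key y hy hx))).eq

theorem AlgebraicGeometry.Scheme.SpecMap_fromSpecStalk_closedPoint {Y : Scheme.{u}}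
    {R : CommRingCat.{u}} [IsLocalRing R] {x : Y} (φ : Y.presheaf.stalk x ⟶ R) [IsLocalHom φ.hom] :
    (Spec.map φ ≫ Y.fromSpecStalk x) (IsLocalRing.closedPoint R) = x :=
  (Scheme.Hom.comp_apply (Spec.map φ) (Y.fromSpecStalk x) _).trans
    ((congrArg (Y.fromSpecStalk x) Spec_closedPoint).trans fromSpecStalk_closedPoint)

namespace PreRibbon

variable {S : Scheme.{u}} (X : PreRibbon S)

/-- The generic point of the fibre over `s`, as a point of `C`. -/
def fiberGen (hS : X.StandingAssumptions) (s : S) : X.C :=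
  haveI := hS.irreducible s
  X.τ.fiberι s (genericPoint (X.τ.fiber s))

theorem τ_fiberι (s : S) (y : X.τ.fiber s) : X.τ (X.τ.fiberι s y) = s := by
  have : X.τ.fiberι s y ∈ X.τ ⁻¹' {s} := X.τ.range_fiberι s ▸ Set.mem_range_self y
  exact this

theorem exists_fiberι_eq {s : S} {x : X.C} (hx : X.τ x = s) : ∃ y, X.τ.fiberι s y = x := by
  have : x ∈ Set.range (X.τ.fiberι s) := X.τ.range_fiberι s ▸ hx
  exact this

theorem τ_fiberGen (hS : X.StandingAssumptions) (s : S) : X.τ (X.fiberGen hS s) = s :=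
  X.τ_fiberι s _

theorem fiberGen_specializes (hS : X.StandingAssumptions) {s : S} {x : X.C} (hx : X.τ x = s) :
    X.fiberGen hS s ⤳ x := by
  obtain ⟨y, rfl⟩ := X.exists_fiberι_eq hx
  have := hS.irreducible s
  exact (genericPoint_specializes y).map (X.τ.fiberι s).continuous

theorem fiberGen_mem (hS : X.StandingAssumptions) {s : S} {x : X.C} (hx : X.τ x = s)
    {U : X.C.Opens} (hU : x ∈ U) : X.fiberGen hS s ∈ U :=
  (X.fiberGen_specializes hS hx).mem_open U.isOpen hU

theorem finite_fiber_notMem (hX : X.IsRibbon) (hS : X.StandingAssumptions) {s : S}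
    {U : X.C.Opens} (hU : X.fiberGen hS s ∈ U) : {y : X.τ.fiber s | X.τ.fiberι s y ∉ U}.Finite := by
  have := hS.irreducible s
  have hc := hX.curve s
  have := hc.locallyOfFiniteType
  have := hc.quasiCompact
  have : IsLocallyNoetherian (X.τ.fiber s) :=
    LocallyOfFiniteType.isLocallyNoetherian (X.τ.fiberToSpecResidueField s)
  have : CompactSpace (X.τ.fiber s) :=
    (quasiCompact_iff_compactSpace (X.τ.fiberToSpecResidueField s)).1 inferInstance
  have : AlgebraicGeometry.IsNoetherian (X.τ.fiber s) := {}
  have hdim : topologicalKrullDim (X.τ.fiber s) ≤ 1 := by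
    have h1 := hc.dim_one Set.univ (by rw [irreducibleComponents_eq_singleton]; rfl)
    exact (IsHomeomorph.topologicalKrullDim_eq _
      (Homeomorph.Set.univ (X.τ.fiber s)).isHomeomorph).symm.trans h1 |>.le
  exact finite_compl_of_topologicalKrullDim_le_one hdim
    (U := X.τ.fiberι s ⁻¹' U) (U.isOpen.preimage (X.τ.fiberι s).continuous) ⟨_, hU⟩

/-- The ideal `𝔪_{S,s} 𝒪_{C,x}` of `𝒪_{C,x}`, where `s = τ(x)`. -/
def fiberIdeal (x : X.C) : Ideal (X.C.presheaf.stalk x) :=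
  (IsLocalRing.maximalIdeal (X.baseStalk x)).map (X.τ.stalkMap x).hom

theorem fiberIdeal_le (x : X.C) :
    X.fiberIdeal x ≤ IsLocalRing.maximalIdeal (X.C.presheaf.stalk x) :=
  Ideal.map_le_iff_le_comap.2 fun r hr => map_mem_nonunits_iff (X.τ.stalkMap x).hom r |>.2 hr

/-- A function on S that vanishes at s pulls back to a function vanishing at every point of the
fibre, and reducedness makes it zero. -/
theorem fiberIdeal_le_ker (s : S) [AlgebraicGeometry.IsReduced (X.τ.fiber s)] (y : X.τ.fiber s) :
    X.fiberIdeal (X.τ.fiberι s y) ≤ RingHom.ker ((X.τ.fiberι s).stalkMap y).hom := by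
  rw [fiberIdeal, Ideal.map_le_iff_le_comap]
  intro r hr
  obtain ⟨V, hV, r, rfl⟩ := S.presheaf.exists_germ_eq r
  rw [Scheme.germ_mem_maximalIdeal_iff, X.τ_fiberι] at hr
  have h0 : (X.τ.fiberι s).app _ (X.τ.app V r) = 0 := by
    rw [← basicOpen_eq_bot_iff, eq_bot_iff]
    intro z hz
    rw [← Scheme.preimage_basicOpen, ← Scheme.preimage_basicOpen] at hz
    refine absurd ?_ hr
    rw [← X.τ_fiberι s z]
    exact hz
  rw [Ideal.mem_comap, RingHom.mem_ker]
  have h1 := Scheme.Hom.germ_stalkMap_apply X.τ V (X.τ.fiberι s y) hV r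
  have h2 := Scheme.Hom.germ_stalkMap_apply (X.τ.fiberι s) (X.τ ⁻¹ᵁ V) y hV (X.τ.app V r)
  exact ((congrArg _ h1).trans h2).trans ((congrArg _ h0).trans (map_zero _))

/-- This morphism, given by the universal property of the fibre product, yields the bound on the
kernel of 𝒪_{C,x} → 𝒪_{C_s,x} that is converse to `fiberIdeal_le_ker`. -/
theorem exists_Spec_to_fiber (x : X.C) :
    ∃ q : Spec (.of (X.C.presheaf.stalk x ⧸ X.fiberIdeal x)) ⟶ X.τ.fiber (X.τ x),
      q ≫ X.τ.fiberι (X.τ x) =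
        Spec.map (CommRingCat.ofHom (Ideal.Quotient.mk (X.fiberIdeal x))) ≫ X.C.fromSpecStalk x := by
  let φ : S.residueField (X.τ x) ⟶ .of (X.C.presheaf.stalk x ⧸ X.fiberIdeal x) :=
    CommRingCat.ofHom (Ideal.Quotient.lift (IsLocalRing.maximalIdeal (X.baseStalk x))
      ((Ideal.Quotient.mk (X.fiberIdeal x)).comp (X.τ.stalkMap x).hom) fun r hr =>
        Ideal.Quotient.eq_zero_iff_mem.2 (Ideal.mem_map_of_mem _ hr))
  have hφ : S.residue (X.τ x) ≫ φ =
      X.τ.stalkMap x ≫ CommRingCat.ofHom (Ideal.Quotient.mk (X.fiberIdeal x)) := by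
    ext r
    rfl
  refine ⟨pullback.lift (Spec.map (CommRingCat.ofHom (Ideal.Quotient.mk (X.fiberIdeal x))) ≫
    X.C.fromSpecStalk x) (Spec.map φ) ?_, pullback.lift_fst _ _ _⟩
  rw [Category.assoc, ← Scheme.SpecMap_stalkMap_fromSpecStalk, Scheme.fromSpecResidueField,
    ← Spec.map_comp_assoc, ← Spec.map_comp_assoc, hφ]
  rfl

/-- The fibre is integral, so its local rings are domains; the ideal is identified with the kernel
of the map from 𝒪_{C,x} to such a ring. -/
theorem fiberIdeal_isPrime (x : X.C) [AlgebraicGeometry.IsReduced (X.τ.fiber (X.τ x))]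
    [IrreducibleSpace (X.τ.fiber (X.τ x))] : (X.fiberIdeal x).IsPrime := by
  have hne : X.fiberIdeal x ≠ ⊤ := fun h =>
    (IsLocalRing.maximalIdeal.isMaximal _).ne_top (top_le_iff.1 (h ▸ X.fiberIdeal_le x))
  have : Nontrivial (X.C.presheaf.stalk x ⧸ X.fiberIdeal x) := Ideal.Quotient.nontrivial_iff.2 hne
  have hmk := Ideal.Quotient.mk_surjective (I := X.fiberIdeal x)
  have : IsLocalRing (X.C.presheaf.stalk x ⧸ X.fiberIdeal x) := .of_surjective' _ hmk
  have : IsLocalHom (Ideal.Quotient.mk (X.fiberIdeal x)) := .of_surjective _ hmk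
  have hint : AlgebraicGeometry.IsIntegral (X.τ.fiber (X.τ x)) :=
    isIntegral_of_irreducibleSpace_of_isReduced _
  obtain ⟨q, hq⟩ := X.exists_Spec_to_fiber x
  let R : CommRingCat.{u} := .of (X.C.presheaf.stalk x ⧸ X.fiberIdeal x)
  let φ : X.C.presheaf.stalk x ⟶ R := CommRingCat.ofHom (Ideal.Quotient.mk (X.fiberIdeal x))
  have : IsLocalHom φ.hom := ‹_›
  have : IsLocalRing R := ‹_›
  set y := q (IsLocalRing.closedPoint R) with hy
  have hyx : X.τ.fiberι _ y = x := by
    exact (congrArg (fun g : Spec R ⟶ X.C => g (IsLocalRing.closedPoint R)) hq).trans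
      (Scheme.SpecMap_fromSpecStalk_closedPoint φ)
  -- The quotient map 𝒪_{C,x} → 𝒪_{C,x}/𝔪𝒪_{C,x} factors through the local ring of the fibre, so
  -- whatever dies there lies in the ideal.
  have hker : ∀ f : X.C.presheaf.stalk (X.τ.fiberι _ y), (X.τ.fiberι _).stalkMap y f = 0 →
      f ∈ X.fiberIdeal (X.τ.fiberι _ y) := by
    intro f hf
    obtain ⟨U, hU, f, rfl⟩ := X.C.presheaf.exists_germ_eq f
    have hxU : x ∈ U := hyx ▸ hU
    have h1 : Scheme.stalkClosedPointTo (q ≫ X.τ.fiberι _) (X.C.presheaf.germ U _ hU f) = 0 := by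
      rw [Scheme.stalkClosedPointTo_comp]
      exact (congrArg (Scheme.stalkClosedPointTo q) hf).trans (map_zero _)
    have h2 : ∀ (g : Spec R ⟶ X.C) (hg : g = q ≫ X.τ.fiberι _)
        (hgU : g (IsLocalRing.closedPoint R) ∈ U),
        Scheme.stalkClosedPointTo g (X.C.presheaf.germ U _ hgU f) = 0 := by
      rintro g rfl hgU
      exact h1
    have hgU : (Spec.map φ ≫ X.C.fromSpecStalk x) (IsLocalRing.closedPoint R) ∈ U :=
      (Scheme.SpecMap_fromSpecStalk_closedPoint φ).symm ▸ hxU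
    have h3 := h2 _ hq.symm hgU
    have h4 := ConcreteCategory.congr_hom
      (Scheme.germ_stalkClosedPointTo_Spec_fromSpecStalk φ U hgU) f
    have h5 : X.C.presheaf.germ U x hxU f ∈ X.fiberIdeal x :=
      Ideal.Quotient.eq_zero_iff_mem.1 (h4.symm.trans h3)
    -- The stalks at x and at the image of y are different types over equal points; generalising the
    -- point allows substitution.
    have h6 : ∀ (z : X.C) (hz : z = x) (hzU : z ∈ U), X.C.presheaf.germ U z hzU f ∈
        X.fiberIdeal z := by
      rintro z rfl hzU
      exact h5
    exact h6 _ hyx hU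
  have hprime : (X.fiberIdeal (X.τ.fiberι _ y)).IsPrime := by
    have : X.fiberIdeal (X.τ.fiberι _ y) = RingHom.ker ((X.τ.fiberι _).stalkMap y).hom :=
      le_antisymm (X.fiberIdeal_le_ker _ y) fun f hf => hker f hf
    rw [this]
    exact RingHom.ker_isPrime _
  exact hyx ▸ hprime

end PreRibbon

end

noncomputable section

/-! ### Coherent sheaves and localisation -/

/-- The algebra behind spreading out from a fibre: if `v` lies in `T` locally at every prime of R
above P, then one denominator from K outside P suffices. -/
theorem exists_notMem_smul_mem {K R M : Type*} [CommRing K] [CommRing R] [AddCommGroup M]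
    [Module R M] (φ : K →+* R) (P : Ideal K) [P.IsPrime] (T : Submodule R M) (v : M)
    (hT : ∀ p ∈ P, φ p • v ∈ T)
    (h : ∀ q : Ideal R, q.IsPrime → q.comap φ = P → ∃ f ∉ q, f • v ∈ T) :
    ∃ r ∉ P, φ r • v ∈ T := by
  by_contra! hcon
  let I : Ideal R := T.comap (LinearMap.toSpanSingleton R M v)
  have hdisj : Disjoint (I : Set R) (P.primeCompl.map φ) := by
    rw [Set.disjoint_left]
    rintro _ hI ⟨r, hr, rfl⟩
    exact hcon r hr hI
  -- A prime containing (T : v) and avoiding the image of K ∖ P lies over P, since P carries `v`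
  -- into `T`; the local hypothesis at this prime contradicts (T : v) ⊆ q.
  obtain ⟨q, hq, hIq, hqd⟩ := Ideal.exists_le_prime_disjoint I _ hdisj
  obtain ⟨f, hf, hfv⟩ := h q hq (by
    ext r
    refine ⟨fun hr => ?_, fun hr => hIq (hT r hr)⟩
    by_contra hrP
    exact Set.disjoint_left.1 hqd hr ⟨r, hrP, rfl⟩)
  exact hf (hIq hfv)

/-- The span of the image of `T` in the local ring is the localisation of `T`, so membership there
can be cleared of denominators. -/
theorem exists_notMem_smul_mem_of_localization {R O ι : Type*} [CommRing R] [CommRing O]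
    [Algebra R O] [Finite ι] (q : Ideal R) [q.IsPrime] [IsLocalization.AtPrime O q]
    (T : Submodule R (ι → R)) (v : ι → R)
    (h : (fun k => algebraMap R O (v k)) ∈
      Submodule.span O ((fun w : ι → R => fun k => algebraMap R O (w k)) '' T)) :
    ∃ f ∉ q, f • v ∈ T := by
  let F : (ι → R) →ₗ[R] (ι → O) := LinearMap.pi fun k => Algebra.linearMap R O ∘ₗ LinearMap.proj k
  have : IsLocalizedModule q.primeCompl F := IsLocalizedModule.pi _ _
  change F v ∈ Submodule.span O (F '' T) at h
  rw [← Submodule.localized'_eq_span O q.primeCompl F T, Submodule.mem_localized'] at h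
  obtain ⟨m, hm, s, hs⟩ := h
  rw [IsLocalizedModule.mk'_eq_iff, Submonoid.smul_def, ← map_smul] at hs
  obtain ⟨t, ht⟩ := (IsLocalizedModule.eq_iff_exists q.primeCompl F).1 hs
  refine ⟨t * s, (t * s).2, ?_⟩
  rw [mul_smul]
  have : (t : R) • (s : R) • v = (t : R) • m := ht.symm
  rw [this]
  exact T.smul_mem _ hm

namespace PreRibbon

variable {S : Scheme.{u}} (X : PreRibbon S)

section Relations

variable (hX : X.IsRibbon) {x : X.C} (i : ℤ) {n : ℕ} (g : Fin n → X.A.stalk x)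
  (hg : ∀ k, g k ∈ X.A.stalkFil i x)

theorem mul_mem_sup {j : ℤ} (J : Ideal (X.baseStalk x)) {b a : X.A.stalk x}
    (hb : b ∈ X.A.stalkFil 0 x) (ha : a ∈ X.stalkSub j x ⊔ J • X.stalkSub i x) :
    b * a ∈ X.stalkSub j x ⊔ J • X.stalkSub i x := by
  have key : ∀ (l : ℤ) {c}, c ∈ X.stalkSub l x → b * c ∈ X.stalkSub l x := fun l c hc => by
    have := X.A.stalkFil_mul_mem hb hc
    rwa [zero_add] at this
  obtain ⟨p, hp, q, hq, rfl⟩ := Submodule.mem_sup.1 ha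
  rw [mul_add]
  refine Submodule.add_mem_sup (key _ hp) ?_
  refine Submodule.smul_induction_on hq (fun r hr n hn => ?_) (fun _ _ h1 h2 => ?_)
  · rw [mul_smul_comm]
    exact Submodule.smul_mem_smul hr (key _ hn)
  · rw [mul_add]
    exact add_mem h1 h2

/-- The relations between sections `g_k` of `𝒜_i`, modulo `𝒜_{i+1} + J 𝒜_i`, at the stalk of `x`. -/
def relSub (J : Ideal (X.baseStalk x)) : Submodule (X.C.presheaf.stalk x)
    (Fin n → X.C.presheaf.stalk x) :=
  (Submodule.span _ {v | ∃ b : Fin n → X.A.zeroStalk x, (∀ k, X.resStalk x (b k) = v k) ∧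
    ∑ k, (b k : X.A.stalk x) * g k ∈ X.stalkSub (i + 1) x ⊔ J • X.stalkSub i x})

-- The relation condition does not depend on the lifts: two lifts of the same residue differ by 𝒜_1,
-- which multiplies g_k ∈ 𝒜_i into 𝒜_{i+1}.
include hX hg in
theorem mem_of_mem_relSub {J : Ideal (X.baseStalk x)} {v : Fin n → X.C.presheaf.stalk x}
    (hv : v ∈ X.relSub i g J) (b : Fin n → X.A.zeroStalk x)
    (hb : ∀ k, X.resStalk x (b k) = v k) :
    ∑ k, (b k : X.A.stalk x) * g k ∈ X.stalkSub (i + 1) x ⊔ J • X.stalkSub i x := by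
  have huniq : ∀ b b' : Fin n → X.A.zeroStalk x, (∀ k, X.resStalk x (b k) = X.resStalk x (b' k)) →
      ∑ k, (b' k : X.A.stalk x) * g k ∈ X.stalkSub (i + 1) x ⊔ J • X.stalkSub i x →
      ∑ k, (b k : X.A.stalk x) * g k ∈ X.stalkSub (i + 1) x ⊔ J • X.stalkSub i x := by
    intro b b' h h'
    have h1 : ∑ k, ((b k - b' k : X.A.zeroStalk x) : X.A.stalk x) * g k ∈
        X.stalkSub (i + 1) x := by
      refine sum_mem fun k _ => ?_
      have h2 := (X.resStalk_eq_zero_iff hX (b k - b' k)).1 (by rw [map_sub, h k, sub_self])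
      have := X.A.stalkFil_mul_mem h2 (hg k)
      rwa [add_comm] at this
    have := add_mem (Submodule.mem_sup_left h1) h'
    simpa [sub_mul, ← Finset.sum_add_distrib] using this
  suffices h : ∃ b : Fin n → X.A.zeroStalk x, (∀ k, X.resStalk x (b k) = v k) ∧
      ∑ k, (b k : X.A.stalk x) * g k ∈ X.stalkSub (i + 1) x ⊔ J • X.stalkSub i x by
    obtain ⟨b', hb', h⟩ := h
    exact huniq b b' (fun k => (hb k).trans (hb' k).symm) h
  clear hb b
  induction hv using Submodule.span_induction with
  | mem v hv => exact hv
  | zero => exact ⟨0, fun k => map_zero _, by simp⟩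
  | add v w _ _ hv hw =>
    obtain ⟨b, hb, h⟩ := hv
    obtain ⟨b', hb', h'⟩ := hw
    refine ⟨b + b', fun k => by simp [hb, hb'], ?_⟩
    simpa [add_mul, Finset.sum_add_distrib] using add_mem h h'
  | smul f v _ hv =>
    obtain ⟨b, hb, h⟩ := hv
    obtain ⟨f, rfl⟩ := X.resStalk_surjective hX x f
    refine ⟨fun k => f * b k, fun k => by simp [hb], ?_⟩
    have := X.mul_mem_sup i J f.2 h
    simpa [Finset.mul_sum, mul_assoc] using this

include hX hg in
theorem smul_mem_relSub {J : Ideal (X.baseStalk x)} {r : X.baseStalk x} (hr : r ∈ J)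
    (v : Fin n → X.C.presheaf.stalk x) : X.τ.stalkMap x r • v ∈ X.relSub i g J := by
  choose b hb using fun k => X.resStalk_surjective hX x (v k)
  refine Submodule.subset_span ⟨fun k => ⟨X.stalkAlg x r, X.stalkAlg_mem x r⟩ * b k, fun k => ?_, ?_⟩
  · rw [map_mul, X.resStalk_stalkAlg, hb]
    rfl
  · refine Submodule.mem_sup_right ?_
    have : ∑ k, ((⟨X.stalkAlg x r, X.stalkAlg_mem x r⟩ * b k : X.A.zeroStalk x) : X.A.stalk x) * g k =
        r • ∑ k, (b k : X.A.stalk x) * g k := by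
      rw [Algebra.smul_def, Finset.mul_sum]
      exact Finset.sum_congr rfl fun k _ => mul_assoc _ _ _
    rw [this]
    refine Submodule.smul_mem_smul hr (sum_mem fun k _ => ?_)
    have := X.A.stalkFil_mul_mem (b k).2 (hg k)
    rwa [zero_add] at this

include hX in
/-- If the `g_k` generate `𝒜_i / 𝒜_{i+1}` with relations `r_l`, then all relations modulo
`𝒜_{i+1} + 𝔪 𝒜_i` are consequences of the `r_l` and of `𝔪`. -/
theorem mem_span_sup_of_mem_fiberGrSub {m : ℕ} (r : Fin m → Fin n → X.A.zeroStalk x)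
    (hgen : ∀ a ∈ X.A.stalkFil i x, ∃ c : Fin n → X.A.stalk x, (∀ k, c k ∈ X.A.stalkFil 0 x) ∧
        a - ∑ k, c k * g k ∈ X.A.stalkFil (i + 1) x)
    (hrel : ∀ c : Fin n → X.A.stalk x, (∀ k, c k ∈ X.A.stalkFil 0 x) →
        ∑ k, c k * g k ∈ X.A.stalkFil (i + 1) x →
        ∃ d : Fin m → X.A.stalk x, (∀ l, d l ∈ X.A.stalkFil 0 x) ∧
          ∀ k, c k - ∑ l, d l * (r l k : X.A.stalk x) ∈ X.A.stalkFil 1 x)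
    (c : Fin n → X.A.zeroStalk x) (hc : ∑ k, (c k : X.A.stalk x) * g k ∈ X.fiberGrSub i x) :
    (fun k => X.resStalk x (c k)) ∈
      Submodule.span (X.C.presheaf.stalk x) (Set.range fun l k => X.resStalk x (r l k)) ⊔
        X.fiberIdeal x • ⊤ := by
  obtain ⟨u, hu, v, hv, huv⟩ := Submodule.mem_sup.1 hc
  -- The part of the relation in 𝔪𝒜_i is rewritten through the generators with coefficients in 𝔪.
  -- Subtracting these coefficients leaves an honest relation modulo 𝒜_{i+1}, to which `hrel`
  -- applies.
  have hp : ∃ (p : Fin n → X.A.zeroStalk x), (∀ k, X.resStalk x (p k) ∈ X.fiberIdeal x) ∧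
      v - ∑ k, (p k : X.A.stalk x) * g k ∈ X.stalkSub (i + 1) x := by
    refine Submodule.smul_induction_on hv (fun r hr a ha => ?_) (fun a b ha hb => ?_)
    · obtain ⟨d, hd, h⟩ := hgen a ha
      refine ⟨fun k => ⟨X.stalkAlg x r, X.stalkAlg_mem x r⟩ * ⟨d k, hd k⟩, fun k => ?_, ?_⟩
      · rw [map_mul, X.resStalk_stalkAlg]
        exact Ideal.mul_mem_right _ _ (Ideal.mem_map_of_mem _ hr)
      · have := (X.stalkSub (i + 1) x).smul_mem r h
        have h2 : r • (a - ∑ k, d k * g k) = r • a - ∑ k,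
          ((⟨X.stalkAlg x r, X.stalkAlg_mem x r⟩ * ⟨d k, hd k⟩ : X.A.zeroStalk x) : X.A.stalk x) *
            g k := by
          rw [smul_sub, Finset.smul_sum]
          congr 1
          refine Finset.sum_congr rfl fun k _ => ?_
          rw [Algebra.smul_def, ← mul_assoc]
          rfl
        rwa [h2] at this
    · obtain ⟨p, hp, h⟩ := ha
      obtain ⟨p', hp', h'⟩ := hb
      refine ⟨p + p', fun k => by rw [Pi.add_apply, map_add]; exact add_mem (hp k) (hp' k), ?_⟩
      have := add_mem h h'
      have h2 : a + b - ∑ k, ((p + p') k : X.A.stalk x) * g k =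
          a - ∑ k, (p k : X.A.stalk x) * g k + (b - ∑ k, (p' k : X.A.stalk x) * g k) := by
        simp only [Pi.add_apply, Subring.coe_add, add_mul, Finset.sum_add_distrib]
        ring
      rwa [h2]
  obtain ⟨p, hp, hvp⟩ := hp
  obtain ⟨d, hd, h⟩ := hrel (fun k => c k - p k) (fun k => sub_mem (c k).2 (p k).2) (by
    have := add_mem hu hvp
    have h2 : ∑ k, ((c k : X.A.stalk x) - p k) * g k = u + (v - ∑ k, (p k : X.A.stalk x) * g k) := by
      simp only [sub_mul, Finset.sum_sub_distrib]
      rw [← huv]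
      ring
    rwa [h2])
  have hres : (fun k => X.resStalk x (c k)) =
      ∑ l, X.resStalk x ⟨d l, hd l⟩ • (fun k => X.resStalk x (r l k)) +
        fun k => X.resStalk x (p k) := by
    funext k
    have h1 : X.resStalk x (c k - p k - ∑ l, ⟨d l, hd l⟩ * r l k) = 0 := by
      rw [X.resStalk_eq_zero_iff hX]
      have := h k
      simpa using this
    rw [map_sub, map_sub, map_sum] at h1
    simp only [map_mul] at h1
    simp only [Pi.add_apply, Finset.sum_apply, Pi.smul_apply, smul_eq_mul]
    linear_combination h1
  rw [hres]
  refine Submodule.add_mem_sup (sum_mem fun l _ => Submodule.smul_mem _ _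
    (Submodule.subset_span ⟨l, rfl⟩)) ?_
  have : (fun k => X.resStalk x (p k)) = ∑ k, X.resStalk x (p k) • Pi.single k 1 := by
    funext j
    simp [Finset.sum_apply, Pi.single_apply]
  rw [this]
  exact sum_mem fun k _ => Submodule.smul_mem_smul (hp k) trivial

end Relations

end PreRibbon

end

noncomputable section

/-! ### Specialisation -/

theorem AlgebraicGeometry.IsAffineOpen.mem_primeIdealOf_iff {Y : Scheme.{u}} {V : Y.Opens}
    (hV : IsAffineOpen V) {s : Y} (hs : s ∈ V) (p : Γ(Y, V)) :
    p ∈ (hV.primeIdealOf ⟨s, hs⟩).asIdeal ↔ s ∉ Y.basicOpen p := by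
  rw [← Scheme.germ_mem_maximalIdeal_iff hs]
  let := Y.presheaf.algebra_section_stalk ⟨s, hs⟩
  have := hV.isLocalization_stalk ⟨s, hs⟩
  exact (IsLocalization.AtPrime.to_map_mem_maximal_iff (Y.presheaf.stalk s)
    (hV.primeIdealOf ⟨s, hs⟩).asIdeal p).symm

theorem AlgebraicGeometry.IsAffineOpen.exists_primeIdealOf_eq {Y : Scheme.{u}} {V : Y.Opens}
    (hV : IsAffineOpen V) (q : PrimeSpectrum Γ(Y, V)) :
    ∃ (y : Y) (hy : y ∈ V), hV.primeIdealOf ⟨y, hy⟩ = q := by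
  refine ⟨(hV.isoSpec.inv q).1, (hV.isoSpec.inv q).2, ?_⟩
  exact (Scheme.Hom.comp_apply hV.isoSpec.inv hV.isoSpec.hom q).symm.trans
    (congrArg (fun f : Spec Γ(Y, V) ⟶ Spec Γ(Y, V) => f q) hV.isoSpec.inv_hom_id)

namespace PreRibbon

variable {S : Scheme.{u}} (X : PreRibbon S)

theorem germ_appLE {V : S.Opens} {W : X.C.Opens} (h : W ≤ X.τ ⁻¹ᵁ V) {y : X.C} (hy : y ∈ W)
    (p : Γ(S, V)) : X.C.presheaf.germ W y hy (X.τ.appLE V W h p) =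
      X.τ.stalkMap y (S.presheaf.germ V (X.τ y) (h hy) p) :=
  (Scheme.germ_map_homOfLE h hy _).trans (Scheme.Hom.germ_stalkMap_apply X.τ V y (h hy) p).symm

section Affine

variable (hX : X.IsRibbon) {V : S.Opens} (hV : IsAffineOpen V) {W : X.C.Opens}
  (hW : IsAffineOpen W) (h : W ≤ X.τ ⁻¹ᵁ V) {i : ℤ} {n m : ℕ} {g : Fin n → X.A.sec W}
  (hg : ∀ k, g k ∈ X.A.fil i W) (r : Fin m → Fin n → X.A.zeroRing W)
  (c : Fin n → X.A.zeroRing W)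

/-- The germ of a section of `𝒜_0`. -/
def germ₀ {U : X.C.Opens} {x : X.C} (hx : x ∈ U) (a : X.A.zeroRing U) : X.A.zeroStalk x :=
  ⟨X.A.germ hx (a : X.A.sec U), X.A.germ_mem_stalkFil hx a.2⟩

theorem resStalk_germ₀ {U : X.C.Opens} {x : X.C} (hx : x ∈ U) (a : X.A.zeroRing U) :
    X.resStalk x (X.germ₀ hx a) = X.C.presheaf.germ U x hx (X.residue U a) :=
  X.resStalk_eq _ hx a rfl

/-- The submodule of `𝒪(W)^n` spanned by the relations and by `P`. -/
def relModule (P : Ideal Γ(S, V)) : Submodule Γ(X.C, W) (Fin n → Γ(X.C, W)) :=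
  Submodule.span _ (Set.range fun l k => X.residue W (r l k)) ⊔ P.map (X.τ.appLE V W h).hom • ⊤

-- Relations over the affine open W induce relations on every stalk, modulo any ideal J that
-- contains the germs of P.
include hX hg in
theorem germ_mem_relSub_of_mem_relModule {P : Ideal Γ(S, V)} {x : X.C} (hx : x ∈ W)
    {J : Ideal (X.baseStalk x)} (hJ : ∀ p ∈ P, S.presheaf.germ V (X.τ x) (h hx) p ∈ J)
    (hrel : ∀ l, ∑ k, X.A.germ hx (r l k : X.A.sec W) * X.A.germ hx (g k) ∈
      X.A.stalkFil (i + 1) x) {v : Fin n → Γ(X.C, W)} (hv : v ∈ X.relModule h r P) :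
    (fun k => X.C.presheaf.germ W x hx (v k)) ∈ X.relSub i (fun k => X.A.germ hx (g k)) J := by
  have hg' : ∀ k, X.A.germ hx (g k) ∈ X.A.stalkFil i x := fun k => X.A.germ_mem_stalkFil hx (hg k)
  let Q := X.relSub i (fun k => X.A.germ hx (g k)) J
  have hadd : ∀ v w : Fin n → Γ(X.C, W), (fun k => X.C.presheaf.germ W x hx (v k)) ∈ Q →
      (fun k => X.C.presheaf.germ W x hx (w k)) ∈ Q →
      (fun k => X.C.presheaf.germ W x hx ((v + w) k)) ∈ Q := fun v w hv hw => by
    have := add_mem hv hw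
    convert this using 1
    funext k
    exact map_add _ _ _
  have hsmul : ∀ (a : Γ(X.C, W)) (v : Fin n → Γ(X.C, W)),
      (fun k => X.C.presheaf.germ W x hx (v k)) ∈ Q →
      (fun k => X.C.presheaf.germ W x hx ((a • v) k)) ∈ Q := fun a v hv => by
    have := Q.smul_mem (X.C.presheaf.germ W x hx a) hv
    convert this using 1
    funext k
    exact map_mul _ _ _
  have hzero : (fun k => X.C.presheaf.germ W x hx ((0 : Fin n → Γ(X.C, W)) k)) ∈ Q := by
    convert Q.zero_mem using 1
    funext k
    exact map_zero _
  obtain ⟨v₁, hv₁, w, hw, rfl⟩ := Submodule.mem_sup.1 hv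
  refine hadd _ _ ?_ ?_
  · clear hv
    induction hv₁ using Submodule.span_induction with
    | mem v hv =>
      obtain ⟨l, rfl⟩ := hv
      exact Submodule.subset_span ⟨fun k => X.germ₀ hx (r l k), fun k => X.resStalk_germ₀ hx _,
        Submodule.mem_sup_left (hrel l)⟩
    | zero => exact hzero
    | add v w _ _ hv hw => exact hadd _ _ hv hw
    | smul a v _ hv => exact hsmul _ _ hv
  · refine Submodule.smul_induction_on hw (fun z hz w _ => ?_) (fun v w hv hw => hadd _ _ hv hw)
    induction hz using Submodule.span_induction with
    | mem z hz =>
      obtain ⟨p, hp, rfl⟩ := hz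
      have := X.smul_mem_relSub hX i _ hg' (hJ p hp) (fun k => X.C.presheaf.germ W x hx (w k))
      convert this using 1
      funext k
      refine (map_mul _ _ _).trans ?_
      rw [Pi.smul_apply, smul_eq_mul]
      congr 1
      exact X.germ_appLE h hx p
    | zero => rw [zero_smul]; exact hzero
    | add y z _ _ hy hz => rw [add_smul]; exact hadd _ _ hy hz
    | smul a z _ hz => rw [smul_assoc]; exact hsmul _ _ hz

-- The fibre of the coherent sheaf over s' is a localisation of 𝒪(W)^n modulo the relations and P.
-- Vanishing at every point of that fibre is thus detected by a single denominator `ρ` on V that is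
-- invertible at s'.
include hX hV hW hg in
theorem exists_smul_mem_of_forall_fiber
    (hcoh : ∀ y (hy : y ∈ W),
      (∀ a ∈ X.A.stalkFil i y, ∃ c : Fin n → X.A.stalk y, (∀ k, c k ∈ X.A.stalkFil 0 y) ∧
        a - ∑ k, c k * X.A.germ hy (g k) ∈ X.A.stalkFil (i + 1) y) ∧
      (∀ l, ∑ k, X.A.germ hy (r l k : X.A.sec W) * X.A.germ hy (g k) ∈ X.A.stalkFil (i + 1) y) ∧
      (∀ c : Fin n → X.A.stalk y, (∀ k, c k ∈ X.A.stalkFil 0 y) →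
        ∑ k, c k * X.A.germ hy (g k) ∈ X.A.stalkFil (i + 1) y →
        ∃ d : Fin m → X.A.stalk y, (∀ l, d l ∈ X.A.stalkFil 0 y) ∧
          ∀ k, c k - ∑ l, d l * X.A.germ hy (r l k : X.A.sec W) ∈ X.A.stalkFil 1 y))
    {s' : S} (hs' : s' ∈ V)
    (hfib : ∀ y (hy : y ∈ W), X.τ y = s' →
      ∑ k, X.A.germ hy (c k : X.A.sec W) * X.A.germ hy (g k) ∈ X.fiberGrSub i y) :
    ∃ ρ : Γ(S, V), s' ∈ S.basicOpen ρ ∧ ∀ x (hx : x ∈ W) (J : Ideal (X.baseStalk x)),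
      (∀ p : Γ(S, V), s' ∉ S.basicOpen p → S.presheaf.germ V (X.τ x) (h hx) p ∈ J) →
      S.presheaf.germ V (X.τ x) (h hx) ρ •
        ∑ k, X.A.germ hx (c k : X.A.sec W) * X.A.germ hx (g k) ∈
          X.stalkSub (i + 1) x ⊔ J • X.stalkSub i x := by
  let P := (hV.primeIdealOf ⟨s', hs'⟩).asIdeal
  let φ := (X.τ.appLE V W h).hom
  let v : Fin n → Γ(X.C, W) := fun k => X.residue W (c k)
  have hP : ∀ p ∈ P, ∀ w : Fin n → Γ(X.C, W), φ p • w ∈ X.relModule h r P := fun p hp w =>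
    Submodule.mem_sup_right (Submodule.smul_mem_smul (Ideal.mem_map_of_mem _ hp) trivial)
  obtain ⟨ρ, hρ, hρv⟩ := exists_notMem_smul_mem φ P (X.relModule h r P) v (fun p hp => hP p hp v) (by
    intro q hq hqP
    -- The primes of 𝒪(W) above the prime of s' are the points of W over s', and `hfib` speaks about
    -- exactly those points.
    obtain ⟨y, hy, hyq⟩ := hW.exists_primeIdealOf_eq ⟨q, hq⟩
    have hcomap := IsAffineOpen.comap_primeIdealOf_appLE V hV W hW h hy
    rw [hyq] at hcomap
    have hPy : hV.primeIdealOf ⟨X.τ y, h hy⟩ = hV.primeIdealOf ⟨s', hs'⟩ :=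
      hcomap.symm.trans (PrimeSpectrum.ext hqP)
    have hτ : X.τ y = s' := by
      have h1 := hV.fromSpec_primeIdealOf ⟨X.τ y, h hy⟩
      have h2 := hV.fromSpec_primeIdealOf ⟨s', hs'⟩
      exact h1.symm.trans ((congrArg hV.fromSpec hPy).trans h2)
    let := X.C.presheaf.algebra_section_stalk ⟨y, hy⟩
    let := S.presheaf.algebra_section_stalk ⟨X.τ y, h hy⟩
    have hloc : IsLocalization.AtPrime (X.C.presheaf.stalk y) q := by
      have := hW.isLocalization_stalk ⟨y, hy⟩
      rw [hyq] at this
      exact this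
    have hlocV := hV.isLocalization_stalk ⟨X.τ y, h hy⟩
    refine exists_notMem_smul_mem_of_localization (O := X.C.presheaf.stalk y) q _ v ?_
    obtain ⟨h1, h2, h3⟩ := hcoh y hy
    have hmem := X.mem_span_sup_of_mem_fiberGrSub hX i (fun k => X.A.germ hy (g k))
      (fun l k => X.germ₀ hy (r l k)) h1 h3 (fun k => X.germ₀ hy (c k)) (hfib y hy hτ)
    simp only [X.resStalk_germ₀] at hmem
    refine (sup_le ?_ ?_ : _ ≤ Submodule.span (X.C.presheaf.stalk y)
      ((fun w : Fin n → Γ(X.C, W) => fun k => X.C.presheaf.germ W y hy (w k)) ''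
        (X.relModule h r P : Set (Fin n → Γ(X.C, W))))) hmem
    · rw [Submodule.span_le]
      rintro _ ⟨l, rfl⟩
      exact Submodule.subset_span ⟨fun k => X.residue W (r l k),
        Submodule.mem_sup_left (Submodule.subset_span ⟨l, rfl⟩), rfl⟩
    · rw [Submodule.smul_le]
      intro z hz w _
      -- As y lies over s', the local ring at τ(y) is the localisation of 𝒪(V) at P, so germs of P
      -- generate its maximal ideal.
      have hmax : IsLocalRing.maximalIdeal (X.baseStalk y) =
          P.map (S.presheaf.germ V (X.τ y) (h hy)).hom := by
        have := IsLocalization.AtPrime.map_eq_maximalIdeal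
          (hV.primeIdealOf ⟨X.τ y, h hy⟩).asIdeal (S.presheaf.stalk (X.τ y))
        rw [← this, hPy]
        rfl
      rw [fiberIdeal, hmax, Ideal.map_map] at hz
      induction hz using Submodule.span_induction with
      | mem z hz =>
        obtain ⟨p, hp, rfl⟩ := hz
        have hw : w = ∑ k, w k • Pi.single k 1 := by
          funext j
          simp [Finset.sum_apply, Pi.single_apply]
        rw [hw, Finset.smul_sum]
        refine sum_mem fun k _ => ?_
        rw [smul_comm]
        refine Submodule.smul_mem _ _ (Submodule.subset_span
          ⟨φ p • Pi.single k 1, hP p hp _, ?_⟩)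
        funext j
        refine (map_mul _ _ _).trans ?_
        rw [Pi.smul_apply, smul_eq_mul]
        refine congrArg₂ (· * ·) (X.germ_appLE h hy p) ?_
        by_cases hjk : j = k
        · subst hjk; rw [Pi.single_eq_same, Pi.single_eq_same, map_one]
        · rw [Pi.single_eq_of_ne hjk, Pi.single_eq_of_ne hjk, map_zero]
      | zero => rw [zero_smul]; exact Submodule.zero_mem _
      | add y z _ _ hy hz => rw [add_smul]; exact add_mem hy hz
      | smul a z _ hz => rw [smul_assoc]; exact Submodule.smul_mem _ _ hz)
  refine ⟨ρ, not_not.1 (mt (hV.mem_primeIdealOf_iff hs' ρ).2 hρ), fun x hx J hJ => ?_⟩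
  have hmem := X.germ_mem_relSub_of_mem_relModule hX h hg r hx (J := J)
    (fun p hp => hJ p ((hV.mem_primeIdealOf_iff hs' p).1 hp)) (hcoh x hx).2.1 hρv
  have := X.mem_of_mem_relSub hX i _ (fun k => X.A.germ_mem_stalkFil hx (hg k)) hmem
    (fun k => ⟨_, X.stalkAlg_mem x (S.presheaf.germ V (X.τ x) (h hx) ρ)⟩ * X.germ₀ hx (c k))
    (fun k => by
      rw [map_mul, X.resStalk_stalkAlg, X.resStalk_germ₀, ← X.germ_appLE h hx]
      exact (map_mul _ _ _).symm)
  have heq : S.presheaf.germ V (X.τ x) (h hx) ρ •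
      ∑ k, X.A.germ hx (c k : X.A.sec W) * X.A.germ hx (g k) =
      ∑ k, X.stalkAlg x (S.presheaf.germ V (X.τ x) (h hx) ρ) * X.A.germ hx (c k : X.A.sec W) *
        X.A.germ hx (g k) := by
    rw [Algebra.smul_def, Finset.mul_sum]
    exact Finset.sum_congr rfl fun k _ => (mul_assoc _ _ _).symm
  rw [heq]
  exact this

end Affine

/-! ### Primes of the local rings of S and vanishing along a fibre -/

/-- The prime ideal of `𝒪_{S,s}` of a point `s'` that specialises to `s`. -/
def _root_.AlgebraicGeometry.Scheme.specIdeal {Y : Scheme.{u}} {s' s : Y} (h : s' ⤳ s) :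
    Ideal (Y.presheaf.stalk s) :=
  (IsLocalRing.maximalIdeal (Y.presheaf.stalk s')).comap (Y.presheaf.stalkSpecializes h).hom

instance {Y : Scheme.{u}} {s' s : Y} (h : s' ⤳ s) : (Scheme.specIdeal h).IsPrime :=
  inferInstanceAs (Ideal.comap _ _).IsPrime

theorem _root_.AlgebraicGeometry.Scheme.germ_mem_specIdeal_iff {Y : Scheme.{u}} {s' s : Y}
    (h : s' ⤳ s) {V : Y.Opens} (hs : s ∈ V) (p : Γ(Y, V)) :
    Y.presheaf.germ V s hs p ∈ Scheme.specIdeal h ↔ s' ∉ Y.basicOpen p := by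
  rw [← Scheme.germ_mem_maximalIdeal_iff (h.mem_open V.isOpen hs), Scheme.specIdeal, Ideal.mem_comap]
  have := ConcreteCategory.congr_hom (Y.presheaf.germ_stalkSpecializes hs h) p
  exact this ▸ Iff.rfl

theorem exists_common_section {x : X.C} {j : ℤ} {ι : Type*} [Finite ι] (t : ι → X.A.stalk x)
    (ht : ∀ k, t k ∈ X.A.stalkFil j x) :
    ∃ (W : X.C.Opens) (hx : x ∈ W) (c : ι → X.A.sec W), (∀ k, c k ∈ X.A.fil j W) ∧
      ∀ k, X.A.germ hx (c k) = t k := by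
  choose U hU a ha hat using ht
  cases nonempty_fintype ι
  have hx : x ∈ Finset.univ.inf U := by
    rw [← SetLike.mem_coe, Opens.coe_finset_inf]
    simp [hU]
  refine ⟨Finset.univ.inf U, hx, fun k => X.A.res (Finset.inf_le (Finset.mem_univ k)) (a k),
    fun k => X.A.fil_res j _ (ha k), fun k => ?_⟩
  rw [X.A.germ_res _ hx, hat]

/-- If a section of `𝒜_i` vanishes in `𝒜_i / 𝒜_{i+1}` on the fibre over `s'`, and `s'` specialises to
`τ(x)`, then its germ at `x` vanishes in `𝒜_i / 𝒜_{i+1}` modulo the prime ideal of `s'`. -/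
theorem germ_mem_of_forall_fiber (hX : X.IsRibbon) {x : X.C} {U : X.C.Opens} (hx : x ∈ U) {i : ℤ}
    {a : X.A.sec U} (ha : a ∈ X.A.fil i U) {s' : S} (hs : s' ⤳ X.τ x)
    (hfib : ∀ y (hy : y ∈ U), X.τ y = s' → X.A.germ hy a ∈ X.fiberGrSub i y) :
    X.A.germ hx a ∈ X.stalkSub (i + 1) x ⊔ Scheme.specIdeal hs • X.stalkSub i x := by
  obtain ⟨W₀, n, m, g, r, hxW₀, hg, hr, hcoh⟩ := hX.coherent i x
  obtain ⟨c, hc, hac⟩ := (hcoh x hxW₀).1 _ (X.A.germ_mem_stalkFil hx ha)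
  obtain ⟨W₁, hxW₁, c, hcW₁, hc'⟩ := X.exists_common_section c hc
  have hxN : x ∈ (U ⊓ W₀) ⊓ W₁ := ⟨⟨hx, hxW₀⟩, hxW₁⟩
  have hN₀ : (U ⊓ W₀) ⊓ W₁ ≤ W₀ := inf_le_left.trans inf_le_right
  have hNU : (U ⊓ W₀) ⊓ W₁ ≤ U := inf_le_left.trans inf_le_left
  -- Near x the section equals ∑ c_k g_k modulo 𝒜_{i+1}, so its vanishing becomes a question about
  -- the coefficients c_k.
  obtain ⟨N, hN, hxN', hmem⟩ := X.A.exists_res_mem_fil hxN (i := i + 1)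
    (X.A.res hNU a - ∑ k, X.A.res inf_le_right (c k) * X.A.res hN₀ (g k)) (by
      rw [map_sub, map_sum, X.A.germ_res _ hxN]
      simp only [map_mul, X.A.germ_res _ hxN, hc']
      exact hac)
  obtain ⟨_, ⟨V, hV, rfl⟩, hxV, -⟩ := S.isBasis_affineOpens.exists_subset_of_mem_open
    (Set.mem_univ (X.τ x)) isOpen_univ
  obtain ⟨_, ⟨W, hW, rfl⟩, hxW, hWN⟩ := X.C.isBasis_affineOpens.exists_subset_of_mem_open
    (show x ∈ (N ⊓ X.τ ⁻¹ᵁ V : X.C.Opens) from ⟨hxN', hxV⟩) (Opens.isOpen _)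
  have hWN' : W ≤ N ⊓ X.τ ⁻¹ᵁ V := hWN
  have hWV : W ≤ X.τ ⁻¹ᵁ V := hWN'.trans inf_le_right
  have hW₀ : W ≤ W₀ := (hWN'.trans inf_le_left).trans (hN.trans hN₀)
  have hW₁ : W ≤ W₁ := (hWN'.trans inf_le_left).trans (hN.trans inf_le_right)
  have hWU : W ≤ U := (hWN'.trans inf_le_left).trans (hN.trans hNU)
  have hdiff : ∀ y (hy : y ∈ W), X.A.germ (hWU hy) a -
      ∑ k, X.A.germ (hW₁ hy) (c k) * X.A.germ (hW₀ hy) (g k) ∈ X.stalkSub (i + 1) y := by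
    intro y hy
    have h1 := X.A.germ_mem_stalkFil (hWN' hy).1 hmem
    rw [X.A.germ_res, map_sub, map_sum, X.A.germ_res _ (hN (hWN' hy).1)] at h1
    simp only [map_mul, X.A.germ_res _ (hN (hWN' hy).1)] at h1
    exact h1
  obtain ⟨ρ, hρ, hρ'⟩ := X.exists_smul_mem_of_forall_fiber hX hV hW hWV
    (g := fun k => X.A.res hW₀ (g k)) (fun k => X.A.fil_res i hW₀ (hg k))
    (fun l k => ⟨X.A.res hW₀ (r l k), X.A.fil_res 0 hW₀ (hr l k)⟩)
    (fun k => ⟨X.A.res hW₁ (c k), X.A.fil_res 0 hW₁ (hcW₁ k)⟩) (s' := s')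
    (fun y hy => by
      simp only [X.A.germ_res _ hy]
      exact hcoh y (hW₀ hy))
    (hs.mem_open V.isOpen hxV)
    (fun y hy hyτ => by
      simp only [X.A.germ_res _ hy]
      have := sub_mem (hfib y (hWU hy) hyτ)
        (Submodule.mem_sup_left (hdiff y hy) : _ ∈ X.fiberGrSub i y)
      rwa [sub_sub_cancel] at this)
  have hρx := hρ' x hxW (Scheme.specIdeal hs) fun p hp => (Scheme.germ_mem_specIdeal_iff hs _ p).2 hp
  simp only [X.A.germ_res _ hxW] at hρx
  have := hX.gr_flat i x
  -- `ρ` lies outside the prime of s', and a flat graded piece has no torsion modulo a prime, so `ρ`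
  -- can be cancelled.
  refine mem_sup_smul_of_smul_mem (Scheme.specIdeal hs)
    (mt (Scheme.germ_mem_specIdeal_iff hs hxV ρ).1 (not_not.2 hρ)) (X.A.germ_mem_stalkFil hx ha) ?_
  have := add_mem (Submodule.mem_sup_left ((X.stalkSub (i + 1) x).smul_mem
    (S.presheaf.germ V (X.τ x) hxV ρ) (hdiff x hxW))) hρx
  rwa [← smul_add, sub_add_cancel] at this

end PreRibbon

end

noncomputable section

/-! ### Membership in the filtration along generic points -/

/-- On an affine neighbourhood this is the correspondence between primes of a localisation and
primes contained in that of s. It lets the minimal primes of 𝒪_{S,s} be handled as points of S. -/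
theorem AlgebraicGeometry.Scheme.exists_specIdeal_eq {Y : Scheme.{u}} (s : Y)
    (p : Ideal (Y.presheaf.stalk s)) [p.IsPrime] :
    ∃ (s' : Y) (h : s' ⤳ s), Scheme.specIdeal h = p := by
  obtain ⟨_, ⟨V, hV, rfl⟩, hs, -⟩ := Y.isBasis_affineOpens.exists_subset_of_mem_open
    (Set.mem_univ s) isOpen_univ
  let := Y.presheaf.algebra_section_stalk ⟨s, hs⟩
  have hloc := hV.isLocalization_stalk ⟨s, hs⟩
  obtain ⟨s', hs', hq⟩ := hV.exists_primeIdealOf_eq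
    ⟨p.comap (Y.presheaf.germ V s hs).hom, inferInstance⟩
  have hle : p.comap (Y.presheaf.germ V s hs).hom ≤ (hV.primeIdealOf ⟨s, hs⟩).asIdeal := by
    intro r hr
    rw [hV.mem_primeIdealOf_iff, ← Scheme.germ_mem_maximalIdeal_iff hs]
    exact IsLocalRing.le_maximalIdeal (Ideal.IsPrime.ne_top ‹_›) hr
  have h : s' ⤳ s := by
    have h1 : hV.primeIdealOf ⟨s', hs'⟩ ⤳ hV.primeIdealOf ⟨s, hs⟩ := by
      rw [← PrimeSpectrum.le_iff_specializes, hq]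
      exact hle
    have h2 := h1.map hV.fromSpec.continuous
    exact ((specializes_of_eq (hV.fromSpec_primeIdealOf ⟨s', hs'⟩).symm).trans h2).trans
      (specializes_of_eq (hV.fromSpec_primeIdealOf ⟨s, hs⟩))
  refine ⟨s', h, ?_⟩
  refine (IsLocalization.orderEmbedding (hV.primeIdealOf ⟨s, hs⟩).asIdeal.primeCompl
    (Y.presheaf.stalk s)).injective ?_
  ext r
  refine (Scheme.germ_mem_specIdeal_iff h hs r).trans ?_
  rw [← hV.mem_primeIdealOf_iff hs', hq]
  exact Iff.rfl

namespace PreRibbon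

variable {S : Scheme.{u}} (X : PreRibbon S)

/-- Around `x`, a section whose germ lies in `𝒜_{j,x} + I 𝒜_{i,x}` is the sum of a section of `𝒜_j`
and of a section `∑ p_k a_k` with `p_k ∈ I` and `a_k ∈ 𝒜_i`. -/
theorem exists_res_eq_add {x : X.C} {U : X.C.Opens} (hx : x ∈ U) (a : X.A.sec U)
    {I : Ideal (X.baseStalk x)} {i j : ℤ}
    (h : X.A.germ hx a ∈ X.stalkSub j x ⊔ I • X.stalkSub i x) :
    ∃ (W : X.C.Opens) (hW : W ≤ U) (b c : X.A.sec W) (hxW : x ∈ W) (V : S.Opens)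
      (hV : W ≤ X.τ ⁻¹ᵁ V) (s : Finset Γ(S, V)), b ∈ X.A.fil j W ∧ X.A.res hW a = b + c ∧
      (∀ p ∈ s, S.presheaf.germ V (X.τ x) (hV hxW) p ∈ I) ∧
      ∀ y (hy : y ∈ W) (J : Ideal (X.baseStalk y)),
        (∀ p ∈ s, S.presheaf.germ V (X.τ y) (hV hy) p ∈ J) →
          X.A.germ hy c ∈ J • X.stalkSub i y := by
  obtain ⟨b, hb, c, hc, hbc⟩ := Submodule.mem_sup.1 h
  obtain ⟨U₁, hx₁, b, hbU, rfl⟩ := hb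
  obtain ⟨U₂, c, hx₂, V, hV, s, rfl, hs, hs'⟩ := X.exists_section_smul hc
  have hxN : x ∈ U ⊓ (U₁ ⊓ U₂) := ⟨hx, hx₁, hx₂⟩
  have h₁ : U ⊓ (U₁ ⊓ U₂) ≤ U₁ := inf_le_right.trans inf_le_left
  have h₂ : U ⊓ (U₁ ⊓ U₂) ≤ U₂ := inf_le_right.trans inf_le_right
  obtain ⟨W, hW, hW', hxW, heq⟩ := X.A.exists_res_eq hxN hxN (X.A.res inf_le_left a)
    (X.A.res h₁ b + X.A.res h₂ c) (by
      rw [map_add, X.A.germ_res _ hxN, X.A.germ_res _ hxN, X.A.germ_res _ hxN]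
      exact hbc.symm)
  refine ⟨W, hW.trans inf_le_left, X.A.res (hW.trans h₁) b, X.A.res (hW.trans h₂) c, hxW, V,
    (hW.trans h₂).trans hV, s, X.A.fil_res j _ hbU, ?_, hs, fun y hy J hJ => ?_⟩
  · rw [X.A.res_res, map_add, X.A.res_res, X.A.res_res] at heq
    exact heq
  · rw [X.A.germ_res _ hy]
    exact hs' y _ J hJ

/-- A section of `𝒜_i` whose germ at the generic point of a fibre vanishes in the restriction of
`𝒜_i / 𝒜_{i+1}` to the fibre has this property along the whole fibre. -/
theorem germ_mem_fiberGrSub_of_fiberGen (hX : X.IsRibbon) (hS : X.StandingAssumptions) {s : S}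
    {U : X.C.Opens} {i : ℤ} {b : X.A.sec U} (hb : b ∈ X.A.fil i U) (hη : X.fiberGen hS s ∈ U)
    (h : X.A.germ hη b ∈ X.fiberGrSub i _) {y : X.C} (hy : y ∈ U) (hτ : X.τ y = s) :
    X.A.germ hy b ∈ X.fiberGrSub i y := by
  -- Near the generic point, b is a section of 𝒜_{i+1} plus a combination with coefficients
  -- vanishing at s, so it vanishes on all of C_s ∩ W.
  obtain ⟨W, hWU, b', c, hηW, V, hV, t, hb', hbc, ht, htc⟩ := X.exists_res_eq_add hη b h
  have key : ∀ z (hz : z ∈ W), X.τ z = s → X.A.germ (hWU hz) b ∈ X.fiberGrSub i z := by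
    intro z hz hzs
    rw [← X.A.germ_res hWU hz, hbc, map_add]
    refine Submodule.add_mem_sup (X.A.germ_mem_stalkFil hz hb') (htc z hz _ fun p hp => ?_)
    have := (Scheme.germ_mem_maximalIdeal_iff _ p).1 (ht p hp)
    refine (Scheme.germ_mem_maximalIdeal_iff _ p).2 ?_
    rwa [hzs, ← X.τ_fiberGen hS s]
  have hfin := X.finite_fiber_notMem hX hS hηW
  obtain ⟨y, rfl⟩ := X.exists_fiberι_eq hτ
  -- Only finitely many points of the fibre lie outside W, and there are no sections with finite
  -- support.
  refine hX.torsionFree i s U b hb (hfin.subset ?_) y hy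
  rintro z ⟨hz, hzb⟩ hzW
  exact hzb (key _ hzW (X.τ_fiberι s z))

/-- Flat morphisms lift generalisations, so every neighbourhood of x meets the fibre over s' and
hence contains its generic point. -/
theorem fiberGen_mem_of_specializes (hX : X.IsRibbon) (hS : X.StandingAssumptions) {x : X.C}
    {s' : S} (h : s' ⤳ X.τ x) {U : X.C.Opens} (hx : x ∈ U) : X.fiberGen hS s' ∈ U := by
  have := hX.flat
  obtain ⟨y, hyx, hy⟩ := Flat.generalizingMap X.τ h
  exact X.fiberGen_mem hS hy (hyx.mem_open U.isOpen hx)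

/-- The engine of the proof. In a graded piece, vanishing passes from the generic point of a fibre
to the whole fibre and then to x modulo the prime of the fibre. `hloc` combines the primes for s ∈ T
into I, and the correction in I𝒜 is split off before the next step. -/
theorem germ_mem_sup_of_fiberGen (hX : X.IsRibbon) (hS : X.StandingAssumptions) {x : X.C}
    (T : Set S) (hT : ∀ s ∈ T, s ⤳ X.τ x) (I : Ideal (X.baseStalk x))
    (hI : ∀ s (h : s ∈ T), I ≤ Scheme.specIdeal (hT s h))
    (hloc : ∀ i, ∀ b ∈ X.stalkSub i x,
      (∀ s (h : s ∈ T), b ∈ X.stalkSub (i + 1) x ⊔ Scheme.specIdeal (hT s h) • X.stalkSub i x) →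
        b ∈ X.stalkSub (i + 1) x ⊔ I • X.stalkSub i x)
    {j : ℤ} {U : X.C.Opens} (hx : x ∈ U) (a : X.A.sec U)
    (ha : ∀ s ∈ T, ∀ hη : X.fiberGen hS s ∈ U, X.A.germ hη a ∈ (X.fiberFiltration _).F j) :
    X.A.germ hx a ∈
      X.stalkSub j x ⊔ I • (⊤ : Submodule (X.baseStalk x) (X.A.stalk x)) := by
  -- `n` is the number of filtration steps still missing; the open set and the section vary because
  -- both shrink at each step.
  have key : ∀ (n : ℕ) {U : X.C.Opens} (hx : x ∈ U) (a : X.A.sec U), a ∈ X.A.fil (j - n) U →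
      (∀ s ∈ T, ∀ hη : X.fiberGen hS s ∈ U, X.A.germ hη a ∈ (X.fiberFiltration _).F j) →
      X.A.germ hx a ∈ X.stalkSub j x ⊔ I • (⊤ : Submodule (X.baseStalk x) (X.A.stalk x)) := by
    intro n
    induction n with
    | zero =>
      intro U hx a ha _
      rw [Nat.cast_zero, sub_zero] at ha
      exact Submodule.mem_sup_left (X.A.germ_mem_stalkFil hx ha)
    | succ n ih =>
      intro U hx a ha haj
      have h1 := hloc _ _ (X.A.germ_mem_stalkFil hx ha) fun s hs =>
        X.germ_mem_of_forall_fiber hX hx ha (hT s hs) fun y hy hτ =>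
          have hη := X.fiberGen_mem_of_specializes hX hS (hT s hs) hx
          X.germ_mem_fiberGrSub_of_fiberGen hX hS ha hη (X.mem_fiberGrSub hX
            (X.A.germ_mem_stalkFil hη ha)
            ((X.fiberFiltration _).anti (by push_cast; omega) (haj s hs hη))) hy hτ
      obtain ⟨W, hWU, b, c, hxW, V, hV, t, hb, hbc, ht, htc⟩ := X.exists_res_eq_add hx a h1
      rw [← X.A.germ_res hWU hxW, hbc, map_add]
      refine add_mem (ih hxW b ?_ fun s hs hη => ?_) (Submodule.mem_sup_right
        (Submodule.smul_mono le_rfl le_top (htc x hxW I ht)))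
      · convert hb using 2
        push_cast; ring
      · have h2 := X.A.germ_res hWU hη a
        rw [hbc, map_add] at h2
        -- The coefficients of c lie in I, hence vanish at every s ∈ T, so at these generic points c
        -- lies in 𝔪𝒜 and b satisfies the same hypothesis as a.
        rw [← add_sub_cancel_right (X.A.germ hη b) (X.A.germ hη c), h2]
        refine sub_mem (haj s hs (hWU hη)) (Submodule.mem_sup_right
          (Submodule.smul_mono le_rfl le_top (htc _ hη _ fun p hp => ?_)))
        have := (Scheme.germ_mem_specIdeal_iff _ _ p).1 (hI s hs (ht p hp))
        refine (Scheme.germ_mem_maximalIdeal_iff _ p).2 ?_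
        rwa [X.τ_fiberGen hS s]
  obtain ⟨W, hWU, i, hxW, hi⟩ := X.A.exhaust U a x hx
  rw [← X.A.germ_res hWU hxW]
  -- If i ≥ j, then `toNat` returns 0 and nothing remains to be climbed.
  refine key (j - i).toNat hxW (X.A.res hWU a) (X.A.fil_anti W (by omega) hi) fun s hs hη => ?_
  rw [X.A.germ_res hWU hη]
  exact ha s hs _

/-- The case of one generalisation. It gives semicontinuity of the order, and with s = τ(x) it
spreads a bound from the generic point over the fibre. -/
theorem germ_mem_sup_specIdeal (hX : X.IsRibbon) (hS : X.StandingAssumptions) {x : X.C} {s : S}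
    (hs : s ⤳ X.τ x) {j : ℤ} {U : X.C.Opens} (hx : x ∈ U) (a : X.A.sec U)
    (hη : X.fiberGen hS s ∈ U) (ha : X.A.germ hη a ∈ (X.fiberFiltration _).F j) :
    X.A.germ hx a ∈ (X.fiberFiltration x).F j := by
  have := X.germ_mem_sup_of_fiberGen hX hS {s} (by rintro _ rfl; exact hs) (Scheme.specIdeal hs)
    (by rintro _ rfl; exact le_rfl) (fun i b _ h => h s rfl) hx a (by rintro _ rfl _; exact ha)
  exact sup_le_sup_left (Submodule.smul_mono (IsLocalRing.le_maximalIdeal (Ideal.IsPrime.ne_top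
    (inferInstanceAs (Scheme.specIdeal hs).IsPrime))) le_rfl) (X.stalkSub j x) this

/-- The case of all generalisations: every minimal prime of 𝒪_{S,τ(x)} belongs to one of them, so
the bounds combine to one modulo the nilradical. -/
theorem germ_mem_sup_nilA [IsLocallyNoetherian S] (hX : X.IsRibbon) (hS : X.StandingAssumptions)
    {x : X.C} {j : ℤ} {U : X.C.Opens} (hx : x ∈ U) (a : X.A.sec U)
    (ha : ∀ s, ∀ hη : X.fiberGen hS s ∈ U, X.A.germ hη a ∈ (X.fiberFiltration _).F j) :
    X.A.germ hx a ∈ X.stalkSub j x ⊔ X.nilA x := by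
  refine X.germ_mem_sup_of_fiberGen hX hS {s | s ⤳ X.τ x} (fun s hs => hs) (X.nilStalk x)
    (fun s hs => nilradical_le_prime _) (fun i b hb h => ?_) hx a (fun s _ hη => ha s hη)
  have := hX.gr_flat i x
  refine mem_sup_nilradical_smul hb fun p hp => ?_
  have := hp.1.1
  obtain ⟨s, hs, rfl⟩ := Scheme.exists_specIdeal_eq (X.τ x) p
  exact h s hs

end PreRibbon

/-- A null sequence is eventually in F i, so completing does not change which elements of R lie in a
given step. Orders can therefore be computed before completion. -/
theorem RingFiltration.incl_mem_complFil_iff {R : Type u} [CommRing R] (𝓕 : RingFiltration R)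
    {i : ℤ} {a : R} : 𝓕.incl a ∈ 𝓕.complFil i ↔ a ∈ 𝓕.F i := by
  refine ⟨?_, 𝓕.incl_mem⟩
  rintro ⟨c, ⟨N, hN⟩, hc⟩
  obtain ⟨M, hM⟩ := Ideal.Quotient.eq.1 hc i
  have := (𝓕.F i).sub_mem (hN (max N M) (le_max_left _ _)) (hM (max N M) (le_max_right _ _))
  change c.1 _ - (c.1 _ - a) ∈ _ at this
  rwa [sub_sub_cancel] at this

namespace PreRibbon

variable {S : Scheme.{u}} (X : PreRibbon S)

/-- The order along a fibre, defined by all its points, depends only on the generic point; one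
direction is evaluation there, the other is `germ_mem_sup_specIdeal` with s = τ(x). -/
theorem mem_ordSet_iff (hX : X.IsRibbon) (hS : X.StandingAssumptions) {U : X.C.Opens}
    (a : X.A.sec U) {s : S} (hη : X.fiberGen hS s ∈ U) (j : ℤ) :
    j ∈ X.ordSet a s ↔ X.A.germ hη a ∈ (X.fiberFiltration _).F j := by
  constructor
  · intro h
    obtain ⟨y, hy⟩ := X.exists_fiberι_eq (X.τ_fiberGen hS s)
    have := hS.irreducible s
    exact (RingFiltration.incl_mem_complFil_iff _).1 (h ⟨genericPoint (X.τ.fiber s), hη⟩)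
  · intro h y
    refine (RingFiltration.incl_mem_complFil_iff _).2 ?_
    exact X.germ_mem_sup_specIdeal hX hS (specializes_of_eq (X.τ_fiberι s y).symm) y.2 a hη h

end PreRibbon

end

noncomputable section

/-! ### Units -/

namespace FilteredRingSheaf

variable {T : TopCat.{u}} (A : FilteredRingSheaf T)

/-- Around `x` there is a unit of order one: a section of `𝒜_1` with inverse in `𝒜_{-1}`. -/
def HasUniformizer (x : T) : Prop :=
  ∃ (U : Opens T) (_ : x ∈ U) (t : (A.sec U)ˣ), (t : A.sec U) ∈ A.fil 1 U ∧
    ((t⁻¹ : (A.sec U)ˣ) : A.sec U) ∈ A.fil (-1) U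

theorem HasUniformizer.isInvertibleAt {A : FilteredRingSheaf T} {x : T} (h : A.HasUniformizer x) :
    A.IsInvertibleAt x := by
  apply le_antisymm
  · rw [AddSubgroup.closure_le]
    rintro _ ⟨a, ha, b, hb, rfl⟩
    exact A.stalkFil_mul_mem ha hb
  · obtain ⟨U, hx, t, ht, ht'⟩ := h
    intro z hz
    refine AddSubgroup.subset_closure ⟨_, A.germ_mem_stalkFil hx ht, _,
      (A.stalkFil_mul_mem (A.germ_mem_stalkFil hx ht') hz : _ ∈ A.stalkFil (-1 + 0) x), ?_⟩
    rw [← mul_assoc, ← map_mul, Units.mul_inv, map_one, one_mul]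

/-- The inverse is the geometric series in -a, which converges because (-a)^j ∈ 𝒜_j. -/
theorem IsComplete.exists_unit_eq_one_add {A : FilteredRingSheaf T} (hA : A.IsComplete)
    {U : Opens T} {a : A.sec U} (ha : a ∈ A.fil 1 U) :
    ∃ u ∈ A.zeroUnits U, (u : A.sec U) = 1 + a := by
  have hpow : ∀ j : ℕ, (-a) ^ j ∈ A.fil j U := fun j => by
    induction j with
    | zero => rw [pow_zero]; exact A.one_mem U
    | succ j ih =>
      rw [pow_succ]
      exact_mod_cast A.mul_mem ih (neg_mem ha)
  have hsum : ∀ j : ℕ, ∑ k ∈ Finset.range j, (-a) ^ k ∈ A.fil 0 U := fun j =>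
    sum_mem fun k _ => A.fil_anti U (Int.natCast_nonneg k) (hpow k)
  obtain ⟨b, ⟨hb0, hb⟩, -⟩ := hA 0 U
    (fun j x => A.germ x.2 (∑ k ∈ Finset.range j, (-a) ^ k))
    (fun j _ x => ⟨U, le_rfl, _, x.2, hsum j, fun y hy => by rw [sub_self]; exact zero_mem _⟩)
    (fun j _ x => by
      rw [Finset.sum_range_succ, map_add, add_sub_cancel_left, zero_add]
      exact A.germ_mem_stalkFil x.2 (hpow j))
  -- The difference lies in 𝒜_j for every j > 0, and so does 0; the uniqueness half of completeness
  -- identifies them.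
  have h1 : (1 + a) * b - 1 = 0 := by
    refine (hA 0 U (fun _ _ => 0)
      (fun j _ x => ⟨U, le_rfl, 0, x.2, zero_mem _, fun y hy => by
        rw [map_zero, sub_self]; exact zero_mem _⟩)
      (fun j _ x => by rw [sub_self]; exact zero_mem _)).unique
      ⟨?_, fun j hj x => ?_⟩ ⟨zero_mem _, fun j hj x => by
        rw [map_zero, sub_self]; exact zero_mem _⟩
    · refine sub_mem ?_ (A.one_mem U)
      exact (A.zeroRing U).mul_mem (add_mem (A.one_mem U) (A.fil_anti U zero_le_one ha)) hb0
    · have hgeom : (∑ k ∈ Finset.range j, (-a) ^ k) * (-a - 1) = (-a) ^ j - 1 := geom_sum_mul _ _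
      have : (1 + a) * b - 1 = (1 + a) * (b - ∑ k ∈ Finset.range j, (-a) ^ k) - (-a) ^ j := by
        linear_combination -hgeom
      rw [sub_zero, this, map_sub, map_mul, map_sub, zero_add]
      refine sub_mem ?_ (A.germ_mem_stalkFil x.2 (hpow j))
      have := A.stalkFil_mul_mem (i := 0) (A.germ_mem_stalkFil x.2
        (add_mem (A.one_mem U) (A.fil_anti U zero_le_one ha))) (hb j hj x)
      simpa only [zero_add] using this
  exact ⟨⟨1 + a, b, by linear_combination h1, by linear_combination h1⟩,
    ⟨add_mem (A.one_mem U) (A.fil_anti U zero_le_one ha), hb0⟩, rfl⟩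

end FilteredRingSheaf

namespace PreRibbon

variable {S : Scheme.{u}} (X : PreRibbon S)

/-- A lift of the inverse residue inverts `a` modulo 𝒜_1, and 1 + 𝒜_1 consists of units of 𝒜_0. -/
theorem exists_zeroUnits_eq_res (hX : X.IsRibbon) {x : X.C} {U : X.C.Opens} (hx : x ∈ U)
    (a : X.A.zeroRing U) (h : IsUnit (X.resStalk x (X.germ₀ hx a))) :
    ∃ (W : X.C.Opens) (hW : W ≤ U), x ∈ W ∧
      ∃ u ∈ X.A.zeroUnits W, (u : X.A.sec W) = X.A.res hW a := by
  obtain ⟨r, hr⟩ := isUnit_iff_exists_inv.1 h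
  obtain ⟨b', rfl⟩ := X.resStalk_surjective hX x r
  obtain ⟨V, hV, b, hbV, hb⟩ := b'.2
  have hxN : x ∈ U ⊓ V := ⟨hx, hV⟩
  have hz : X.resStalk x (X.germ₀ hx a * b' - 1) = 0 := by
    rw [map_sub, map_mul, hr, map_one, sub_self]
  rw [X.resStalk_eq_zero_iff hX] at hz
  obtain ⟨W, hW, hxW, hmem⟩ := X.A.exists_res_mem_fil hxN (i := 1)
    (X.A.res inf_le_left (a : X.A.sec U) * X.A.res inf_le_right b - 1) (by
      rw [map_sub, map_mul, X.A.germ_res _ hxN, X.A.germ_res _ hxN, hb, map_one]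
      exact hz)
  obtain ⟨u, hu, hu'⟩ := hX.complete.exists_unit_eq_one_add hmem
  have hprod : X.A.res (hW.trans inf_le_left) (a : X.A.sec U) *
      X.A.res (hW.trans inf_le_right) b = u := by
    rw [hu', map_sub, map_mul, map_one, X.A.res_res, X.A.res_res]
    ring
  have hb0 : X.A.res (hW.trans inf_le_right) b ∈ X.A.fil 0 W := X.A.fil_res 0 _ hbV
  have hinv : X.A.res (hW.trans inf_le_left) (a : X.A.sec U) *
      (X.A.res (hW.trans inf_le_right) b * ((u⁻¹ : (X.A.sec W)ˣ) : X.A.sec W)) = 1 := by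
    rw [← mul_assoc, hprod, Units.mul_inv]
  exact ⟨W, hW.trans inf_le_left, hxW, ⟨_, _, hinv, (mul_comm _ _).trans hinv⟩,
    ⟨X.A.fil_res 0 _ a.2, (X.A.zeroRing W).mul_mem hb0 hu.2⟩, rfl⟩

/-- An element of `𝒜_{0,x}` vanishes in the local ring of the fibre iff its residue lies in the
ideal of the fibre. -/
theorem resStalk_mem_fiberIdeal_iff (hX : X.IsRibbon) {x : X.C} (a : X.A.zeroStalk x) :
    X.resStalk x a ∈ X.fiberIdeal x ↔ (a : X.A.stalk x) ∈ X.fiberGrSub 0 x := by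
  constructor
  · have key : ∀ f ∈ X.fiberIdeal x, ∀ a : X.A.zeroStalk x, X.resStalk x a = f →
        (a : X.A.stalk x) ∈ X.fiberGrSub 0 x := by
      intro f hf
      have h1 : ∃ b : X.A.zeroStalk x, X.resStalk x b = f ∧
          (b : X.A.stalk x) ∈ X.fiberGrSub 0 x := by
        induction hf using Submodule.span_induction with
        | mem f hf =>
          obtain ⟨r, hr, rfl⟩ := hf
          refine ⟨_, X.resStalk_stalkAlg x r, Submodule.mem_sup_right ?_⟩
          have := Submodule.smul_mem_smul hr (X.A.stalkFiltration x).one_mem (N := X.stalkSub 0 x)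
          exact Set.mem_of_eq_of_mem
            ((Algebra.smul_def r (1 : X.A.stalk x)).trans (mul_one _)).symm this
        | zero => exact ⟨0, map_zero _, zero_mem _⟩
        | add f g _ _ hf hg =>
          obtain ⟨b, rfl, hb⟩ := hf
          obtain ⟨c, rfl, hc⟩ := hg
          exact ⟨b + c, map_add _ _ _, add_mem hb hc⟩
        | smul g f _ hf =>
          obtain ⟨b, rfl, hb⟩ := hf
          obtain ⟨c, rfl⟩ := X.resStalk_surjective hX x g
          exact ⟨c * b, map_mul _ _ _, X.mul_mem_sup 0 _ c.2 hb⟩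
      obtain ⟨b, hb, hbm⟩ := h1
      intro a ha
      have h2 := (X.resStalk_eq_zero_iff hX (a - b)).1 (by rw [map_sub, ha, hb, sub_self])
      have h3 := add_mem (Submodule.mem_sup_left h2) hbm
      rwa [AddSubgroupClass.coe_sub, sub_add_cancel] at h3
    exact fun h => key _ h a rfl
  · intro h
    obtain ⟨b, hb, c, hc, hbc⟩ := Submodule.mem_sup.1 h
    have key : ∀ c ∈ IsLocalRing.maximalIdeal (X.baseStalk x) • X.stalkSub 0 x,
        ∃ c' : X.A.zeroStalk x, (c' : X.A.stalk x) = c ∧ X.resStalk x c' ∈ X.fiberIdeal x := by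
      intro c hc
      refine Submodule.smul_induction_on hc (fun r hr n hn => ?_) (fun a b h1 h2 => ?_)
      · refine ⟨⟨_, X.stalkAlg_mem x r⟩ * ⟨n, hn⟩, (Algebra.smul_def r n).symm, ?_⟩
        rw [map_mul, X.resStalk_stalkAlg]
        exact Ideal.mul_mem_right _ _ (Ideal.mem_map_of_mem _ hr)
      · obtain ⟨a', rfl, ha⟩ := h1
        obtain ⟨b', rfl, hb⟩ := h2
        exact ⟨a' + b', rfl, by rw [map_add]; exact add_mem ha hb⟩
    obtain ⟨c', rfl, hc'⟩ := key c hc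
    have h2 := (X.resStalk_eq_zero_iff hX (a - c')).2 (by
      rw [AddSubgroupClass.coe_sub, ← hbc, add_sub_cancel_right]; exact hb)
    rw [map_sub, sub_eq_zero] at h2
    rwa [h2]

/-- On the fibre, 1 is a sum of products ab with a of degree 1 and b of degree -1. As 𝒪_{C,x} is
local, some such product, lifted to 𝒜, has unit residue; it is then a unit of 𝒜_0, and a is the
desired section. -/
theorem hasUniformizer_of_isInvertibleAt (hX : X.IsRibbon) {s : S} (P : X.τ.fiber s)
    (hP : (X.fiberA s).IsInvertibleAt P) : X.A.HasUniformizer (X.τ.fiberι s P) := by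
  set x := X.τ.fiberι s P with hx
  let 𝓕 := X.fiberFiltration x
  have happrox : ∀ (j k : ℤ), j ≤ k → ∀ (W : (X.τ.fiber s).Opens) (hPW : P ∈ W)
      (f : (X.fiberA s).sec W), f ∈ (X.fiberA s).fil j W →
      ∃ a ∈ X.A.stalkFil j x, f.1 ⟨P, hPW⟩ - 𝓕.incl a ∈ 𝓕.complFil k := by
    intro j k hjk W hPW f hf
    obtain ⟨U, a, hU, h⟩ := f.2 k ⟨P, hPW⟩
    have h1 := h ⟨P, hPW⟩ hU
    have h2 : 𝓕.incl (X.A.germ hU a) ∈ 𝓕.complFil j := by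
      have := sub_mem (hf ⟨P, hPW⟩) (𝓕.complFil_anti hjk h1)
      rwa [sub_sub_cancel] at this
    obtain ⟨b, hb, c, hc, hbc⟩ := Submodule.mem_sup.1 (𝓕.incl_mem_complFil_iff.1 h2)
    refine ⟨b, hb, ?_⟩
    have h3 := add_mem h1 (𝓕.incl_mem (i := k) (Submodule.mem_sup_right hc))
    rwa [← hbc, map_add, sub_add_eq_sub_sub, sub_add_cancel] at h3
  have hmain : ∃ a ∈ X.A.stalkFil 1 x, ∃ b ∈ X.A.stalkFil (-1) x, ∃ m : X.A.zeroStalk x,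
      (m : X.A.stalk x) = a * b ∧ IsUnit (X.resStalk x m) := by
    -- If all residues of products were non-units, every element of 𝒜_{s,0} at P, being a sum of
    -- products, would be congruent modulo 𝒜_{s,1} to an element with residue in the maximal ideal.
    by_contra! hcon
    have key : ∀ t ∈ (X.fiberA s).stalkFil 0 P, ∃ (W : (X.τ.fiber s).Opens) (hPW : P ∈ W)
        (f : (X.fiberA s).sec W), (X.fiberA s).germ hPW f = t ∧ ∃ m : X.A.zeroStalk x,
        X.resStalk x m ∈ IsLocalRing.maximalIdeal _ ∧
        f.1 ⟨P, hPW⟩ - 𝓕.incl m ∈ 𝓕.complFil 1 := by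
      rw [← hP]
      intro t ht
      induction ht using AddSubgroup.closure_induction with
      | mem t ht =>
        obtain ⟨_, ⟨W₁, h₁, f, hf, rfl⟩, _, ⟨W₂, h₂, g, hg, rfl⟩, rfl⟩ := ht
        -- The product has to be known modulo degree 1: since the factors have degrees 1 and -1,
        -- precisions 2 and 0 are needed.
        obtain ⟨a, ha, hfa⟩ := happrox 1 2 (by norm_num) W₁ h₁ f hf
        obtain ⟨b, hb, hgb⟩ := happrox (-1) 0 (by norm_num) W₂ h₂ g hg
        have hP12 : P ∈ W₁ ⊓ W₂ := ⟨h₁, h₂⟩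
        have hab : a * b ∈ X.A.stalkFil 0 x := X.A.stalkFil_mul_mem ha hb
        refine ⟨W₁ ⊓ W₂, hP12, (X.fiberA s).res inf_le_left f * (X.fiberA s).res inf_le_right g,
          by rw [map_mul, FilteredRingSheaf.germ_res _ _ hP12,
            FilteredRingSheaf.germ_res _ _ hP12], ⟨a * b, hab⟩, ?_, ?_⟩
        · exact hcon a ha b hb ⟨a * b, hab⟩ rfl
        · exact 𝓕.mul_approx (i := 1) (hf ⟨P, h₁⟩) (hg ⟨P, h₂⟩) hfa hgb
      | zero =>
        exact ⟨⊤, trivial, 0, map_zero _, 0, by rw [map_zero]; exact zero_mem _, by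
          rw [Subring.coe_zero, map_zero, sub_zero]; exact zero_mem _⟩
      | add t u _ _ ht hu =>
        obtain ⟨W₁, h₁, f, rfl, m, hm, hfm⟩ := ht
        obtain ⟨W₂, h₂, g, rfl, n, hn, hgn⟩ := hu
        have hP12 : P ∈ W₁ ⊓ W₂ := ⟨h₁, h₂⟩
        refine ⟨W₁ ⊓ W₂, hP12, (X.fiberA s).res inf_le_left f + (X.fiberA s).res inf_le_right g,
          by rw [map_add, FilteredRingSheaf.germ_res _ _ hP12,
            FilteredRingSheaf.germ_res _ _ hP12], m + n, ?_, ?_⟩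
        · rw [map_add]; exact add_mem hm hn
        · rw [Subring.coe_add, map_add]
          have := add_mem hfm hgn
          rwa [← add_sub_add_comm] at this
      | neg t _ ht =>
        obtain ⟨W₁, h₁, f, rfl, m, hm, hfm⟩ := ht
        refine ⟨W₁, h₁, -f, map_neg _ _, -m, by rw [map_neg]; exact neg_mem hm, ?_⟩
        rw [Subring.coe_neg, map_neg]
        have h := neg_mem hfm
        have h' : ∀ a b : 𝓕.Completion, -(a - b) = -a - -b := fun a b => by ring
        rw [h'] at h
        exact h
    -- For the element 1 this puts 1 - m in the ideal of the fibre with m in the maximal ideal,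
    -- hence 1 in the maximal ideal.
    obtain ⟨W, hPW, f, hf, m, hm, hfm⟩ := key 1 ((X.fiberA s).stalkFiltration P).one_mem
    obtain ⟨W', h, h', hPW', hres⟩ := (X.fiberA s).exists_res_eq hPW hPW f 1
      (hf.trans (map_one _).symm)
    have hf1 : f.1 ⟨P, hPW⟩ = 1 := congrFun (congrArg Subtype.val hres) ⟨P, hPW'⟩
    rw [hf1, ← map_one 𝓕.incl, ← map_sub, 𝓕.incl_mem_complFil_iff] at hfm
    have h1 := X.mem_fiberGrSub hX (i := 0)
      (sub_mem (X.A.stalkFiltration x).one_mem m.2) hfm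
    have h2 := X.fiberIdeal_le x ((X.resStalk_mem_fiberIdeal_iff hX (1 - m)).2 h1)
    rw [map_sub, map_one] at h2
    have h3 := add_mem h2 hm
    rw [sub_add_cancel] at h3
    exact (Ideal.ne_top_iff_one _).1 (IsLocalRing.maximalIdeal.isMaximal _).ne_top h3
  obtain ⟨_, ⟨U₁, h₁, a, ha, rfl⟩, _, ⟨U₂, h₂, b, hb, rfl⟩, m, hm, hu⟩ := hmain
  have hx12 : x ∈ U₁ ⊓ U₂ := ⟨h₁, h₂⟩
  have ha' := X.A.fil_res 1 (inf_le_left : U₁ ⊓ U₂ ≤ U₁) ha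
  have hb' := X.A.fil_res (-1) (inf_le_right : U₁ ⊓ U₂ ≤ U₂) hb
  obtain ⟨W, hW, hxW, u, hu, huW⟩ := X.exists_zeroUnits_eq_res hX hx12
    ⟨X.A.res inf_le_left a * X.A.res inf_le_right b, X.A.mul_mem ha' hb'⟩ (by
      convert hu
      apply Subtype.ext
      rw [hm]
      refine (map_mul (X.A.germ hx12) _ _).trans ?_
      rw [X.A.germ_res _ hx12, X.A.germ_res _ hx12])
  have hinv : X.A.res hW (X.A.res inf_le_left a) *
      (X.A.res hW (X.A.res inf_le_right b) * ((u⁻¹ : (X.A.sec W)ˣ) : X.A.sec W)) = 1 := by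
    rw [← mul_assoc, ← map_mul]
    exact huW ▸ u.mul_inv
  refine ⟨W, hxW, ⟨_, _, hinv, (mul_comm _ _).trans hinv⟩, X.A.fil_res 1 hW ha', ?_⟩
  have := X.A.mul_mem (X.A.fil_res (-1) hW hb') hu.2
  rwa [add_zero] at this

theorem hasUniformizer_of_starStar (hX : X.IsRibbon) (h : ∀ s, (X.fiberA s).StarStar) (x : X.C) :
    X.A.HasUniformizer x := by
  obtain ⟨P, hP⟩ := X.exists_fiberι_eq (rfl : X.τ x = X.τ x)
  obtain ⟨𝒰, hcover, h𝒰⟩ := h (X.τ x)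
  obtain ⟨U, hU, hPU⟩ := hcover P
  obtain ⟨-, t, ht, ht'⟩ := h𝒰 U hU
  have := X.hasUniformizer_of_isInvertibleAt hX P
    (FilteredRingSheaf.HasUniformizer.isInvertibleAt ⟨U, hPU, t, ht, ht'⟩)
  rwa [hP] at this

theorem hasUniformizer_fiberGen (hX : X.IsRibbon) (hS : X.StandingAssumptions) (s : S) :
    X.A.HasUniformizer (X.fiberGen hS s) := by
  obtain ⟨P, hP⟩ := hS.exists_point s
  obtain ⟨U, hU, t, ht⟩ := X.hasUniformizer_of_isInvertibleAt hX P hP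
  exact ⟨U, X.fiberGen_mem hS (X.τ_fiberι s P) hU, t, ht⟩

end PreRibbon

end

noncomputable section

/-! ### The order of a unit -/

namespace RingFiltration

variable {R : Type u} [CommRing R] (𝓕 : RingFiltration R)

/-- If u ∈ F j and u⁻¹ ∈ F m, then 1 ∈ F (j + m), which forces j + m ≤ 0; so the degree of u⁻¹
bounds that of u. -/
theorem exists_isGreatest (h1 : (1 : R) ∉ 𝓕.F 1) (u : Rˣ) :
    ∃ n, IsGreatest {j | (u : R) ∈ 𝓕.F j} n := by
  obtain ⟨i, hi⟩ := 𝓕.exhaust u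
  obtain ⟨m, hm⟩ := 𝓕.exhaust (u⁻¹ : Rˣ)
  obtain ⟨n, hn, hmax⟩ := Int.exists_greatest_of_bdd (P := fun j => (u : R) ∈ 𝓕.F j)
    ⟨-m, fun j hj => by
      by_contra! hlt
      refine h1 (𝓕.anti (show 1 ≤ j + m by omega) ?_)
      have := 𝓕.mul_mem hj hm
      rwa [Units.mul_inv] at this⟩ ⟨i, hi⟩
  exact ⟨n, hn, hmax⟩

variable {𝓕} {t : Rˣ} (ht : (t : R) ∈ 𝓕.F 1) (ht' : ((t⁻¹ : Rˣ) : R) ∈ 𝓕.F (-1))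

include ht ht'

theorem zpow_mem (n : ℤ) : ((t ^ n : Rˣ) : R) ∈ 𝓕.F n := by
  have key : ∀ (t : Rˣ) (j : ℤ), (t : R) ∈ 𝓕.F j → ∀ n : ℕ, ((t ^ n : Rˣ) : R) ∈ 𝓕.F (j * n) := by
    intro t j h n
    induction n with
    | zero => simpa using 𝓕.one_mem
    | succ n ih =>
      rw [pow_succ, Units.val_mul]
      convert 𝓕.mul_mem ih h using 2
      push_cast; ring
  obtain ⟨n, rfl | rfl⟩ := n.eq_nat_or_neg
  · simpa using key t 1 ht n
  · simpa using key t⁻¹ (-1) ht' n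

/-- Multiplication by powers of t shifts both factors to order 0, where the primality of F 1 in F 0
keeps the product out of F 1. -/
theorem isGreatest_mul
    (hprime : ∀ a ∈ 𝓕.F 0, ∀ b ∈ 𝓕.F 0, a * b ∈ 𝓕.F 1 → a ∈ 𝓕.F 1 ∨ b ∈ 𝓕.F 1)
    {a b : R} {m n : ℤ} (ha : IsGreatest {j | a ∈ 𝓕.F j} m) (hb : IsGreatest {j | b ∈ 𝓕.F j} n) :
    IsGreatest {j | a * b ∈ 𝓕.F j} (m + n) := by
  have hsh : ∀ {a : R} {j : ℤ} (k : ℤ), a ∈ 𝓕.F j → ((t ^ k : Rˣ) : R) * a ∈ 𝓕.F (k + j) :=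
    fun k h => 𝓕.mul_mem (zpow_mem ht ht' k) h
  have hback : ∀ {a : R} {m : ℤ}, IsGreatest {j | a ∈ 𝓕.F j} m →
      ((t ^ (-m) : Rˣ) : R) * a ∈ 𝓕.F 0 ∧ ((t ^ (-m) : Rˣ) : R) * a ∉ 𝓕.F 1 := by
    intro a m h
    refine ⟨by simpa using hsh (-m) h.1, fun h' => ?_⟩
    have := hsh m h'
    rw [← mul_assoc, ← Units.val_mul, ← zpow_add, add_neg_cancel, zpow_zero, Units.val_one,
      one_mul] at this
    have := h.2 this
    omega
  refine ⟨𝓕.mul_mem ha.1 hb.1, fun j hj => ?_⟩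
  by_contra! hlt
  have h2 := 𝓕.anti (show 1 ≤ -(m + n) + j by omega) (hsh (-(m + n)) hj)
  have h3 : ((t ^ (-(m + n)) : Rˣ) : R) * (a * b) =
      ((t ^ (-m) : Rˣ) : R) * a * (((t ^ (-n) : Rˣ) : R) * b) := by
    rw [neg_add, zpow_add, Units.val_mul]; ring
  rw [h3] at h2
  rcases hprime _ (hback ha).1 _ (hback hb).1 h2 with h | h
  · exact (hback ha).2 h
  · exact (hback hb).2 h

theorem isGreatest_uniformizer (h1 : (1 : R) ∉ 𝓕.F 1) : IsGreatest {j | (t : R) ∈ 𝓕.F j} 1 := by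
  refine ⟨ht, fun j hj => ?_⟩
  by_contra! hlt
  refine h1 (𝓕.anti (show 1 ≤ j + -1 by omega) ?_)
  have := 𝓕.mul_mem hj ht'
  rwa [Units.mul_inv] at this

end RingFiltration

namespace PreRibbon

variable {S : Scheme.{u}} (X : PreRibbon S)

theorem fiberIdeal_isPrime_of_isRibbon (hX : X.IsRibbon) (hS : X.StandingAssumptions) (x : X.C) :
    (X.fiberIdeal x).IsPrime := by
  have := (hX.curve (X.τ x)).isReduced
  have := hS.irreducible (X.τ x)
  exact X.fiberIdeal_isPrime x

theorem one_notMem_fiberFiltration (hX : X.IsRibbon) (x : X.C) :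
    (1 : X.A.stalk x) ∉ (X.fiberFiltration x).F 1 := by
  intro h
  have h1 := X.mem_fiberGrSub hX (i := 0) (X.A.stalkFiltration x).one_mem h
  have h2 := X.fiberIdeal_le x ((X.resStalk_mem_fiberIdeal_iff hX 1).2 h1)
  rw [map_one] at h2
  exact (Ideal.ne_top_iff_one _).1 (IsLocalRing.maximalIdeal.isMaximal _).ne_top h2

/-- The residue map identifies F 0 / F 1 with 𝒪_{C,x} modulo the ideal of the fibre, which is a
domain. -/
theorem fiberFiltration_prime (hX : X.IsRibbon) (hS : X.StandingAssumptions) (x : X.C) :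
    ∀ a ∈ (X.fiberFiltration x).F 0, ∀ b ∈ (X.fiberFiltration x).F 0,
      a * b ∈ (X.fiberFiltration x).F 1 →
        a ∈ (X.fiberFiltration x).F 1 ∨ b ∈ (X.fiberFiltration x).F 1 := by
  intro a ha b hb hab
  obtain ⟨a₀, ha₀, p, hp, rfl⟩ := Submodule.mem_sup.1 ha
  obtain ⟨b₀, hb₀, q, hq, rfl⟩ := Submodule.mem_sup.1 hb
  have hF : ∀ p ∈ IsLocalRing.maximalIdeal (X.baseStalk x) •
      (⊤ : Submodule (X.baseStalk x) (X.A.stalk x)), ∀ j, p ∈ (X.fiberFiltration x).F j :=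
    fun p hp j => Submodule.mem_sup_right hp
  have hpb := (X.fiberFiltration x).mul_mem (hF p hp 1) hb
  have haq := (X.fiberFiltration x).mul_mem (Submodule.mem_sup_left ha₀ : a₀ ∈
    (X.fiberFiltration x).F 0) (hF q hq 1)
  have h0 : a₀ * b₀ ∈ (X.fiberFiltration x).F 1 := by
    have := sub_mem (sub_mem hab hpb) haq
    convert this using 1
    ring
  let a' : X.A.zeroStalk x := ⟨a₀, ha₀⟩
  let b' : X.A.zeroStalk x := ⟨b₀, hb₀⟩
  have h1 := (X.resStalk_mem_fiberIdeal_iff hX (a' * b')).2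
    (X.mem_fiberGrSub hX (i := 0) (a' * b').2 h0)
  rw [map_mul] at h1
  rcases (X.fiberIdeal_isPrime_of_isRibbon hX hS x).mem_or_mem h1 with h | h
  · exact Or.inl (add_mem (X.fiberGrSub_le x 0 ((X.resStalk_mem_fiberIdeal_iff hX a').1 h)) (hF p hp 1))
  · exact Or.inr (add_mem (X.fiberGrSub_le x 0 ((X.resStalk_mem_fiberIdeal_iff hX b').1 h)) (hF q hq 1))

variable (hX : X.IsRibbon) (hS : X.StandingAssumptions)

/-- The order of a unit of the stalk of `𝒜` at the generic point of the fibre over `s`. -/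
def ord (s : S) (u : (X.A.stalk (X.fiberGen hS s))ˣ) : ℤ :=
  (RingFiltration.exists_isGreatest _ (X.one_notMem_fiberFiltration hX _) u).choose

theorem isGreatest_ord (s : S) (u : (X.A.stalk (X.fiberGen hS s))ˣ) :
    IsGreatest {j | (u : X.A.stalk (X.fiberGen hS s)) ∈ (X.fiberFiltration _).F j}
      (X.ord hX hS s u) :=
  (RingFiltration.exists_isGreatest _ (X.one_notMem_fiberFiltration hX _) u).choose_spec

theorem ord_mul (s : S) (u v : (X.A.stalk (X.fiberGen hS s))ˣ) :
    X.ord hX hS s (u * v) = X.ord hX hS s u + X.ord hX hS s v := by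
  obtain ⟨U, hU, t, ht, ht'⟩ := X.hasUniformizer_fiberGen hX hS s
  refine (X.isGreatest_ord hX hS s (u * v)).unique ?_
  exact RingFiltration.isGreatest_mul (t := Units.map (X.A.germ hU).toMonoidHom t)
    (Submodule.mem_sup_left (X.A.germ_mem_stalkFil hU ht))
    (Submodule.mem_sup_left (X.A.germ_mem_stalkFil hU ht'))
    (X.fiberFiltration_prime hX hS _)
    (X.isGreatest_ord hX hS s u) (X.isGreatest_ord hX hS s v)

theorem ord_inv (s : S) (u : (X.A.stalk (X.fiberGen hS s))ˣ) :
    X.ord hX hS s u⁻¹ = -X.ord hX hS s u := by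
  have h1 := X.ord_mul hX hS s 1 1
  have h2 := X.ord_mul hX hS s u⁻¹ u
  rw [mul_one] at h1
  rw [inv_mul_cancel] at h2
  omega

/-- The order of a unit along the fibre through a point. -/
def ordAt {U : X.C.Opens} (a : (X.A.sec U)ˣ) {x : X.C} (hx : x ∈ U) : ℤ :=
  X.ord hX hS (X.τ x) (Units.map (X.A.germ (X.fiberGen_mem hS rfl hx)).toMonoidHom a)

theorem ordAt_mul {U : X.C.Opens} (a b : (X.A.sec U)ˣ) {x : X.C} (hx : x ∈ U) :
    X.ordAt hX hS (a * b) hx = X.ordAt hX hS a hx + X.ordAt hX hS b hx :=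
  (congrArg _ (map_mul _ a b)).trans (X.ord_mul hX hS _ _ _)

theorem ordAt_inv {U : X.C.Opens} (a : (X.A.sec U)ˣ) {x : X.C} (hx : x ∈ U) :
    X.ordAt hX hS a⁻¹ hx = -X.ordAt hX hS a hx :=
  (congrArg _ (map_inv _ a)).trans (X.ord_inv hX hS _ _)

theorem isGreatest_ordAt {U : X.C.Opens} (a : (X.A.sec U)ˣ) {x : X.C} (hx : x ∈ U) :
    IsGreatest (X.ordSet (a : X.A.sec U) (X.τ x)) (X.ordAt hX hS a hx) := by
  have h := X.isGreatest_ord hX hS (X.τ x)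
    (Units.map (X.A.germ (X.fiberGen_mem hS rfl hx)).toMonoidHom a)
  have heq : X.ordSet (a : X.A.sec U) (X.τ x) = _ :=
    Set.ext fun j => X.mem_ordSet_iff hX hS (a : X.A.sec U) (X.fiberGen_mem hS rfl hx) j
  rw [heq]
  exact h

theorem ordAt_res {U V : X.C.Opens} (h : V ≤ U) (a : (X.A.sec U)ˣ) {x : X.C} (hx : x ∈ V) :
    X.ordAt hX hS (Units.map (X.A.res h).toMonoidHom a) hx = X.ordAt hX hS a (h hx) :=
  congrArg (X.ord hX hS (X.τ x)) (Units.ext (X.A.germ_res h _ _))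

theorem ordAt_eq_one {U : X.C.Opens} {t : (X.A.sec U)ˣ} (ht : (t : X.A.sec U) ∈ X.A.fil 1 U)
    (ht' : ((t⁻¹ : (X.A.sec U)ˣ) : X.A.sec U) ∈ X.A.fil (-1) U) {x : X.C} (hx : x ∈ U) :
    X.ordAt hX hS t hx = 1 := by
  have hη := X.fiberGen_mem hS rfl hx
  exact (X.isGreatest_ord hX hS _ _).unique (RingFiltration.isGreatest_uniformizer
    (t := Units.map (X.A.germ hη).toMonoidHom t)
    (Submodule.mem_sup_left (X.A.germ_mem_stalkFil hη ht))
    (Submodule.mem_sup_left (X.A.germ_mem_stalkFil hη ht'))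
    (X.one_notMem_fiberFiltration hX _))

theorem germ_mem_of_le_ordAt {U : X.C.Opens} (a : (X.A.sec U)ˣ) {x : X.C} (hx : x ∈ U) {s : S}
    (hτ : X.τ x = s) (hη : X.fiberGen hS s ∈ U) {j : ℤ} :
    X.A.germ hη (a : X.A.sec U) ∈ (X.fiberFiltration _).F j ↔ j ≤ X.ordAt hX hS a hx := by
  subst hτ
  have h := X.isGreatest_ord hX hS (X.τ x) (Units.map (X.A.germ hη).toMonoidHom a)
  exact ⟨fun hj => h.2 hj, fun hj => (X.fiberFiltration _).anti hj h.1⟩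

theorem ordAt_le_of_specializes {U : X.C.Opens} (a : (X.A.sec U)ˣ) {x y : X.C} (hx : x ∈ U)
    (hy : y ∈ U) (h : X.τ x ⤳ X.τ y) : X.ordAt hX hS a hx ≤ X.ordAt hX hS a hy := by
  have hηx := X.fiberGen_mem hS rfl hx
  have hηy := X.fiberGen_mem hS rfl hy
  rw [← X.germ_mem_of_le_ordAt hX hS a hy rfl hηy]
  refine X.germ_mem_sup_specIdeal hX hS
    (h.trans (specializes_of_eq (X.τ_fiberGen hS (X.τ y)).symm)) hηy a hηx ?_
  exact (X.germ_mem_of_le_ordAt hX hS a hx rfl hηx).2 le_rfl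

/-- Semicontinuity for a and for a⁻¹ gives inequalities in opposite directions. -/
theorem ordAt_eq_of_specializes {U : X.C.Opens} (a : (X.A.sec U)ˣ) {x y : X.C} (hx : x ∈ U)
    (hy : y ∈ U) (h : X.τ x ⤳ X.τ y) : X.ordAt hX hS a hx = X.ordAt hX hS a hy := by
  refine le_antisymm (X.ordAt_le_of_specializes hX hS a hx hy h) ?_
  have := X.ordAt_le_of_specializes hX hS a⁻¹ hx hy h
  rw [ordAt_inv, ordAt_inv] at this
  omega

-- Remove the finitely many irreducible components that miss x: any remaining point shares a
-- component with x, whose generic point specialises to both.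
omit hX hS in
theorem _root_.TopologicalSpace.NoetherianSpace.exists_isOpen_specializes {T : Type*}
    [TopologicalSpace T] [NoetherianSpace T] [QuasiSober T] (x : T) :
    ∃ V : Set T, IsOpen V ∧ x ∈ V ∧ ∀ y ∈ V, ∃ z, z ⤳ x ∧ z ⤳ y := by
  have hfin := NoetherianSpace.finite_irreducibleComponents (α := T)
  refine ⟨(⋃₀ {Z ∈ irreducibleComponents T | x ∉ Z})ᶜ, ?_, ?_, fun y hy => ?_⟩
  · rw [isOpen_compl_iff, Set.sUnion_eq_biUnion]
    exact (hfin.subset (Set.sep_subset _ _)).isClosed_biUnion fun Z hZ =>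
      isClosed_of_mem_irreducibleComponents Z hZ.1
  · rintro ⟨Z, hZ, hxZ⟩
    exact hZ.2 hxZ
  · have hxZ : x ∈ irreducibleComponent y := by
      by_contra h
      exact hy ⟨_, ⟨irreducibleComponent_mem_irreducibleComponents y, h⟩, mem_irreducibleComponent⟩
    obtain ⟨z, hz⟩ := QuasiSober.sober (isIrreducible_irreducibleComponent (x := y))
      isClosed_irreducibleComponent
    exact ⟨z, hz.specializes hxZ, hz.specializes mem_irreducibleComponent⟩

theorem isLocallyConstant_ordAt [AlgebraicGeometry.IsNoetherian S] {U : X.C.Opens}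
    (a : (X.A.sec U)ˣ) :
    IsLocallyConstant fun x : U => (ULift.up (X.ordAt hX hS a x.2) : ULift.{u} ℤ) := by
  have := hX.flat
  refine (IsLocallyConstant.iff_exists_open _).2 fun x => ?_
  obtain ⟨V, hV, hxV, h⟩ := NoetherianSpace.exists_isOpen_specializes (X.τ x.1)
  refine ⟨(fun y : U => X.τ y.1) ⁻¹' V, hV.preimage (by fun_prop), hxV, fun y hy => ?_⟩
  obtain ⟨z, hzx, hzy⟩ := h _ hy
  -- Flatness lifts z to a generalisation w of x, which automatically lies in U. Only τ(w) has to
  -- specialise to τ(y).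
  obtain ⟨w, hwx, rfl⟩ := Flat.generalizingMap X.τ hzx
  have hw : w ∈ U := hwx.mem_open U.isOpen x.2
  exact congrArg ULift.up ((X.ordAt_eq_of_specializes hX hS a hw y.2 hzy).symm.trans
    (X.ordAt_eq_of_specializes hX hS a hw x.2 hzx))

/-- The order map `𝒜^* → ℤ_C`. -/
def orderMap [AlgebraicGeometry.IsNoetherian S] :
    X.A.unitsSheaf ⟶ SheafAux.constZ X.C.carrier :=
  ⟨{ app := fun U => AddCommGrpCat.ofHom
      { toFun := fun a : Additive (X.A.sec U.unop)ˣ =>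
          ⟨fun x => ULift.up (X.ordAt hX hS a.toMul x.2), X.isLocallyConstant_ordAt hX hS a.toMul⟩
        map_zero' := Subtype.ext (funext fun x => ULift.ext _ _ (by
          have := X.ordAt_mul hX hS (1 : (X.A.sec U.unop)ˣ) 1 x.2
          rw [mul_one] at this
          exact add_eq_left.1 this.symm))
        map_add' := fun a b => Subtype.ext (funext fun x => ULift.ext _ _
          (X.ordAt_mul hX hS a.toMul b.toMul x.2)) }
     naturality := fun U V i => by
      ext a
      exact Subtype.ext (funext fun x => ULift.ext _ _
        (X.ordAt_res hX hS i.unop.le (Additive.toMul a) x.2)) }⟩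

theorem isOrderMap_orderMap [AlgebraicGeometry.IsNoetherian S] :
    X.IsOrderMap (X.orderMap hX hS) :=
  fun _ a _ hx => X.isGreatest_ordAt hX hS (Additive.toMul (a : Additive (X.A.sec _)ˣ)) hx

theorem surjectiveOn_orderMap [AlgebraicGeometry.IsNoetherian S] {U : X.C.Opens}
    (hU : ∀ x ∈ U, X.A.HasUniformizer x) : X.SurjectiveOn (X.orderMap hX hS) U := by
  intro W hW f x hx
  obtain ⟨V, hxV, t, ht, ht'⟩ := hU x (hW hx)
  obtain ⟨N, hN, hxN, hc⟩ := (IsLocallyConstant.iff_exists_open _).1 f.2 ⟨x, hx⟩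
  obtain ⟨N, hN', rfl⟩ := isOpen_induced_iff.1 hN
  let W' : X.C.Opens := W ⊓ (V ⊓ ⟨N, hN'⟩)
  have hWV : W' ≤ V := inf_le_right.trans inf_le_left
  let t' : (X.A.sec W')ˣ := Units.map (X.A.res hWV).toMonoidHom t
  let n : ℤ := (f.1 ⟨x, hx⟩).down
  let a : X.A.unitsSheaf.presheaf.obj (op W') := (Additive.ofMul t' : Additive (X.A.sec W')ˣ)
  refine ⟨W', inf_le_left, n • a, ⟨hx, hxV, hxN⟩, ?_⟩
  rw [map_zsmul]
  refine Subtype.ext (funext fun y => ULift.ext _ _ ?_)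
  have h1 : X.ordAt hX hS t' y.2 = 1 :=
    X.ordAt_eq_one hX hS (X.A.fil_res 1 hWV ht) (X.A.fil_res (-1) hWV ht') y.2
  have h2 : f.1 ⟨y.1, y.2.1⟩ = f.1 ⟨x, hx⟩ := hc ⟨y.1, y.2.1⟩ y.2.2.2
  have h3 : (n • X.ordAt hX hS t' y.2 : ℤ) = (f.1 ⟨y.1, y.2.1⟩).down := by
    rw [h1, h2, smul_eq_mul, mul_one]
  exact h3

end PreRibbon

end

noncomputable section

/-! ### The kernel of the order map -/

namespace PreRibbon

variable {S : Scheme.{u}} (X : PreRibbon S)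

theorem _root_.AlgebraicGeometry.Scheme.exists_isNilpotent_map {Y : Scheme.{u}} {V : Y.Opens} {s : Y}
    (hs : s ∈ V) (t : Finset Γ(Y, V)) (h : ∀ p ∈ t, IsNilpotent (Y.presheaf.germ V s hs p)) :
    ∃ (V' : Y.Opens) (hV' : V' ≤ V), s ∈ V' ∧
      ∀ p ∈ t, IsNilpotent (Y.presheaf.map (homOfLE hV').op p) := by
  classical
  induction t using Finset.induction_on with
  | empty => exact ⟨V, le_rfl, hs, by simp⟩
  | insert p t _ ih =>
    obtain ⟨V₁, hV₁, hs₁, h₁⟩ := ih fun q hq => h q (Finset.mem_insert_of_mem hq)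
    obtain ⟨n, hn⟩ := h p (Finset.mem_insert_self p t)
    have h0 : Y.presheaf.germ V s hs (p ^ n) = Y.presheaf.germ V s hs 0 := by
      rw [map_zero, map_pow, hn]
    obtain ⟨V₂, hs₂, i, j, hV₂⟩ := Y.presheaf.germ_eq s hs hs _ _ h0
    rw [map_zero, map_pow] at hV₂
    have hres : ∀ (W : Y.Opens) (hW : W ≤ V) (W' : Y.Opens) (hW' : W' ≤ W) (q : Γ(Y, V)),
        IsNilpotent (Y.presheaf.map (homOfLE hW).op q) →
          IsNilpotent (Y.presheaf.map (homOfLE (hW'.trans hW)).op q) := by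
      intro W hW W' hW' q hq
      have := hq.map (Y.presheaf.map (homOfLE hW').op).hom
      have h2 := ConcreteCategory.congr_hom
        (Y.presheaf.map_comp (homOfLE hW).op (homOfLE hW').op) q
      exact h2 ▸ this
    refine ⟨V₁ ⊓ V₂, inf_le_left.trans hV₁, ⟨hs₁, hs₂⟩, fun q hq => ?_⟩
    rcases Finset.mem_insert.1 hq with rfl | hq
    · exact hres V₂ i.le _ inf_le_right q ⟨n, hV₂⟩
    · exact hres V₁ hV₁ _ inf_le_left q (h₁ q hq)

/-- Only finitely many nilpotent germs of functions are involved, and each stays nilpotent on a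
neighbourhood. -/
theorem exists_forall_germ_mem_nilA {x : X.C} {U : X.C.Opens} (hx : x ∈ U) (a : X.A.sec U)
    (ha : X.A.germ hx a ∈ X.nilA x) :
    ∃ (W : X.C.Opens) (hW : W ≤ U), x ∈ W ∧ ∀ y (hy : y ∈ W), X.A.germ (hW hy) a ∈ X.nilA y := by
  obtain ⟨i, hi⟩ := X.exists_mem_smul_stalkSub _ ha
  obtain ⟨U', c, hx', V, hV, t, hca, ht, hc⟩ := X.exists_section_smul hi
  obtain ⟨V', hV', hxV', hnil⟩ := Scheme.exists_isNilpotent_map (Y := S) (V := V) (s := X.τ x) (hV hx') t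
    fun p hp => mem_nilradical.1 (ht p hp)
  obtain ⟨W, hWU, hWU', hxW, heq⟩ := X.A.exists_res_eq hx hx' a c hca.symm
  refine ⟨W ⊓ X.τ ⁻¹ᵁ V', inf_le_left.trans hWU, ⟨hxW, hxV'⟩, fun y hy => ?_⟩
  rw [← X.A.germ_res hWU hy.1, heq, X.A.germ_res hWU' hy.1]
  refine Submodule.smul_mono le_rfl le_top (hc y (hWU' hy.1) _ fun p hp => mem_nilradical.2 ?_)
  have := (hnil p hp).map (S.presheaf.germ V' (X.τ y) hy.2).hom
  exact Scheme.germ_map_homOfLE hV' hy.2 p ▸ this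

theorem exists_zeroUnits_germ_eq {x : X.C} {b b' : X.A.stalk x} (hb : b ∈ X.A.stalkFil 0 x)
    (hb' : b' ∈ X.A.stalkFil 0 x) (h : b * b' = 1) :
    ∃ (W : X.C.Opens) (hx : x ∈ W) (u : (X.A.sec W)ˣ), u ∈ X.A.zeroUnits W ∧
      X.A.germ hx (u : X.A.sec W) = b := by
  obtain ⟨U, hU, b, hbU, rfl⟩ := hb
  obtain ⟨V, hV, b', hbV, rfl⟩ := hb'
  have hxN : x ∈ U ⊓ V := ⟨hU, hV⟩
  obtain ⟨W, hW, hW', hxW, heq⟩ := X.A.exists_res_eq hxN hxN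
    (X.A.res inf_le_left b * X.A.res inf_le_right b') 1 (by
      rw [map_mul, X.A.germ_res _ hxN, X.A.germ_res _ hxN, h, map_one])
  rw [map_mul, map_one] at heq
  refine ⟨W, hxW, ⟨_, _, heq, (mul_comm _ _).trans heq⟩,
    ⟨X.A.fil_res 0 _ (X.A.fil_res 0 _ hbU), X.A.fil_res 0 _ (X.A.fil_res 0 _ hbV)⟩, ?_⟩
  exact (X.A.germ_res hW hxW _).trans (X.A.germ_res _ hxN _)

/-- The 𝒜_0-parts b and b' of a and a⁻¹ satisfy bb' - 1 ∈ 𝒩𝒜 ∩ 𝒜_0 = 𝒩𝒜_0, which is nilpotent;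
correcting b' by a unit of 1 + 𝒩𝒜_0 makes b invertible in 𝒜_0. -/
theorem exists_mul_eq_one_of_mem_sup_nilA (hX : X.IsRibbon) {x : X.C} (a : (X.A.stalk x)ˣ)
    (ha : (a : X.A.stalk x) ∈ X.stalkSub 0 x ⊔ X.nilA x)
    (ha' : ((a⁻¹ : (X.A.stalk x)ˣ) : X.A.stalk x) ∈ X.stalkSub 0 x ⊔ X.nilA x) :
    ∃ b ∈ X.A.stalkFil 0 x, ∃ b' ∈ X.A.stalkFil 0 x, b * b' = 1 ∧ (a : X.A.stalk x) - b ∈ X.nilA x := by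
  obtain ⟨b, hb, n, hn, hbn⟩ := Submodule.mem_sup.1 ha
  obtain ⟨b', hb', n', hn', hbn'⟩ := Submodule.mem_sup.1 ha'
  have hbb : b * b' ∈ X.A.stalkFil 0 x := (X.A.zeroStalk x).mul_mem hb hb'
  have h1 : b * b' - 1 ∈ X.nilA x := by
    have heq : b * b' - 1 = -(n * b') - n' * a := by
      have := a.mul_inv
      rw [← hbn', ← hbn] at this
      rw [← hbn]
      linear_combination this
    rw [heq]
    exact sub_mem (neg_mem (X.nilA_mul hn b')) (X.nilA_mul hn' _)
  have h2 : b * b' - 1 ∈ X.nilA₀ x := X.mem_smul_stalkSub hX _ 0 h1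
    (sub_mem hbb (X.A.stalkFiltration x).one_mem)
  obtain ⟨u, hu⟩ := (X.nilA₀_nilpotent h2).isUnit_one_add
  rw [add_sub_cancel] at hu
  have h3 := X.nilA₀_inv u (by rw [hu]; exact h2)
  have h4 : ((u⁻¹ : (X.A.stalk x)ˣ) : X.A.stalk x) ∈ X.A.stalkFil 0 x := by
    have := add_mem (X.nilA₀_le x h3) (X.A.stalkFiltration x).one_mem
    rwa [sub_add_cancel] at this
  refine ⟨b, hb, _, (X.A.zeroStalk x).mul_mem hb' h4, ?_, ?_⟩
  · rw [← mul_assoc, ← hu, Units.mul_inv]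
  · rw [← hbn, add_sub_cancel_left]; exact hn

variable (hX : X.IsRibbon) (hS : X.StandingAssumptions)

/-- The nilradical lies in the maximal ideal, so the hypotheses give orders at least 0 for both a
and a⁻¹. -/
theorem ordAt_eq_zero {U : X.C.Opens} (a : (X.A.sec U)ˣ)
    (ha : ∀ x (hx : x ∈ U), X.A.germ hx (a : X.A.sec U) ∈ X.stalkSub 0 x ⊔ X.nilA x)
    (ha' : ∀ x (hx : x ∈ U), X.A.germ hx ((a⁻¹ : (X.A.sec U)ˣ) : X.A.sec U) ∈
      X.stalkSub 0 x ⊔ X.nilA x) {x : X.C} (hx : x ∈ U) : X.ordAt hX hS a hx = 0 := by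
  have key : ∀ a : (X.A.sec U)ˣ,
      (∀ x (hx : x ∈ U), X.A.germ hx (a : X.A.sec U) ∈ X.stalkSub 0 x ⊔ X.nilA x) →
      0 ≤ X.ordAt hX hS a hx := by
    intro a ha
    have hη := X.fiberGen_mem hS rfl hx
    refine (X.germ_mem_of_le_ordAt hX hS a hx rfl hη).1
      (sup_le_sup_left (Submodule.smul_mono ?_ le_rfl) (X.stalkSub 0 _) (ha _ hη))
    exact nilradical_le_prime _
  have h1 := key a ha
  have h2 := key a⁻¹ ha'
  rw [X.ordAt_inv] at h2
  omega

theorem zeroUnits_ordAt {U : X.C.Opens} {a : (X.A.sec U)ˣ} (ha : a ∈ X.A.zeroUnits U) {x : X.C}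
    (hx : x ∈ U) : X.ordAt hX hS a hx = 0 :=
  X.ordAt_eq_zero hX hS a
    (fun _ hy => Submodule.mem_sup_left (X.A.germ_mem_stalkFil hy ha.1))
    (fun _ hy => Submodule.mem_sup_left (X.A.germ_mem_stalkFil hy ha.2)) hx

theorem oneAddNilSec_ordAt {U : X.C.Opens} {a : (X.A.sec U)ˣ} (ha : a ∈ X.oneAddNilSec U) {x : X.C}
    (hx : x ∈ U) : X.ordAt hX hS a hx = 0 := by
  have key : ∀ a ∈ X.oneAddNilSec U, ∀ y (hy : y ∈ U), X.A.germ hy (a : X.A.sec U) ∈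
      X.stalkSub 0 y ⊔ X.nilA y := by
    intro a ha y hy
    have := Submodule.add_mem_sup (X.A.stalkFiltration y).one_mem (ha y hy) (S := X.stalkSub 0 y)
    rwa [add_sub_cancel] at this
  exact X.ordAt_eq_zero hX hS a (key a ha) (key _ ((X.oneAddNilSec U).inv_mem ha)) hx

/-- Locally, a unit of order zero is the product of a unit of `𝒜_0` and of a section of
`1 + 𝒩_S 𝒜`. -/
theorem exists_res_eq_mul [IsLocallyNoetherian S] {U : X.C.Opens} (a : (X.A.sec U)ˣ)
    (ha : ∀ x (hx : x ∈ U), X.ordAt hX hS a hx = 0) {x : X.C} (hx : x ∈ U) :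
    ∃ (W : X.C.Opens) (h : W ≤ U), x ∈ W ∧ ∃ b ∈ X.A.zeroUnits W, ∃ c ∈ X.oneAddNilSec W,
      Units.map (X.A.res h).toMonoidHom a = b * c := by
  have key : ∀ a : (X.A.sec U)ˣ, (∀ x (hx : x ∈ U), X.ordAt hX hS a hx = 0) →
      X.A.germ hx (a : X.A.sec U) ∈ X.stalkSub 0 x ⊔ X.nilA x := fun a ha =>
    X.germ_mem_sup_nilA hX hS hx a fun s hη =>
      (X.germ_mem_of_le_ordAt hX hS a hη (X.τ_fiberGen hS s) hη).2 (ha _ hη).ge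
  obtain ⟨b, hb, b', hb', hbb, hab⟩ := X.exists_mul_eq_one_of_mem_sup_nilA hX
    (Units.map (X.A.germ hx).toMonoidHom a) (key a ha)
    (key a⁻¹ fun y hy => by rw [X.ordAt_inv, ha, neg_zero])
  obtain ⟨W₁, hx₁, u, hu, rfl⟩ := X.exists_zeroUnits_germ_eq hb hb' hbb
  have hxN : x ∈ U ⊓ W₁ := ⟨hx, hx₁⟩
  let u' : (X.A.sec (U ⊓ W₁))ˣ := Units.map (X.A.res inf_le_right).toMonoidHom u
  let c : (X.A.sec (U ⊓ W₁))ˣ := u'⁻¹ * Units.map (X.A.res inf_le_left).toMonoidHom a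
  have hc : X.A.germ hxN ((c : X.A.sec (U ⊓ W₁)) - 1) ∈ X.nilA x := by
    have h1 : (c : X.A.sec (U ⊓ W₁)) - 1 =
        (X.A.res inf_le_left (a : X.A.sec U) - X.A.res inf_le_right (u : X.A.sec W₁)) *
          ((u'⁻¹ : (X.A.sec (U ⊓ W₁))ˣ) : X.A.sec (U ⊓ W₁)) := by
      rw [sub_mul]
      refine congrArg₂ (· - ·) ((Units.val_mul _ _).trans (mul_comm _ _)) ?_
      exact u'.mul_inv.symm
    rw [h1, map_mul, map_sub, X.A.germ_res _ hxN, X.A.germ_res _ hxN]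
    exact X.nilA_mul hab _
  obtain ⟨W, hW, hxW, h⟩ := X.exists_forall_germ_mem_nilA hxN _ hc
  refine ⟨W, hW.trans inf_le_left, hxW, Units.map (X.A.res (hW.trans inf_le_right)).toMonoidHom u,
    ⟨X.A.fil_res 0 _ hu.1, X.A.fil_res 0 _ hu.2⟩, Units.map (X.A.res hW).toMonoidHom c, ?_, ?_⟩
  · intro y hy
    have := h y hy
    rw [map_sub, map_one] at this
    exact (X.A.germ_res hW hy (c : X.A.sec (U ⊓ W₁))).symm ▸ this
  · apply Units.ext
    have h1 : (u' : X.A.sec (U ⊓ W₁)) * (c : X.A.sec (U ⊓ W₁)) = X.A.res inf_le_left (a : X.A.sec U) := by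
      rw [← Units.val_mul, mul_inv_cancel_left]; rfl
    have h2 := congrArg (X.A.res hW) h1
    rw [map_mul, X.A.res_res] at h2
    refine h2.symm.trans ?_
    exact congrArg (· * _) (X.A.res_res _ hW (u : X.A.sec W₁))

variable [AlgebraicGeometry.IsNoetherian S]

theorem unitsZeroι_orderMap : X.unitsZeroι ≫ X.orderMap hX hS = 0 :=
  SheafAux.sheaf_hom_ext fun _ a => Subtype.ext (funext fun x => ULift.ext _ _
    (X.zeroUnits_ordAt hX hS a.2 x.2))

theorem oneAddNilι_orderMap : X.oneAddNilι ≫ X.orderMap hX hS = 0 :=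
  SheafAux.sheaf_hom_ext fun _ a => Subtype.ext (funext fun x => ULift.ext _ _
    (X.oneAddNilSec_ordAt hX hS a.2 x.2))

theorem orderMap_app_eq_zero_iff (U : X.C.Opens) (a : X.A.unitsSheaf.presheaf.obj (op U)) :
    (X.orderMap hX hS).hom.app (op U) a = 0 ↔
      ∀ x ∈ U, ∃ (W : X.C.Opens) (h : W ≤ U) (b : X.unitsZero.presheaf.obj (op W))
        (c : X.oneAddNil.presheaf.obj (op W)), x ∈ W ∧
        X.A.unitsSheaf.presheaf.map (homOfLE h).op a =
          X.unitsZeroι.hom.app (op W) b + X.oneAddNilι.hom.app (op W) c := by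
  constructor
  · intro ha x hx
    obtain ⟨W, hW, hxW, b, hb, c, hc, h⟩ := X.exists_res_eq_mul hX hS
      (Additive.toMul (a : Additive (X.A.sec U)ˣ))
      (fun y hy => congrArg ULift.down (congrFun (congrArg Subtype.val ha) ⟨y, hy⟩)) hx
    exact ⟨W, hW, ⟨Additive.ofMul b, hb⟩, ⟨Additive.ofMul c, hc⟩, hxW, congrArg Additive.ofMul h⟩
  · intro h
    refine TopCat.Presheaf.IsSheaf.section_ext (SheafAux.constZ X.C.carrier).2 fun x hx => ?_
    obtain ⟨W, hW, b, c, hxW, hbc⟩ := h x hx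
    refine ⟨W, hW, hxW, ?_⟩
    refine (SheafAux.hom_app_map (X.orderMap hX hS) hW a).symm.trans ?_
    rw [hbc, map_add, map_zero]
    have h1 := congrArg (fun k => k.hom.app (op W) b) (X.unitsZeroι_orderMap hX hS)
    have h2 := congrArg (fun k => k.hom.app (op W) c) (X.oneAddNilι_orderMap hX hS)
    exact (congrArg₂ (· + ·) h1 h2).trans (add_zero _)

/-- The two subgroups generate the kernel locally, so only their intersection remains to be
computed. -/
theorem isPushout_kernel_orderMap :
    ∃ (i₁ : X.unitsZero ⟶ kernel (X.orderMap hX hS)) (i₂ : X.oneAddNil ⟶ kernel (X.orderMap hX hS)),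
      i₁ ≫ kernel.ι _ = X.unitsZeroι ∧ i₂ ≫ kernel.ι _ = X.oneAddNilι ∧
      IsPushout X.oneAddNilZeroToUnitsZero X.oneAddNilZeroToOneAddNil i₁ i₂ := by
  have h₁ := kernel.lift_ι (X.orderMap hX hS) _ (X.unitsZeroι_orderMap hX hS)
  have h₂ := kernel.lift_ι (X.orderMap hX hS) _ (X.oneAddNilι_orderMap hX hS)
  refine ⟨_, _, h₁, h₂, SheafAux.isPushout_of_locally ?_ ?_ ?_⟩
  · rw [← cancel_mono (kernel.ι (X.orderMap hX hS)), Category.assoc, Category.assoc, h₁, h₂]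
    rfl
  · intro U s x hx
    obtain ⟨W, hW, b, c, hxW, h⟩ := (X.orderMap_app_eq_zero_iff hX hS U _).1
      (SheafAux.kernel_ι_app (X.orderMap hX hS) U s) x hx
    refine ⟨W, hW, b, c, hxW, SheafAux.app_injective_of_mono (kernel.ι (X.orderMap hX hS)) W ?_⟩
    rw [map_add, SheafAux.hom_app_map, h]
    exact congrArg₂ (· + ·) (congrArg (fun k => k.hom.app (op W) b) h₁)
      (congrArg (fun k => k.hom.app (op W) c) h₂)
  · intro U a b hab x hx
    have h := congrArg ((kernel.ι (X.orderMap hX hS)).hom.app (op U)) hab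
    have h' : a.1 = b.1 := (congrArg (fun k => k.hom.app (op U) a) h₁).symm.trans
      (h.trans (congrArg (fun k => k.hom.app (op U) b) h₂))
    -- On each stalk, a - 1 lies in 𝒩𝒜 ∩ 𝒜_0, which is 𝒩𝒜_0 by flatness.
    have hmem : a.1 ∈ (X.oneAddNilZeroSec U).toAddSubgroup := by
      intro y hy
      refine X.mem_smul_stalkSub hX _ 0 (h' ▸ b.2 y hy)
        (sub_mem (X.A.germ_mem_stalkFil hy a.2.1) (X.A.stalkFiltration y).one_mem)
    refine ⟨U, le_rfl, ⟨a.1, hmem⟩, hx, ?_, ?_⟩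
    · exact Subtype.ext (ConcreteCategory.congr_hom (X.A.unitsSheaf.presheaf.map_id (op U)) a.1).symm
    · exact Subtype.ext (h'.trans
        (ConcreteCategory.congr_hom (X.A.unitsSheaf.presheaf.map_id (op U)) b.1).symm)

end PreRibbon

end

noncomputable section

/-! ### Germs of sections of `𝒩_S ⊠ 𝒜` -/

namespace PreRibbon

open Topology

variable {S : Scheme.{u}} (X : PreRibbon S)

open Classical in
/-- An extension of a germ of a function on `S` to a neighbourhood. -/
def extS {x : X.C} (r : X.baseStalk x) (y : X.C) : X.baseStalk y :=
  if hy : X.τ y ∈ (S.presheaf.exists_germ_eq r).choose then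
    S.presheaf.germ _ (X.τ y) hy (S.presheaf.exists_germ_eq r).choose_spec.choose_spec.choose
  else 0

/-- The chosen extension agrees near x with any other representative of the germ, so algebraic
identities between germs hold eventually between their extensions. -/
theorem extS_eventually {x : X.C} {r : X.baseStalk x} {V : S.Opens} (hV : X.τ x ∈ V) (p : Γ(S, V))
    (h : S.presheaf.germ V (X.τ x) hV p = r) :
    ∀ᶠ y in 𝓝 x, ∀ hy : X.τ y ∈ V, X.extS r y = S.presheaf.germ V (X.τ y) hy p := by
  have hr := (S.presheaf.exists_germ_eq r).choose_spec.choose_spec.choose_spec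
  obtain ⟨W, hxW, i, j, hW⟩ := S.presheaf.germ_eq (X.τ x) _ hV _ p (hr.trans h.symm)
  filter_upwards [(X.τ ⁻¹ᵁ W).isOpen.mem_nhds hxW] with y hy hyV
  rw [extS, dif_pos (i.le hy)]
  refine (Scheme.germ_map_homOfLE i.le hy _).symm.trans (Eq.trans ?_ (Scheme.germ_map_homOfLE j.le hy p))
  exact congrArg _ hW

open Classical in
/-- An extension of a germ of a section of `𝒜` to a neighbourhood. -/
def extA {x : X.C} (a : X.A.stalk x) (y : X.C) : X.A.stalk y :=
  if hy : y ∈ (X.A.exists_germ x a).choose then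
    X.A.germ hy (X.A.exists_germ x a).choose_spec.choose_spec.choose
  else 0

theorem extA_eventually {x : X.C} {a : X.A.stalk x} {U : X.C.Opens} (hU : x ∈ U) (b : X.A.sec U)
    (h : X.A.germ hU b = a) : ∀ᶠ y in 𝓝 x, ∀ hy : y ∈ U, X.extA a y = X.A.germ hy b := by
  have hr := (X.A.exists_germ x a).choose_spec.choose_spec.choose_spec
  obtain ⟨W, i, j, hxW, hW⟩ := X.A.exists_res_eq _ hU _ b (hr.trans h.symm)
  filter_upwards [W.isOpen.mem_nhds hxW] with y hy hyV
  rw [extA, dif_pos (i hy)]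
  refine (X.A.germ_res i hy _).symm.trans (Eq.trans ?_ (X.A.germ_res j hy b))
  exact congrArg _ hW

open Classical in
/-- An extension of a germ of a section of `𝒩_S` to a neighbourhood. -/
def extN {x : X.C} (n : X.nilStalk x) (y : X.C) : X.nilStalk y :=
  if hy : X.extS (n : X.baseStalk x) y ∈ X.nilStalk y then ⟨_, hy⟩ else 0

theorem exists_isNilpotent_germ_eq {x : X.C} (n : X.nilStalk x) :
    ∃ (V : S.Opens) (hV : X.τ x ∈ V) (p : Γ(S, V)), IsNilpotent p ∧
      S.presheaf.germ V (X.τ x) hV p = n := by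
  obtain ⟨V, hV, p, hp⟩ := S.presheaf.exists_germ_eq (n : X.baseStalk x)
  obtain ⟨V', hV', hx, h⟩ := Scheme.exists_isNilpotent_map hV {p} (by
    intro q hq
    rw [Finset.mem_singleton.1 hq, hp]
    exact mem_nilradical.1 n.2)
  exact ⟨V', hx, _, h p (Finset.mem_singleton_self p), (Scheme.germ_map_homOfLE hV' hx p).trans hp⟩

theorem extN_eventually {x : X.C} (n : X.nilStalk x) :
    ∀ᶠ y in 𝓝 x, (X.extN n y : X.baseStalk y) = X.extS (n : X.baseStalk x) y := by
  obtain ⟨V, hV, p, hp, hpn⟩ := X.exists_isNilpotent_germ_eq n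
  filter_upwards [(X.τ ⁻¹ᵁ V).isOpen.mem_nhds hV, X.extS_eventually hV p hpn] with y hy h
  rw [extN, dif_pos]
  rw [h hy]
  exact mem_nilradical.2 (hp.map (S.presheaf.germ V (X.τ y) hy).hom)

theorem exists_common_germ_base {x : X.C} (r s : X.baseStalk x) :
    ∃ (V : S.Opens) (hV : X.τ x ∈ V) (p q : Γ(S, V)), S.presheaf.germ V (X.τ x) hV p = r ∧
      S.presheaf.germ V (X.τ x) hV q = s := by
  obtain ⟨V, hV, p, rfl⟩ := S.presheaf.exists_germ_eq r
  obtain ⟨W, hW, q, rfl⟩ := S.presheaf.exists_germ_eq s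
  have hx : X.τ x ∈ V ⊓ W := ⟨hV, hW⟩
  exact ⟨V ⊓ W, hx, _, _, Scheme.germ_map_homOfLE inf_le_left hx p,
    Scheme.germ_map_homOfLE inf_le_right hx q⟩

theorem extS_op {x : X.C} (r s : X.baseStalk x) :
    ∀ᶠ y in 𝓝 x, X.extS (r + s) y = X.extS r y + X.extS s y ∧
      X.extS (r * s) y = X.extS r y * X.extS s y := by
  obtain ⟨V, hV, p, q, hp, hq⟩ := X.exists_common_germ_base r s
  filter_upwards [(X.τ ⁻¹ᵁ V).isOpen.mem_nhds hV, X.extS_eventually hV p hp,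
    X.extS_eventually hV q hq,
    X.extS_eventually hV (p + q) (r := r + s) (by rw [map_add, hp, hq]),
    X.extS_eventually hV (p * q) (r := r * s) (by rw [map_mul, hp, hq])] with y hy h1 h2 h3 h4
  rw [h1 hy, h2 hy, h3 hy, h4 hy, map_add, map_mul]
  exact ⟨rfl, rfl⟩

theorem extA_add {x : X.C} (a b : X.A.stalk x) :
    ∀ᶠ y in 𝓝 x, X.extA (a + b) y = X.extA a y + X.extA b y := by
  obtain ⟨U, hU, a, rfl⟩ := X.A.exists_germ x a
  obtain ⟨V, hV, b, rfl⟩ := X.A.exists_germ x b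
  have hx : x ∈ U ⊓ V := ⟨hU, hV⟩
  filter_upwards [(U ⊓ V).isOpen.mem_nhds hx, X.extA_eventually hU a rfl,
    X.extA_eventually hV b rfl,
    X.extA_eventually hx (X.A.res inf_le_left a + X.A.res inf_le_right b)
      (by rw [map_add, X.A.germ_res _ hx, X.A.germ_res _ hx])] with y hy h1 h2 h3
  rw [h1 hy.1, h2 hy.2, h3 hy, map_add, X.A.germ_res _ hy, X.A.germ_res _ hy]

theorem extA_smul {x : X.C} (r : X.baseStalk x) (a : X.A.stalk x) :
    ∀ᶠ y in 𝓝 x, X.extA (r • a) y = X.extS r y • X.extA a y := by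
  obtain ⟨U, hU, a, rfl⟩ := X.A.exists_germ x a
  obtain ⟨V, hV, p, rfl⟩ := S.presheaf.exists_germ_eq r
  have hx : x ∈ U ⊓ X.τ ⁻¹ᵁ V := ⟨hU, hV⟩
  filter_upwards [(U ⊓ X.τ ⁻¹ᵁ V).isOpen.mem_nhds hx, X.extA_eventually hU a rfl,
    X.extS_eventually hV p rfl,
    X.extA_eventually hx (X.algMap inf_le_right p * X.A.res inf_le_left a)
      (by rw [map_mul, X.germ_algMap, X.A.germ_res _ hx, ← Algebra.smul_def])] with y hy h1 h2 h3
  rw [h1 hy.1, h2 hy.2, h3 hy, map_mul, X.germ_algMap, X.A.germ_res _ hy, ← Algebra.smul_def]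

/-- The stalk `𝒩_{S,s} ⊗ 𝒜_x` of `𝒩_S ⊠ 𝒜`. -/
abbrev boxStalk (x : X.C) : Type u := X.nilStalk x ⊗[X.baseStalk x] X.A.stalk x

/-- Families of elements of the stalks of `𝒩_S ⊠ 𝒜` that vanish near `x`. -/
def eventuallyZero (x : X.C) : AddSubgroup (∀ y, X.boxStalk y) where
  carrier := {f | ∀ᶠ y in 𝓝 x, f y = 0}
  zero_mem' := Filter.Eventually.of_forall fun _ => rfl
  add_mem' {f g} hf hg := by
    filter_upwards [hf, hg] with y h1 h2
    rw [Pi.add_apply, h1, h2, add_zero]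
  neg_mem' {f} hf := by
    filter_upwards [hf] with y h1
    rw [Pi.neg_apply, h1, neg_zero]

/-- Germs at `x` of families of elements of the stalks of `𝒩_S ⊠ 𝒜`. -/
def BoxGerms (x : X.C) : Type u := (∀ y, X.boxStalk y) ⧸ X.eventuallyZero x

instance (x : X.C) : AddCommGroup (X.BoxGerms x) :=
  inferInstanceAs (AddCommGroup ((∀ y, X.boxStalk y) ⧸ X.eventuallyZero x))

/-- The germ at `x` of a family of elements of the stalks of `𝒩_S ⊠ 𝒜`. -/
def germMk (x : X.C) : (∀ y, X.boxStalk y) →+ X.BoxGerms x :=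
  QuotientAddGroup.mk' _

theorem germMk_eq {x : X.C} {f g : ∀ y, X.boxStalk y} (h : ∀ᶠ y in 𝓝 x, f y = g y) :
    X.germMk x f = X.germMk x g := by
  refine QuotientAddGroup.eq.2 ?_
  filter_upwards [h] with y hy
  rw [Pi.add_apply, Pi.neg_apply, hy, neg_add_cancel]

/-- The map from the stalk `𝒩_{S,s} ⊗ 𝒜_x` to germs of families of elements of the stalks. -/
def boxGerm (x : X.C) : X.boxStalk x →+ X.BoxGerms x :=
  TensorProduct.liftAddHom
    (AddMonoidHom.mk' (fun n : X.nilStalk x => AddMonoidHom.mk'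
      (fun a : X.A.stalk x => X.germMk x fun y => X.extN n y ⊗ₜ[X.baseStalk y] X.extA a y)
      (fun a b => by
        refine Eq.trans (X.germMk_eq ?_) (map_add (X.germMk x) _ _)
        filter_upwards [X.extA_add a b] with y hy
        rw [hy, TensorProduct.tmul_add]
        rfl))
      (fun n m => by
        ext a
        refine Eq.trans (X.germMk_eq ?_) (map_add (X.germMk x) _ _)
        filter_upwards [X.extN_eventually n, X.extN_eventually m, X.extN_eventually (n + m),
          X.extS_op (n : X.baseStalk x) m] with y h1 h2 h3 h4
        have : X.extN (n + m) y = X.extN n y + X.extN m y := Subtype.ext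
          (h3.trans (h4.1.trans (congrArg₂ (· + ·) h1.symm h2.symm)))
        rw [this, TensorProduct.add_tmul]
        rfl))
    (fun r n a => by
      refine X.germMk_eq ?_
      filter_upwards [X.extN_eventually n, X.extN_eventually (r • n),
        X.extS_op r (n : X.baseStalk x), X.extA_smul r a] with y h1 h2 h3 h4
      have : X.extN (r • n) y = X.extS r y • X.extN n y := Subtype.ext
        (h2.trans (h3.2.trans (congrArg (X.extS r y * ·) h1.symm)))
      rw [this, h4, TensorProduct.smul_tmul])

theorem boxGerm_tmul {x : X.C} (n : X.nilStalk x) (a : X.A.stalk x) :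
    X.boxGerm x (n ⊗ₜ a) = X.germMk x fun y => X.extN n y ⊗ₜ[X.baseStalk y] X.extA a y := rfl

open Classical in
/-- The extension by zero of a family of elements of the stalks. -/
def extZero {U : X.C.Opens} (t : ∀ y : U, X.boxStalk y.1) (y : X.C) : X.boxStalk y :=
  if hy : y ∈ U then t ⟨y, hy⟩ else 0

theorem extZero_of_mem {U : X.C.Opens} (t : ∀ y : U, X.boxStalk y.1) {y : X.C} (hy : y ∈ U) :
    X.extZero t y = t ⟨y, hy⟩ := dif_pos hy

/-- The value of a section at x determines the section near x. This is not formal, as sections are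
families of tensors: it works because extending germs is well defined on the tensor product at x. -/
theorem boxGerm_eq {U : X.C.Opens} (t : ∀ y : U, X.boxStalk y.1) (ht : t ∈ X.famA.boxPre U)
    {x : X.C} (hx : x ∈ U) : X.boxGerm x (t ⟨x, hx⟩) = X.germMk x (X.extZero t) := by
  induction ht using AddSubgroup.closure_induction with
  | mem t ht =>
    obtain ⟨V, h, n, hn, m, ⟨a, ha⟩, rfl⟩ := ht
    let n' : X.nilStalk x := ⟨S.presheaf.germ V (X.τ x) (h hx) n,
      mem_nilradical.2 (hn.map (S.presheaf.germ V _ _).hom)⟩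
    refine (X.boxGerm_tmul n' (m ⟨x, hx⟩)).trans (X.germMk_eq ?_)
    filter_upwards [U.isOpen.mem_nhds hx, X.extS_eventually (h hx) n rfl,
      X.extA_eventually hx a (ha ⟨x, hx⟩).symm, X.extN_eventually n'] with y hy h1 h2 h3
    refine Eq.trans ?_ (X.extZero_of_mem _ hy).symm
    exact congrArg₂ (fun (p : X.nilStalk y) (q : X.A.stalk y) => p ⊗ₜ[X.baseStalk y] q)
      (Subtype.ext (h3.trans (h1 (h hy)))) ((h2 hy).trans (ha ⟨y, hy⟩).symm)
  | zero =>
    refine (map_zero (X.boxGerm x)).trans ((map_zero (X.germMk x)).symm.trans (X.germMk_eq ?_))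
    refine Filter.Eventually.of_forall fun y => ?_
    rw [extZero]; split_ifs <;> rfl
  | add s t _ _ hs ht =>
    refine (map_add (X.boxGerm x) _ _).trans ((congrArg₂ (· + ·) hs ht).trans
      ((map_add (X.germMk x) _ _).symm.trans (X.germMk_eq ?_)))
    refine Filter.Eventually.of_forall fun y => ?_
    rw [Pi.add_apply, extZero, extZero, extZero]
    split_ifs
    · rfl
    · exact add_zero _
  | neg s _ hs =>
    refine (map_neg (X.boxGerm x) _).trans ((congrArg (- ·) hs).trans
      ((map_neg (X.germMk x) _).symm.trans (X.germMk_eq ?_)))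
    refine Filter.Eventually.of_forall fun y => ?_
    rw [Pi.neg_apply, extZero, extZero]
    split_ifs
    · rfl
    · exact neg_zero

/-- Two sections of `𝒩_S ⊠ 𝒜` with the same germ at `x` agree near `x`. -/
theorem exists_box_res_eq {U : X.C.Opens} (s t : X.famA.box.presheaf.obj (op U)) {x : X.C}
    (hx : x ∈ U) (h : s.1 ⟨x, hx⟩ = t.1 ⟨x, hx⟩) :
    ∃ (W : X.C.Opens) (hW : W ≤ U), x ∈ W ∧ X.famA.box.presheaf.map (homOfLE hW).op s =
      X.famA.box.presheaf.map (homOfLE hW).op t := by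
  obtain ⟨V, hV, hxV, hst⟩ := (s - t).2 ⟨x, hx⟩
  -- The difference is locally a finite sum of families n ⊗ a and vanishes at x, so its germ
  -- vanishes.
  have h0 : X.boxGerm x ((s - t).1 ⟨x, hx⟩) = 0 := by
    exact (congrArg (X.boxGerm x) (sub_eq_zero.2 h)).trans (map_zero (X.boxGerm x))
  have h1 := (QuotientAddGroup.eq_zero_iff _).1 ((X.boxGerm_eq _ hst hxV).symm.trans h0)
  obtain ⟨W, hW, hWo, hxW⟩ := eventually_nhds_iff.1 h1
  refine ⟨V ⊓ ⟨W, hWo⟩, inf_le_left.trans hV, ⟨hxV, hxW⟩, Subtype.ext (funext fun y => ?_)⟩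
  exact sub_eq_zero.1 ((X.extZero_of_mem _ y.2.1).symm.trans (hW y.1 y.2.2))

/-- Every element of a stalk of `𝒩_S ⊠ M` is the germ of a section. -/
theorem ModuleFamily.exists_box_germ {X : PreRibbon S} (𝓜 : X.ModuleFamily) {x : X.C}
    (hM : ∀ m : 𝓜.M x, ∃ (U : X.C.Opens) (hx : x ∈ U), ∃ f ∈ 𝓜.secs U, f ⟨x, hx⟩ = m)
    (t : 𝓜.boxStalk x) :
    ∃ (W : X.C.Opens) (hx : x ∈ W) (f : 𝓜.box.presheaf.obj (op W)), f.1 ⟨x, hx⟩ = t := by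
  induction t using TensorProduct.induction_on with
  | zero => exact ⟨⊤, trivial, 0, rfl⟩
  | tmul n m =>
    obtain ⟨V, hV, p, hp, hpn⟩ := X.exists_isNilpotent_germ_eq n
    obtain ⟨U, hU, f, hf, rfl⟩ := hM m
    have hx : x ∈ U ⊓ X.τ ⁻¹ᵁ V := ⟨hU, hV⟩
    refine ⟨_, hx, 𝓜.boxMk inf_le_right p hp _ (𝓜.res inf_le_left f hf), ?_⟩
    exact congrArg (fun p : X.nilStalk x => p ⊗ₜ[X.baseStalk x] f ⟨x, hU⟩) (Subtype.ext hpn)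
  | add s t hs ht =>
    obtain ⟨U, hU, f, rfl⟩ := hs
    obtain ⟨V, hV, g, rfl⟩ := ht
    exact ⟨U ⊓ V, ⟨hU, hV⟩, 𝓜.box.presheaf.map (homOfLE inf_le_left).op f +
      𝓜.box.presheaf.map (homOfLE inf_le_right).op g, rfl⟩

theorem famA_exists_secs {x : X.C} (m : X.famA.M x) :
    ∃ (U : X.C.Opens) (hx : x ∈ U), ∃ f ∈ X.famA.secs U, f ⟨x, hx⟩ = m := by
  obtain ⟨U, hx, a, rfl⟩ := X.A.exists_germ x m
  exact ⟨U, hx, fun y => X.A.germ y.2 a, ⟨a, fun _ => rfl⟩, rfl⟩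

theorem famA₀_exists_secs {x : X.C} (m : X.famA₀.M x) :
    ∃ (U : X.C.Opens) (hx : x ∈ U), ∃ f ∈ X.famA₀.secs U, f ⟨x, hx⟩ = m := by
  obtain ⟨m, U, hx, a, ha, rfl⟩ := m
  exact ⟨U, hx, fun y => ⟨X.A.germ y.2 a, X.A.germ_mem_stalkFil y.2 ha⟩, ⟨a, ha, fun _ => rfl⟩, rfl⟩

/-! ### The sequence `𝒩_S ⊠ 𝒜_0 → 𝒩_S ⊠ 𝒜 → 𝒩_S ⊠ (𝒜 / 𝒜_0)` -/

theorem boxIncl_boxProj : X.boxIncl ≫ X.boxProj = 0 :=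
  SheafAux.sheaf_hom_ext fun U t => Subtype.ext (funext fun x => by
    refine (LinearMap.lTensor_comp_apply (X.nilStalk x.1) (X.stalkSub 0 x.1).mkQ
      (X.stalkSub 0 x.1).subtype (t.1 x)).symm.trans ?_
    have : (X.stalkSub 0 x.1).mkQ ∘ₗ (X.stalkSub 0 x.1).subtype = 0 := by
      ext a
      exact (Submodule.Quotient.mk_eq_zero _).2 a.2
    rw [this, LinearMap.lTensor_zero]
    rfl)

/-- A section of `𝒩_S ⊠ 𝒜` whose germ at `x` comes from `𝒩_{S,s} ⊗ 𝒜_{0,x}` comes, near `x`, from a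
section of `𝒩_S ⊠ 𝒜_0`. -/
theorem exists_boxIncl_eq {U : X.C.Opens} (t : X.famA.box.presheaf.obj (op U)) {x : X.C} (hx : x ∈ U)
    (h : ∃ τ₀ : X.nilStalk x ⊗[X.baseStalk x] X.stalkSub 0 x,
      (X.stalkSub 0 x).subtype.lTensor (X.nilStalk x) τ₀ = t.1 ⟨x, hx⟩) :
    ∃ (W : X.C.Opens) (hW : W ≤ U) (s : X.famA₀.box.presheaf.obj (op W)), x ∈ W ∧
      X.boxIncl.hom.app (op W) s = X.famA.box.presheaf.map (homOfLE hW).op t := by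
  obtain ⟨τ₀, hτ⟩ := h
  obtain ⟨V, hV, f, hf⟩ := X.famA₀.exists_box_germ X.famA₀_exists_secs τ₀
  have hxN : x ∈ U ⊓ V := ⟨hx, hV⟩
  obtain ⟨W, hW, hxW, h⟩ := X.exists_box_res_eq
    (X.boxIncl.hom.app (op (U ⊓ V)) (X.famA₀.box.presheaf.map (homOfLE inf_le_right).op f))
    (X.famA.box.presheaf.map (homOfLE inf_le_left).op t) hxN
    ((congrArg ((X.stalkSub 0 x).subtype.lTensor (X.nilStalk x)) hf).trans hτ)
  refine ⟨W, hW.trans inf_le_left, X.famA₀.box.presheaf.map (homOfLE (hW.trans inf_le_right)).op f,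
    hxW, ?_⟩
  exact h

instance epi_boxProj : Epi X.boxProj := by
  refine SheafAux.epi_of_locally_surjective _ fun U s x hx => ?_
  obtain ⟨V, hV, hxV, hs⟩ := s.2 ⟨x, hx⟩
  have key : ∀ f ∈ X.famQuot.boxPre V, ∃ g : X.famA.box.presheaf.obj (op V),
      (X.boxProj.hom.app (op V) g).1 = f := by
    intro f hf
    induction hf using AddSubgroup.closure_induction with
    | mem f hf =>
      obtain ⟨W, h, n, hn, m, ⟨a, ha⟩, rfl⟩ := hf
      exact ⟨X.tmulA h n hn a, funext fun y =>
        congrArg (fun q : X.famQuot.M y.1 => (⟨_, mem_nilradical.2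
          (hn.map (S.presheaf.germ W (X.τ y.1) (h y.2)).hom)⟩ : X.nilStalk y.1) ⊗ₜ[X.baseStalk y.1] q)
          (ha y).symm⟩
    | zero => exact ⟨0, congrArg Subtype.val (map_zero (X.boxProj.hom.app (op V)).hom)⟩
    | add f g _ _ hf hg =>
      obtain ⟨f, rfl⟩ := hf
      obtain ⟨g, rfl⟩ := hg
      exact ⟨f + g, congrArg Subtype.val (map_add (X.boxProj.hom.app (op V)).hom f g)⟩
    | neg f _ hf =>
      obtain ⟨f, rfl⟩ := hf
      exact ⟨-f, congrArg Subtype.val (map_neg (X.boxProj.hom.app (op V)).hom f)⟩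
  obtain ⟨g, hg⟩ := key _ hs
  exact ⟨V, hV, g, hxV, Subtype.ext hg⟩

end PreRibbon

end

noncomputable section

/-! ### The exponential map -/

theorem nilExp_eq_exp {R : Type u} [CommRing R] [Algebra ℚ R] (z : R) :
    nilExp z = IsNilpotent.exp z := by
  refine Finset.sum_congr rfl fun k _ => ?_
  have hk : (k.factorial : ℚ) ≠ 0 := Nat.cast_ne_zero.2 k.factorial_ne_zero
  have h : algebraMap ℚ R (k.factorial : ℚ)⁻¹ * (k.factorial : R) = 1 := by
    rw [← map_natCast (algebraMap ℚ R), ← map_mul, inv_mul_cancel₀ hk, map_one]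
  have h' := (mul_comm _ _).trans h
  rw [left_inv_eq_right_inv (Ring.inverse_mul_cancel _ (IsUnit.of_mul_eq_one _ h')) h',
    Algebra.smul_def]

namespace PreRibbon

variable {S : Scheme.{u}} (X : PreRibbon S)

theorem nilA_nilpotent {x : X.C} {p : X.A.stalk x} (hp : p ∈ X.nilA x) : IsNilpotent p := by
  rw [← mem_nilradical]
  refine Submodule.smul_induction_on hp (fun r hr n _ => ?_) (fun _ _ h1 h2 => ?_)
  · rw [Algebra.smul_def]
    exact Ideal.mul_mem_right _ _ (mem_nilradical.2 ((mem_nilradical.1 hr).map _))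
  · exact Ideal.add_mem _ h1 h2

/-- The product map `𝒩_{S,s} ⊗ 𝒜_x → 𝒜_x`. -/
def boxMul (x : X.C) : X.boxStalk x →ₗ[X.baseStalk x] X.A.stalk x :=
  idealMul (X.nilStalk x) (X.A.stalk x)

theorem boxMul_mem {x : X.C} (t : X.boxStalk x) : X.boxMul x t ∈ X.nilA x := idealMul_mem _ t

theorem boxMul_nilpotent {x : X.C} (t : X.boxStalk x) : IsNilpotent (X.boxMul x t) :=
  X.nilA_nilpotent (X.boxMul_mem t)

theorem boxMul_pureFun {V : S.Opens} {U : X.C.Opens} (h : U ≤ X.τ ⁻¹ᵁ V) (n : Γ(S, V))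
    (hn : IsNilpotent n) (a : X.A.sec U) {m : ∀ x : U, X.famA.M x}
    (hm : ∀ x : U, m x = X.A.germ x.2 a) (x : U) :
    X.boxMul x.1 (X.famA.pureFun h n hn m x) = X.A.germ x.2 (X.algMap h n * a) := by
  rw [map_mul, X.germ_algMap h x.2, ← Algebra.smul_def]
  exact (idealMul_tmul _ _ _).trans (congrArg _ (hm x))

/-- Locally, products of sections of `𝒩_S ⊠ 𝒜` are nilpotent sections of `𝒜`. -/
theorem exists_boxMul_section {U : X.C.Opens} (t : ∀ x : U, X.boxStalk x.1)
    (ht : t ∈ X.famA.boxPre U) :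
    ∃ z : X.A.sec U, IsNilpotent z ∧ ∀ x : U, X.A.germ x.2 z = X.boxMul x.1 (t x) := by
  induction ht using AddSubgroup.closure_induction with
  | mem t ht =>
    obtain ⟨V, h, n, hn, m, ⟨a, ha⟩, rfl⟩ := ht
    exact ⟨X.algMap h n * a, (Commute.all _ _).isNilpotent_mul_right (hn.map _), fun x =>
      (X.boxMul_pureFun h n hn a ha x).symm⟩
  | zero => exact ⟨0, IsNilpotent.zero, fun x => (map_zero _).trans (map_zero (X.boxMul x.1)).symm⟩
  | add s t _ _ hs ht =>
    obtain ⟨y, hy, h⟩ := hs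
    obtain ⟨z, hz, h'⟩ := ht
    exact ⟨y + z, (Commute.all _ _).isNilpotent_add hy hz, fun x =>
      (map_add _ y z).trans ((congrArg₂ (· + ·) (h x) (h' x)).trans
        (map_add (X.boxMul x.1) (s x) (t x)).symm)⟩
  | neg s _ hs =>
    obtain ⟨y, hy, h⟩ := hs
    exact ⟨-y, hy.neg, fun x => (map_neg _ y).trans ((congrArg (- ·) (h x)).trans
      (map_neg (X.boxMul x.1) (s x)).symm)⟩

variable [∀ x, Algebra ℚ (X.A.stalk x)]

/-- The exponential of the product of an element of `𝒩_{S,s} ⊗ 𝒜_x`. -/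
def boxExp {x : X.C} (t : X.boxStalk x) : X.A.stalk x := IsNilpotent.exp (X.boxMul x t)

theorem boxExp_add {x : X.C} (s t : X.boxStalk x) : X.boxExp (s + t) = X.boxExp s * X.boxExp t :=
  (congrArg IsNilpotent.exp (map_add (X.boxMul x) s t)).trans
    (IsNilpotent.exp_add_of_commute (Commute.all _ _) (X.boxMul_nilpotent s) (X.boxMul_nilpotent t))

theorem boxExp_zero {x : X.C} : X.boxExp (0 : X.boxStalk x) = 1 :=
  (congrArg IsNilpotent.exp (map_zero (X.boxMul x))).trans IsNilpotent.exp_zero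

theorem boxExp_sub_one_mem {x : X.C} (t : X.boxStalk x) : X.boxExp t - 1 ∈ X.nilA x :=
  IsNilpotent.exp_sub_one_mem (X.nilA x).toAddSubgroup (fun _ ha b _ => X.nilA_mul ha b)
    (fun q a ha => by
      rw [Algebra.smul_def, mul_comm]
      exact X.nilA_mul ha _) (X.boxMul_nilpotent t) (X.boxMul_mem t)

/-- Surjectivity of the exponential on stalks: solve exp(z) = 1 + v inside 𝒩𝒜_x and lift z to a
tensor. -/
theorem exists_boxExp_eq {x : X.C} {v : X.A.stalk x} (hv : v ∈ X.nilA x) :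
    ∃ t : X.boxStalk x, X.boxExp t = 1 + v := by
  obtain ⟨z, hz, -, h⟩ := IsNilpotent.exists_exp_eq_one_add (X.nilA x).toAddSubgroup
    (fun _ ha b _ => X.nilA_mul ha b) (fun q a ha => by
      rw [Algebra.smul_def, mul_comm]
      exact X.nilA_mul ha _) (X.nilA_nilpotent hv) hv
  obtain ⟨t, ht⟩ := exists_idealMul_eq (X.nilStalk x) (⊤ : Submodule (X.baseStalk x) (X.A.stalk x)) hz
  refine ⟨(⊤ : Submodule (X.baseStalk x) (X.A.stalk x)).subtype.lTensor (X.nilStalk x) t, ?_⟩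
  rw [boxExp, boxMul, idealMul_lTensor, ← h, ← ht]
  rfl

section Zero

variable [∀ x, Algebra ℚ (X.baseStalk x)]

/-- A ring admits at most one homomorphism from ℚ, so rational scalars act on 𝒜_x through 𝒪_S and
preserve 𝒜_0. -/
theorem rat_smul_mem_nilA₀ {x : X.C} (q : ℚ) {a : X.A.stalk x} (ha : a ∈ X.nilA₀ x) :
    q • a ∈ X.nilA₀ x := by
  have h : algebraMap ℚ (X.A.stalk x) q = X.stalkAlg x (algebraMap ℚ (X.baseStalk x) q) :=
    congrArg (fun f : ℚ →+* X.A.stalk x => f q)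
      (Subsingleton.elim _ ((X.stalkAlg x).comp (algebraMap ℚ (X.baseStalk x))))
  rw [Algebra.smul_def, mul_comm, h]
  exact X.nilA₀_mul ha (X.stalkAlg_mem x _)

theorem boxExp_sub_one_mem_nilA₀ {x : X.C} (t : X.nilStalk x ⊗[X.baseStalk x] X.stalkSub 0 x) :
    X.boxExp ((X.stalkSub 0 x).subtype.lTensor (X.nilStalk x) t) - 1 ∈ X.nilA₀ x := by
  refine IsNilpotent.exp_sub_one_mem (X.nilA₀ x).toAddSubgroup
    (fun _ ha b hb => X.nilA₀_mul ha (X.nilA₀_le x hb)) (fun q a ha => X.rat_smul_mem_nilA₀ q ha)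
    (X.boxMul_nilpotent _) ?_
  rw [boxMul, idealMul_lTensor]
  exact idealMul_mem_smul _ _ t

/-- From exp(t) - 1 ∈ 𝒩𝒜 ∩ 𝒜_0 = 𝒩𝒜_0 the product of t is recovered in 𝒩𝒜_0. Flatness of the graded
pieces then lifts the tensor itself, although 𝒩 ⊗ 𝒜 → 𝒜 is not known to be injective. -/
theorem exists_lTensor_eq_of_boxExp_mem (hX : X.IsRibbon) {x : X.C} (t : X.boxStalk x)
    (h : X.boxExp t ∈ X.A.stalkFil 0 x) :
    ∃ t₀ : X.nilStalk x ⊗[X.baseStalk x] X.stalkSub 0 x,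
      (X.stalkSub 0 x).subtype.lTensor (X.nilStalk x) t₀ = t := by
  have h1 : X.boxExp t - 1 ∈ X.nilA₀ x := X.mem_smul_stalkSub hX _ 0 (X.boxExp_sub_one_mem t)
    (sub_mem h (X.A.stalkFiltration x).one_mem)
  have h2 : X.boxMul x t ∈ X.nilA₀ x :=
    IsNilpotent.mem_of_exp_sub_one_mem (X.nilA₀ x).toAddSubgroup
      (fun _ ha b hb => X.nilA₀_mul ha (X.nilA₀_le x hb)) (fun q a ha => X.rat_smul_mem_nilA₀ q ha)
      (X.boxMul_nilpotent t) h1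
  exact exists_lTensor_subtype (fun i => X.stalkSub i x) (X.stalkSub_anti x)
    (X.A.stalkFiltration x).exhaust (fun i => hX.gr_flat i x) _ t 0 (X.nilA₀_le x h2)

end Zero

variable [∀ U, Algebra ℚ (X.A.sec U)]

/-- The stalkwise exponentials come locally from exponentials of nilpotent sections and glue. The
exponential of -t provides the inverse. -/
theorem exists_boxExp_unit {U : X.C.Opens} (t : X.famA.box.presheaf.obj (op U)) :
    ∃ u : (X.A.sec U)ˣ, ∀ x : U, X.A.germ x.2 (u : X.A.sec U) = X.boxExp (t.1 x) := by
  have key : ∀ t : X.famA.box.presheaf.obj (op U), ∃ a : X.A.sec U, ∀ x : U,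
      X.A.germ x.2 a = X.boxExp (t.1 x) := by
    intro t
    refine X.A.exists_section (fun x : U => X.boxExp (t.1 x)) fun x => ?_
    obtain ⟨V, hV, hxV, ht⟩ := t.2 x
    obtain ⟨z, hz, h⟩ := X.exists_boxMul_section _ ht
    exact ⟨V, hV, IsNilpotent.exp z, hxV, fun y hy =>
      (IsNilpotent.map_exp hz (X.A.germ hy)).trans (congrArg IsNilpotent.exp (h ⟨y, hy⟩))⟩
  obtain ⟨a, ha⟩ := key t
  obtain ⟨b, hb⟩ := key (-t)
  have hab : a * b = 1 := X.A.sec_ext fun x hx => by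
    rw [map_mul, map_one]
    refine (congrArg₂ (· * ·) (ha ⟨x, hx⟩) (hb ⟨x, hx⟩)).trans ?_
    refine (X.boxExp_add _ _).symm.trans ?_
    exact (congrArg X.boxExp (add_neg_cancel (t.1 ⟨x, hx⟩))).trans X.boxExp_zero
  exact ⟨⟨a, b, hab, (mul_comm _ _).trans hab⟩, ha⟩

/-- The exponential of a section of `𝒩_S ⊠ 𝒜`. -/
def boxExpUnit {U : X.C.Opens} (t : X.famA.box.presheaf.obj (op U)) : (X.A.sec U)ˣ :=
  (X.exists_boxExp_unit t).choose

theorem germ_boxExpUnit {U : X.C.Opens} (t : X.famA.box.presheaf.obj (op U)) {x : X.C} (hx : x ∈ U) :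
    X.A.germ hx (X.boxExpUnit t : X.A.sec U) = X.boxExp (t.1 ⟨x, hx⟩) :=
  (X.exists_boxExp_unit t).choose_spec ⟨x, hx⟩

theorem boxExpUnit_add {U : X.C.Opens} (s t : X.famA.box.presheaf.obj (op U)) :
    X.boxExpUnit (s + t) = X.boxExpUnit s * X.boxExpUnit t :=
  Units.ext (X.A.sec_ext fun x hx => by
    rw [X.germ_boxExpUnit, Units.val_mul, map_mul, X.germ_boxExpUnit, X.germ_boxExpUnit]
    exact X.boxExp_add _ _)

/-- The exponential map `𝒩_S ⊠ 𝒜 → 𝒜^*`. -/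
def expMap : X.famA.box ⟶ X.A.unitsSheaf :=
  ⟨{ app := fun U => AddCommGrpCat.ofHom (AddMonoidHom.mk'
      (fun t => (Additive.ofMul (X.boxExpUnit t) : Additive (X.A.sec U.unop)ˣ)) fun s t =>
        congrArg Additive.ofMul (X.boxExpUnit_add s t))
     naturality := fun U V i => by
      ext t
      refine congrArg Additive.ofMul (Units.ext (X.A.sec_ext fun x hx => ?_))
      refine (X.germ_boxExpUnit _ hx).trans ?_
      exact ((X.A.germ_res i.unop.le hx _).trans (X.germ_boxExpUnit t (i.unop.le hx))).symm }⟩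

theorem unitVal_expMap_tmulA {V : S.Opens} {U : X.C.Opens} (h : U ≤ X.τ ⁻¹ᵁ V) (n : Γ(S, V))
    (hn : IsNilpotent n) (a : X.A.sec U) :
    X.A.unitVal (X.expMap.hom.app (op U) (X.tmulA h n hn a)) = nilExp (X.algMap h n * a) := by
  rw [nilExp_eq_exp]
  refine X.A.sec_ext fun x hx => ?_
  refine (X.germ_boxExpUnit _ hx).trans ?_
  have hnil : IsNilpotent (X.algMap h n * a) :=
    (Commute.all _ _).isNilpotent_mul_right (hn.map (X.algMap h))
  rw [IsNilpotent.map_exp hnil]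
  exact congrArg IsNilpotent.exp (X.boxMul_pureFun h n hn a (fun _ => rfl) ⟨x, hx⟩)

theorem boxExpUnit_mem {U : X.C.Opens} (t : X.famA.box.presheaf.obj (op U)) :
    X.boxExpUnit t ∈ X.oneAddNilSec U := fun x hx => by
  rw [X.germ_boxExpUnit]
  exact X.boxExp_sub_one_mem _

variable [∀ x, Algebra ℚ (X.baseStalk x)]

theorem boxExpUnit_boxIncl_mem {U : X.C.Opens} (t : X.famA₀.box.presheaf.obj (op U)) :
    Additive.ofMul (X.boxExpUnit (X.boxIncl.hom.app (op U) t)) ∈ (X.A.zeroUnits U).toAddSubgroup :=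
  X.oneAddNilZeroSec_le U fun x hx =>
    Set.mem_of_eq_of_mem (congrArg (· - 1) (X.germ_boxExpUnit (X.boxIncl.hom.app (op U) t) hx))
      (X.boxExp_sub_one_mem_nilA₀ (t.1 ⟨x, hx⟩))

/-- The exponential map on sections of `𝒩_S ⊠ 𝒜_0`. -/
def expZeroHom (U : (Opens X.C.carrier)ᵒᵖ) :
    X.famA₀.box.presheaf.obj U →+ X.unitsZero.presheaf.obj U :=
  AddMonoidHom.mk' (fun t => (⟨Additive.ofMul (X.boxExpUnit (X.boxIncl.hom.app U t)),
    X.boxExpUnit_boxIncl_mem t⟩ : X.unitsZero.presheaf.obj U)) fun s t =>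
      Subtype.ext (congrArg Additive.ofMul ((congrArg X.boxExpUnit
        (map_add (X.boxIncl.hom.app U).hom s t)).trans (X.boxExpUnit_add _ _)))

/-- The exponential map `𝒩_S ⊠ 𝒜_0 → 𝒜_0^*`. -/
def expMapZero : X.famA₀.box ⟶ X.unitsZero :=
  ⟨{ app := fun U => ConcreteCategory.ofHom (X := X.famA₀.box.presheaf.obj U)
      (Y := X.unitsZero.presheaf.obj U) (X.expZeroHom U)
     naturality := fun U V i => by
      ext t
      refine Subtype.ext ?_
      exact ConcreteCategory.congr_hom ((X.boxIncl ≫ X.expMap).hom.naturality i) t }⟩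

end PreRibbon

end

noncomputable section

/-! ### The exact sequences -/

namespace PreRibbon

variable {S : Scheme.{u}} (X : PreRibbon S)

section Zero

variable (hX : X.IsRibbon) (hS : X.StandingAssumptions) [AlgebraicGeometry.IsNoetherian S]

/-- The inclusion `𝒜_0^* → Ker(ord)`. -/
def zeroKer : X.unitsZero ⟶ kernel (X.orderMap hX hS) :=
  kernel.lift _ X.unitsZeroι (X.unitsZeroι_orderMap hX hS)

theorem zeroKer_ι : X.zeroKer hX hS ≫ kernel.ι _ = X.unitsZeroι := kernel.lift_ι _ _ _

instance mono_zeroKer : Mono (X.zeroKer hX hS) := by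
  have : Mono X.unitsZeroι := SheafAux.mono_of_app_injective _ fun U => Subtype.val_injective
  rw [← X.zeroKer_ι hX hS] at this
  exact mono_of_mono _ (kernel.ι _)

theorem zeroKer_app_ι {U : X.C.Opens} (b : X.unitsZero.presheaf.obj (op U)) :
    (kernel.ι (X.orderMap hX hS)).hom.app (op U) ((X.zeroKer hX hS).hom.app (op U) b) =
      X.unitsZeroι.hom.app (op U) b :=
  congrArg (fun k => k.hom.app (op U) b) (X.zeroKer_ι hX hS)

end Zero

variable [∀ x, Algebra ℚ (X.A.stalk x)] [∀ U, Algebra ℚ (X.A.sec U)]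

/-- Locally, every section of `1 + 𝒩_S 𝒜` is an exponential. -/
theorem exists_expMap_eq {U : X.C.Opens} (c : X.A.unitsSheaf.presheaf.obj (op U))
    (hc : c ∈ (X.oneAddNilSec U).toAddSubgroup) {x : X.C} (hx : x ∈ U) :
    ∃ (W : X.C.Opens) (hW : W ≤ U) (t : X.famA.box.presheaf.obj (op W)), x ∈ W ∧
      X.expMap.hom.app (op W) t = X.A.unitsSheaf.presheaf.map (homOfLE hW).op c := by
  obtain ⟨τ, hτ⟩ := X.exists_boxExp_eq (hc x hx)
  obtain ⟨V, hV, f, rfl⟩ := X.famA.exists_box_germ X.famA_exists_secs τ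
  obtain ⟨W, hWV, hWU, hxW, h⟩ := X.A.exists_res_eq hV hx (X.boxExpUnit f : X.A.sec V)
    (X.A.unitVal c) ((X.germ_boxExpUnit f hV).trans (hτ.trans (add_sub_cancel _ _)))
  refine ⟨W, hWU, X.famA.box.presheaf.map (homOfLE hWV).op f, hxW, ?_⟩
  refine (SheafAux.hom_app_map X.expMap hWV f).trans ?_
  exact congrArg Additive.ofMul (Units.ext h)

variable (hX : X.IsRibbon) (hS : X.StandingAssumptions) [AlgebraicGeometry.IsNoetherian S]

theorem expMap_orderMap : X.expMap ≫ X.orderMap hX hS = 0 :=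
  SheafAux.sheaf_hom_ext fun _ t => Subtype.ext (funext fun x => ULift.ext _ _
    (X.oneAddNilSec_ordAt hX hS (X.boxExpUnit_mem t) x.2))

/-- The exponential map `𝒩_S ⊠ 𝒜 → Ker(ord)`. -/
def expKer : X.famA.box ⟶ kernel (X.orderMap hX hS) :=
  kernel.lift _ X.expMap (X.expMap_orderMap hX hS)

theorem expKer_ι : X.expKer hX hS ≫ kernel.ι _ = X.expMap := kernel.lift_ι _ _ _

theorem expKer_app_ι {U : X.C.Opens} (t : X.famA.box.presheaf.obj (op U)) :
    (kernel.ι (X.orderMap hX hS)).hom.app (op U) ((X.expKer hX hS).hom.app (op U) t) =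
      X.expMap.hom.app (op U) t :=
  congrArg (fun k => k.hom.app (op U) t) (X.expKer_ι hX hS)

theorem exists_expKer_add_zeroKer {U : X.C.Opens}
    (s : (kernel (X.orderMap hX hS)).presheaf.obj (op U)) {x : X.C} (hx : x ∈ U) :
    ∃ (V : X.C.Opens) (hV : V ≤ U) (t : X.famA.box.presheaf.obj (op V))
      (b : X.unitsZero.presheaf.obj (op V)), x ∈ V ∧
      (X.expKer hX hS).hom.app (op V) t + (X.zeroKer hX hS).hom.app (op V) b =
        (kernel (X.orderMap hX hS)).presheaf.map (homOfLE hV).op s := by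
  obtain ⟨W, hW, b, c, hxW, h⟩ := (X.orderMap_app_eq_zero_iff hX hS U _).1
    (SheafAux.kernel_ι_app (X.orderMap hX hS) U s) x hx
  obtain ⟨V, hV, t, hxV, ht⟩ := X.exists_expMap_eq c.1 c.2 hxW
  refine ⟨V, hV.trans hW, t, X.unitsZero.presheaf.map (homOfLE hV).op b, hxV,
    SheafAux.app_injective_of_mono (kernel.ι (X.orderMap hX hS)) V ?_⟩
  refine (map_add _ _ _).trans ?_
  refine (congrArg₂ (· + ·) ((X.expKer_app_ι hX hS t).trans ht) ((X.zeroKer_app_ι hX hS _).trans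
    (SheafAux.hom_app_map X.unitsZeroι hV b))).trans ?_
  refine (add_comm _ _).trans ((map_add (X.A.unitsSheaf.presheaf.map (homOfLE hV).op).hom _ _).symm.trans ?_)
  refine Eq.trans ?_ (SheafAux.hom_app_map (kernel.ι (X.orderMap hX hS)) (hV.trans hW) s).symm
  refine (congrArg (X.A.unitsSheaf.presheaf.map (homOfLE hV).op) h.symm).trans ?_
  exact (ConcreteCategory.congr_hom
    (X.A.unitsSheaf.presheaf.map_comp (homOfLE hW).op (homOfLE hV).op) _).symm

variable [∀ x, Algebra ℚ (X.baseStalk x)]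

/-- Exponentials and units of 𝒜_0 generate the kernel locally, and an exponential lying in 𝒜_0 comes
locally from 𝒩 ⊠ 𝒜_0. In particular, so does anything killed by exp. -/
theorem isPushout_expKer :
    IsPushout X.boxIncl X.expMapZero (X.expKer hX hS) (X.zeroKer hX hS) := by
  have w : X.boxIncl ≫ X.expKer hX hS = X.expMapZero ≫ X.zeroKer hX hS := by
    rw [← cancel_mono (kernel.ι (X.orderMap hX hS)), Category.assoc, Category.assoc, X.expKer_ι,
      X.zeroKer_ι]
    rfl
  refine SheafAux.isPushout_of_locally w (fun U s x hx => X.exists_expKer_add_zeroKer hX hS s hx) ?_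
  intro U a b hab x hx
  have h : X.expMap.hom.app (op U) a = b.1 := (X.expKer_app_ι hX hS a).symm.trans
    ((congrArg ((kernel.ι (X.orderMap hX hS)).hom.app (op U)) hab).trans (X.zeroKer_app_ι hX hS b))
  have h0 : X.boxExp (a.1 ⟨x, hx⟩) ∈ X.A.stalkFil 0 x := by
    refine Set.mem_of_eq_of_mem ((X.germ_boxExpUnit a hx).symm.trans ?_)
      (X.A.germ_mem_stalkFil hx b.2.1)
    exact congrArg (fun c => X.A.germ hx (X.A.unitVal c)) h
  obtain ⟨W, hW, c, hxW, hc⟩ := X.exists_boxIncl_eq a hx (X.exists_lTensor_eq_of_boxExp_mem hX _ h0)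
  -- That exp(c) equals b is tested in Ker(ord), where commutativity of the square and the equality
  -- of a and b apply.
  refine ⟨W, hW, c, hxW, hc, SheafAux.app_injective_of_mono (X.zeroKer hX hS) W ?_⟩
  refine (congrArg (fun k => k.hom.app (op W) c) w).symm.trans ?_
  refine (congrArg ((X.expKer hX hS).hom.app (op W)) hc).trans ?_
  refine (SheafAux.hom_app_map (X.expKer hX hS) hW a).trans ?_
  exact (congrArg _ hab).trans (SheafAux.hom_app_map (X.zeroKer hX hS) hW b).symm

/-- The map `Ker(ord) → 𝒩_S ⊠ (𝒜 / 𝒜_0)` sending `exp t` to the class of `t`. -/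
def logKer : kernel (X.orderMap hX hS) ⟶ X.famQuot.box :=
  (X.isPushout_expKer hX hS).desc X.boxProj 0 (X.boxIncl_boxProj.trans comp_zero.symm)

theorem expKer_logKer : X.expKer hX hS ≫ X.logKer hX hS = X.boxProj :=
  (X.isPushout_expKer hX hS).inl_desc _ _ _

theorem zeroKer_logKer : X.zeroKer hX hS ≫ X.logKer hX hS = 0 :=
  (X.isPushout_expKer hX hS).inr_desc _ _ _

instance epi_logKer : Epi (X.logKer hX hS) :=
  epi_of_epi_fac (X.expKer_logKer hX hS)

/-- A local section exp(t)·b has logarithm the class of t; if this vanishes, right exactness of the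
tensor product puts t in the image of 𝒩 ⊠ 𝒜_0, and exp(t)·b lies in 𝒜_0^*. -/
theorem exact_zeroKer_logKer :
    (ShortComplex.mk _ _ (X.zeroKer_logKer hX hS)).Exact := by
  refine SheafAux.exact_of_locally _ _ _ fun U s hs x hx => ?_
  obtain ⟨V, hV, t, b, hxV, h⟩ := X.exists_expKer_add_zeroKer hX hS s hx
  have h0 : X.boxProj.hom.app (op V) t = 0 := by
    have h1 := congrArg ((X.logKer hX hS).hom.app (op V)) h
    have h2 := h1.trans ((SheafAux.hom_app_map (X.logKer hX hS) hV s).trans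
      ((congrArg _ hs).trans (map_zero _)))
    refine Eq.trans ?_ h2
    refine Eq.trans ?_ (map_add _ _ _).symm
    refine ((congrArg₂ (· + ·) ?_ ?_).trans (add_zero _)).symm
    · exact congrArg (fun k => k.hom.app (op V) t) (X.expKer_logKer hX hS)
    · exact congrArg (fun k => k.hom.app (op V) b) (X.zeroKer_logKer hX hS)
  have h3 : (X.stalkSub 0 x).mkQ.lTensor (X.nilStalk x) (t.1 ⟨x, hxV⟩) = 0 :=
    congrFun (congrArg Subtype.val h0) ⟨x, hxV⟩
  have hex := lTensor_exact (X.nilStalk x)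
    (LinearMap.exact_subtype_mkQ (X.stalkSub 0 x)) (Submodule.mkQ_surjective _)
  obtain ⟨W, hW, t₀, hxW, ht₀⟩ := X.exists_boxIncl_eq t hxV ((hex _).1 h3)
  refine ⟨W, hW.trans hV, X.expMapZero.hom.app (op W) t₀ +
    X.unitsZero.presheaf.map (homOfLE hW).op b, hxW, ?_⟩
  have h4 : (X.zeroKer hX hS).hom.app (op W) (X.expMapZero.hom.app (op W) t₀) =
      (kernel (X.orderMap hX hS)).presheaf.map (homOfLE hW).op
        ((X.expKer hX hS).hom.app (op V) t) := by
    refine (congrArg (fun k => k.hom.app (op W) t₀) (X.isPushout_expKer hX hS).w).symm.trans ?_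
    exact (congrArg ((X.expKer hX hS).hom.app (op W)) ht₀).trans
      (SheafAux.hom_app_map (X.expKer hX hS) hW t)
  refine (map_add _ _ _).trans ?_
  refine (congrArg₂ (· + ·) h4 (SheafAux.hom_app_map (X.zeroKer hX hS) hW b)).trans ?_
  refine (map_add ((kernel (X.orderMap hX hS)).presheaf.map (homOfLE hW).op).hom _ _).symm.trans ?_
  refine (congrArg ((kernel (X.orderMap hX hS)).presheaf.map (homOfLE hW).op) h).trans ?_
  exact (ConcreteCategory.congr_hom
      ((kernel (X.orderMap hX hS)).presheaf.map_comp (homOfLE hV).op (homOfLE hW).op) s).symm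

theorem expSequences_orderMap (hu : ∀ x, X.A.HasUniformizer x) :
    X.ExpSequences (X.orderMap hX hS) := by
  have hepi : Epi (X.orderMap hX hS) := SheafAux.epi_of_locally_surjective _ fun U f x hx => by
    obtain ⟨W, hW, a, hxW, h⟩ := X.surjectiveOn_orderMap hX hS (U := ⊤) (fun x _ => hu x) U le_top f x hx
    exact ⟨W, hW, a, hxW, h⟩
  have hφ' := cokernel.π_desc X.unitsZeroι (X.orderMap hX hS) (X.unitsZeroι_orderMap hX hS)
  -- The logarithm presents 𝒩 ⊠ (𝒜/𝒜_0) as Ker(ord)/𝒜_0^*, so the middle sequence is obtained from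
  -- the order sequence by dividing out 𝒜_0^*.
  obtain ⟨δ, hδ, w, hδ'⟩ := exists_shortExact_cokernel (X.orderMap hX hS) X.unitsZeroι
    (X.zeroKer hX hS) (X.zeroKer_ι hX hS) (X.logKer hX hS) (X.zeroKer_logKer hX hS)
    (X.exact_zeroKer_logKer hX hS) _ hφ'
  refine ⟨X.zeroKer hX hS, X.expKer hX hS, X.expMapZero, _, δ, X.logKer hX hS, X.zeroKer_ι hX hS,
    ?_, ?_, X.isPushout_expKer hX hS, ?_, hφ', ?_, ⟨w, hδ'⟩, X.expKer_logKer hX hS,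
    X.zeroKer_logKer hX hS, ?_⟩
  · intro V U h n hn a
    rw [X.expKer_ι]
    exact X.unitVal_expMap_tmulA h n hn a
  · intro V U h n hn a ha
    exact X.unitVal_expMap_tmulA h n hn a
  · have h1 : Mono (ShortComplex.mk _ _ (kernel.condition (X.orderMap hX hS))).f :=
      inferInstanceAs (Mono (kernel.ι _))
    have h2 : Epi (ShortComplex.mk _ _ (kernel.condition (X.orderMap hX hS))).g := hepi
    exact ⟨ShortComplex.exact_of_f_is_kernel _ (kernelIsKernel _)⟩
  · rw [← X.expKer_logKer hX hS, Category.assoc, hδ]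
  · have h1 : Mono (ShortComplex.mk _ _ (X.zeroKer_logKer hX hS)).f := X.mono_zeroKer hX hS
    have h2 : Epi (ShortComplex.mk _ _ (X.zeroKer_logKer hX hS)).g := X.epi_logKer hX hS
    exact ⟨X.exact_zeroKer_logKer hX hS⟩

end PreRibbon

end

/-! ### Characteristic zero, base change and the main theorem -/

noncomputable section

namespace PreRibbon

variable {S : Scheme.{u}} (X : PreRibbon S)

theorem expSequences_orderMap_of_field (hX : X.IsRibbon) (hS : X.StandingAssumptions)
    [AlgebraicGeometry.IsNoetherian S] (hu : ∀ x, X.A.HasUniformizer x) (k : Type u) [Field k]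
    [CharZero k] (f : S ⟶ Spec (.of k)) : X.ExpSequences (X.orderMap hX hS) := by
  -- The structure morphism to Spec k gives ℚ → k → Γ(S), and hence all the ℚ-algebra structures
  -- required by the exponential.
  let g : ℚ →+* Γ(S, ⊤) :=
    (f.appTop.hom.comp (Scheme.ΓSpecIso (.of k)).inv.hom).comp (algebraMap ℚ k)
  let (x : X.C) : Algebra ℚ (X.baseStalk x) :=
    ((S.presheaf.germ ⊤ (X.τ x) trivial).hom.comp g).toAlgebra
  let (x : X.C) : Algebra ℚ (X.A.stalk x) :=
    ((X.stalkAlg x).comp (algebraMap ℚ (X.baseStalk x))).toAlgebra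
  let (U : X.C.Opens) : Algebra ℚ (X.A.sec U) :=
    ((X.algMap (V := ⊤) le_top).comp g).toAlgebra
  exact X.expSequences_orderMap hX hS hu

variable {X}

/-- Sections of order one with inverse of order -1 pull back along the filtered homomorphism, so
base change requires no passage through the fibres. -/
theorem BaseChangeData.hasUniformizer {S' : Scheme.{u}} {α : S' ⟶ S} {X' : PreRibbon S'}
    (d : X.BaseChangeData α X') {x : X'.C} (h : X.A.HasUniformizer (d.p x)) :
    X'.A.HasUniformizer x := by
  obtain ⟨U, hU, t, ht, ht'⟩ := h
  exact ⟨d.p ⁻¹ᵁ U, hU, Units.map (d.φ.app (op U)).hom.toMonoidHom t,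
    d.φ_fil 1 U _ ht, d.φ_fil (-1) U _ ht'⟩

end PreRibbon

theorem FilteredRingSheaf.StarStar.hasUniformizer {C : Scheme.{u}} {A : FilteredRingSheaf C.carrier}
    (h : A.StarStar) (x : C) : A.HasUniformizer x := by
  obtain ⟨𝒰, hcover, h𝒰⟩ := h
  obtain ⟨U, hU, hx⟩ := hcover x
  exact ⟨U, hx, (h𝒰 U hU).2⟩

end

theorem mainTheorem12 {S : Scheme.{u}} [AlgebraicGeometry.IsNoetherian S] (X : PreRibbon S)
    (hX : X.IsRibbon) (hS : X.StandingAssumptions) :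
    ∃ φ : X.A.unitsSheaf ⟶ SheafAux.constZ X.C.carrier,
      -- the order map is a morphism of sheaves of groups `𝒜^* → ℤ_C`
      X.IsOrderMap φ ∧
      -- it is surjective on a neighbourhood of each `P_s`
      (∀ (s : S) (P : X.τ.fiber s), (X.fiberA s).IsInvertibleAt P →
        ∃ U : X.C.Opens, IsAffineOpen U ∧ X.τ.fiberι s P ∈ U ∧ X.SurjectiveOn φ U) ∧
      -- its kernel is `𝒜_0^* · (1 + 𝒩_S 𝒜)`
      (∀ (U : X.C.Opens) (a : X.A.unitsSheaf.presheaf.obj (op U)), φ.hom.app (op U) a = 0 ↔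
        ∀ x ∈ U, ∃ (W : X.C.Opens) (h : W ≤ U) (b : X.unitsZero.presheaf.obj (op W))
          (c : X.oneAddNil.presheaf.obj (op W)), x ∈ W ∧
          X.A.unitsSheaf.presheaf.map (homOfLE h).op a =
            X.unitsZeroι.hom.app (op W) b + X.oneAddNilι.hom.app (op W) c) ∧
      -- its kernel is the amalgamated sum of `𝒜_0^*` and `1 + 𝒩_S 𝒜` over `1 + 𝒩_S 𝒜_0`
      (∃ (i₁ : X.unitsZero ⟶ kernel φ) (i₂ : X.oneAddNil ⟶ kernel φ),
        i₁ ≫ kernel.ι φ = X.unitsZeroι ∧ i₂ ≫ kernel.ι φ = X.oneAddNilι ∧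
        IsPushout X.oneAddNilZeroToUnitsZero X.oneAddNilZeroToOneAddNil i₁ i₂) ∧
      -- global surjectivity when all fibres satisfy `(**)`
      ((∀ s, (X.fiberA s).StarStar) → X.SurjectiveOn φ ⊤) ∧
      -- the exponential description in characteristic zero when all fibres satisfy `(**)`
      (∀ (k : Type u) [Field k] [CharZero k] (_ : S ⟶ Spec (.of k)),
        (∀ s, (X.fiberA s).StarStar) → X.ExpSequences φ) ∧
      -- in particular for base changes of ribbons over `k` with `(**)`
      (∀ (k : Type u) [Field k] [CharZero k] (f : S ⟶ Spec (.of k)) (X₀ : PreRibbon (Spec (.of k))),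
        X₀.IsRibbon → X₀.A.StarStar → Nonempty (X₀.BaseChangeData f X) → X.ExpSequences φ) := by
  refine ⟨X.orderMap hX hS, X.isOrderMap_orderMap hX hS, ?_, X.orderMap_app_eq_zero_iff hX hS,
    X.isPushout_kernel_orderMap hX hS, ?_, ?_, ?_⟩
  · intro s P hP
    obtain ⟨U, hU, t, ht, ht'⟩ := X.hasUniformizer_of_isInvertibleAt hX P hP
    obtain ⟨_, ⟨W, hW, rfl⟩, hPW, hWU⟩ := X.C.isBasis_affineOpens.exists_subset_of_mem_open
      hU U.isOpen
    exact ⟨W, hW, hPW, X.surjectiveOn_orderMap hX hS fun x hx => ⟨U, hWU hx, t, ht, ht'⟩⟩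
  · intro h
    exact X.surjectiveOn_orderMap hX hS fun x _ => X.hasUniformizer_of_starStar hX h x
  · intro k _ _ f h
    exact X.expSequences_orderMap_of_field hX hS (X.hasUniformizer_of_starStar hX h) k f
  · rintro k _ _ f X₀ - h₀ ⟨d⟩
    exact X.expSequences_orderMap_of_field hX hS (fun x => d.hasUniformizer (h₀.hasUniformizer _)) k f
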